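/- Let $n\ge 0$ be an integer and $\delta\in\mathbb C$. **Brauer algebra.** A Brauer diagram is a perfect matching (by "lines") of $n$ upper and $n$ lower nodes; $B_n(\delta)$ is the complex vector space with basis the Brauer diagrams, and $b_1b_2=\delta^{\ell}\,b$, where $b$ is obtained by placing $b_1$ below $b_2$, identifying the upper nodes of $b_1$ with the lower nodes of $b_2$, straightening the lines and omitting the $\ell$ closed loops. A permutation $s\in S_n$ is the diagram joining the upper node $i$ to the lower node $s(i)$. Let $C_n(\delta)$ be the centraliser of $\mathbb CS_n$ in $B_n(\delta)$, let $\gamma_b=\sum_{s\in S_n}sbs^{-1}$ for a diagram $b$, and let $A_n=\sum_{1\le i<j\le n}d_{ij}$, where $d_{ij}$ has an arc joining the upper nodes $i,j$, an arc joining the lower nodes $i,j$, and vertical lines elsewhere. **Bracelets.** A bracelet $[w]$ is the class of a non-empty word $w$ under cyclic permutations and reversal $w\mapsto I(w)$. Let $\mathcal A=\{n,s,p\}$ and let $\mathfrak b(\mathcal A)$ be the set of bracelets over $\mathcal A$ with equally many letters $n$ and $s$ such that, in every representative, any two letters $n$ have a letter $s$ between them and any two letters $s$ have a letter $n$ between them.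 Let $\bar{\mathcal A}=\mathcal A\cup\{\dot s,\dot p,\ddot s\}$, and let $\mathfrak b(\bar{\mathcal A})$ be the set of bracelets over $\bar{\mathcal A}$ which lie in $\mathfrak b(\mathcal A)$ after removal of all dots. Let $\mathbb C[\mathfrak b(\mathcal A)]\subset\mathbb C[\mathfrak b(\bar{\mathcal A})]$ be the polynomial algebras on these sets, $\mathbb C[\mathfrak b(\mathcal A)]_n$ the part of degree $n$ (a bracelet having its length as degree), and $\mathbb C[\mathfrak b(\bar{\mathcal A})]''$ the span of the monomials carrying two dots in total. **The basis.** Define a linear map $\Phi$ on $B_n(\delta)$ by $\Phi(b)=\frac1{n!}[w_1]\cdots[w_r]$ for a diagram $b$: label the arcs of the upper row by $n$, those of the lower row by $s$ and the vertical lines by $p$, identify each upper node with the lower node below it, and read off the bracelets $[w_1],\dots,[w_r]$ of the resulting loops. Each $\Phi(\gamma_b)$ is a monic monomial $\zeta$ of degree $n$ in $\mathbb C[\mathfrak b(\mathcal A)]$. Put $e_\zeta=\gamma_b$ for $\zeta=\Phi(\gamma_b)$; this is well defined, and the $e_\zeta$, with $\zeta$ running over all monic monomials of $\mathbb C[\mathfrak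 b(\mathcal A)]_n$, form a basis of $C_n(\delta)$. Extend $\zeta\mapsto e_\zeta$ linearly to $\mathbb C[\mathfrak b(\mathcal A)]_n$. **The derivation.** $\partial$ is the $\mathbb C$-linear derivation of the polynomial algebra generated by the bracelets over $\bar{\mathcal A}$ with $\partial[a_1\dots a_\ell]=\sum_j[a_1\dots\partial(a_j)\dots a_\ell]$, where $\partial(s)=\dot s$, $\partial(p)=\dot p$, $\partial(\dot s)=\ddot s$, $\partial(n)=\partial(\dot p)=\partial(\ddot s)=0$. It satisfies $\partial^2\big(\mathbb C[\mathfrak b(\mathcal A)]_n\big)\subset\mathbb C[\mathfrak b(\bar{\mathcal A})]''$. **The trace.** Call a word $w$ over $\mathcal A$ fit if it is empty, or if $[w]\in\mathfrak b(\mathcal A)$ and each occurrence of $s$ in $w$ is followed by an $n$ somewhere on its right; $|w|_a$ is the number of letters $a$ in $w$. There is exactly one $\mathbb C[\mathfrak b(\mathcal A)]$-linear map $\tau:\mathbb C[\mathfrak b(\bar{\mathcal A})]''\to\mathbb C[\mathfrak b(\mathcal A)]$ such that, for all (possibly empty) words $u,v$ over $\mathcal A$ for which the bracelets on the left lie in $\mathfrak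 b(\bar{\mathcal A})$, $$\tau[\ddot su]=2\delta[su],$$ $$\tau[\dot su\dot sv]=2\big([su\,s\,I(v)]+[su][sv]\big),\qquad \tau\big([\dot su][\dot sv]\big)=2\big([susv]+[su\,s\,I(v)]\big),$$ $$\tau[\dot pu\dot sv]=[pu\,s\,I(v)]+[pu][sv],\qquad \tau\big([\dot pu][\dot sv]\big)=[pusv]+[pu\,s\,I(v)]\qquad(u\text{ fit}),$$ $$\tau[\dot pu\dot pv]=[nu\,s\,I(v)]\ \ (u,v\text{ fit}),\qquad \tau[\dot pu\dot pv]=[nu][sv]\ \ (|u|_s>|u|_n),\qquad \tau\big([\dot pu][\dot pv]\big)=[nu\,s\,I(v)]\ \ (u,v\text{ fit}).$$ **Theorem.** There is exactly one linear operator $\Delta$ on $\mathbb C[\mathfrak b(\mathcal A)]_n$ with $A_n\,e_\zeta=e_{\Delta(\zeta)}$ for all $\zeta\in\mathbb C[\mathfrak b(\mathcal A)]_n$, and it is the second-order differential operator $$\Delta=\tfrac12\,\tau\circ\partial^2 .$$ The formal statement contains, besides this, the assertions above that $\tau$ exists and is unique, that $e_\zeta$ is well defined, that the $e_\zeta$ form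 a basis of $C_n(\delta)$, and that $\partial^2$ maps $\mathbb C[\mathfrak b(\mathcal A)]_n$ into $\mathbb C[\mathfrak b(\bar{\mathcal A})]''$. -/

import Mathlib

open MvPolynomial

/-! ### Curves drawn by two involutions -/

/-- The curves obtained from two families of links `f`, `g` on a set of nodes: two nodes lie on the
same curve iff one gets from one to the other through the links `x -- f x` and `x -- g x`. -/
def curveSetoid {α : Type} (f g : α → α) : Setoid α :=
  Relation.EqvGen.setoid fun x y => y = f x ∨ y = g x

noncomputable instance {α : Type} [Fintype α] (f g : α → α) :
    Fintype (Quotient (curveSetoid f g)) :=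
  Fintype.ofFinite _

/-! ### Brauer diagrams -/

/-- A Brauer diagram on `n` upper nodes `Sum.inl i` and `n` lower nodes `Sum.inr i`: a perfect
matching of the `2 n` nodes, `partner x` being the other endpoint of the line through `x`. -/
@[ext]
structure BrauerDiagram (n : ℕ) where
  partner : Fin n ⊕ Fin n → Fin n ⊕ Fin n
  partner_partner : ∀ x, partner (partner x) = x
  partner_ne : ∀ x, partner x ≠ x

namespace BrauerDiagram

variable {n : ℕ}

/-- The diagram of a permutation: the upper node `i` is joined to the lower node `s i`. -/
def ofPerm (s : Equiv.Perm (Fin n)) : BrauerDiagram n where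
  partner := Sum.elim (fun i => Sum.inr (s i)) (fun i => Sum.inl (s.symm i))
  partner_partner := by rintro (i | i) <;> simp
  partner_ne := by rintro (i | i) <;> simp

/-- The diagram `d_{ij}` (for `i ≠ j`): an arc joining the upper nodes `i`, `j`, an arc joining the
lower nodes `i`, `j`, and vertical lines at all the other positions `k`, that is, at those `k` with
`Equiv.swap i j k = k`. -/
def arcs (i j : Fin n) : BrauerDiagram n where
  partner := Sum.elim
    (fun k => if Equiv.swap i j k = k then Sum.inr k else Sum.inl (Equiv.swap i j k))
    (fun k => if Equiv.swap i j k = k then Sum.inl k else Sum.inr (Equiv.swap i j k))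
  partner_partner := by
    rintro (k | k) <;> by_cases h : Equiv.swap i j k = k
    · simp [h]
    · simp [h, Ne.symm h]
    · simp [h]
    · simp [h, Ne.symm h]
  partner_ne := by
    rintro (k | k) <;> by_cases h : Equiv.swap i j k = k <;> simp [h]

/-! #### Stacking two diagrams -/

/-- The nodes of two diagrams placed one below the other: `Sum.inl x` is the node `x` of the lower
diagram, `Sum.inr x` is the node `x` of the upper one. -/
abbrev StackNode (n : ℕ) : Type := (Fin n ⊕ Fin n) ⊕ (Fin n ⊕ Fin n)

/-- The lines of the stacked diagrams, `b₁` below `b₂`. -/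
def stackLine (b₁ b₂ : BrauerDiagram n) : StackNode n → StackNode n :=
  Sum.map b₁.partner b₂.partner

/-- The identification of the upper nodes of the lower diagram with the lower nodes of the upper
diagram; the outer nodes are fixed. -/
def glue : StackNode n → StackNode n
  | Sum.inl (Sum.inl i) => Sum.inr (Sum.inr i)
  | Sum.inr (Sum.inr i) => Sum.inl (Sum.inl i)
  | Sum.inl (Sum.inr i) => Sum.inl (Sum.inr i)
  | Sum.inr (Sum.inl i) => Sum.inr (Sum.inl i)

/-- The outer nodes of the stack: the upper nodes of the upper diagram and the lower nodes of the
lower diagram. -/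
def outer : Fin n ⊕ Fin n → StackNode n
  | Sum.inl i => Sum.inr (Sum.inl i)
  | Sum.inr i => Sum.inl (Sum.inr i)

/-- The curves of the stack of `b₁` below `b₂`. -/
abbrev stackCurves (b₁ b₂ : BrauerDiagram n) : Setoid (StackNode n) :=
  curveSetoid (stackLine b₁ b₂) glue

theorem glue_glue (x : StackNode n) : glue (glue x) = x := by
  rcases x with (i | i) | (i | i) <;> rfl

theorem glue_outer (x : Fin n ⊕ Fin n) : glue (outer x) = outer x := by
  rcases x with i | i <;> rfl

theorem outer_injective : Function.Injective (outer : Fin n ⊕ Fin n → StackNode n) := by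
  rintro (i | i) (j | j) h <;> simp_all [outer]

theorem exists_outer_of_glue {x : StackNode n} (h : glue x = x) : ∃ y, x = outer y := by
  rcases x with (i | i) | (i | i)
  · simp [glue] at h
  · exact ⟨Sum.inr i, rfl⟩
  · exact ⟨Sum.inl i, rfl⟩
  · simp [glue] at h

theorem stackLine_stackLine (b₁ b₂ : BrauerDiagram n) (x : StackNode n) :
    stackLine b₁ b₂ (stackLine b₁ b₂ x) = x := by
  rcases x with x | x <;> simp [stackLine, partner_partner]

theorem stackLine_ne (b₁ b₂ : BrauerDiagram n) (x : StackNode n) : stackLine b₁ b₂ x ≠ x := by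
  rcases x with x | x <;> simp [stackLine, partner_ne]

/-- Every curve of the stack that contains an outer node contains exactly one other outer node. -/
theorem existsUnique_stack (b₁ b₂ : BrauerDiagram n) (x : Fin n ⊕ Fin n) :
    ∃! y, y ≠ x ∧ stackCurves b₁ b₂ (outer x) (outer y) := by
  let σ : Equiv.Perm (StackNode n) :=
    Function.Involutive.toPerm (stackLine b₁ b₂) (stackLine_stackLine b₁ b₂)
  let ι : Equiv.Perm (StackNode n) := Function.Involutive.toPerm glue glue_glue
  have hσσ : σ * σ = 1 := Equiv.ext (stackLine_stackLine b₁ b₂)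
  have hιι : ι * ι = 1 := Equiv.ext glue_glue
  have hσi : σ⁻¹ = σ := inv_eq_of_mul_eq_one_left hσσ
  have hιi : ι⁻¹ = ι := inv_eq_of_mul_eq_one_left hιι
  let π : Equiv.Perm (StackNode n) := ι * σ
  have hσπ : σ = ι * π := by simp [π, ← mul_assoc, hιι]
  have hconj : ι * π * ι⁻¹ = π⁻¹ := by
    simp only [π, mul_inv_rev, hιi, hσi]
    rw [← mul_assoc, hιι, one_mul]
  have hιz : ∀ (k : ℤ) (z : StackNode n), ι ((π ^ k) z) = (π ^ (-k)) (ι z) := by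
    intro k z
    have h1 : ι * π ^ k * ι⁻¹ = π ^ (-k) := by rw [← conj_zpow, hconj, inv_zpow, zpow_neg]
    have h2 : ι * π ^ k = π ^ (-k) * ι := by rw [← h1]; simp
    exact congrArg (fun e : Equiv.Perm (StackNode n) => e z) h2
  have hιx : ι (outer x) = outer x := glue_outer x
  -- the curve of `outer x` is its orbit under `π`
  have horbit : ∀ z w, stackCurves b₁ b₂ z w →
      ((∃ k : ℤ, (π ^ k) (outer x) = z) ↔ ∃ k : ℤ, (π ^ k) (outer x) = w) := by
    have hι1 : ∀ z, (∃ k : ℤ, (π ^ k) (outer x) = z) → ∃ k : ℤ, (π ^ k) (outer x) = ι z := by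
      rintro z ⟨k, rfl⟩
      exact ⟨-k, by rw [hιz, hιx]⟩
    have hσ1 : ∀ z, (∃ k : ℤ, (π ^ k) (outer x) = z) → ∃ k : ℤ, (π ^ k) (outer x) = σ z := by
      rintro z ⟨k, rfl⟩
      refine ⟨-(1 + k), ?_⟩
      rw [hσπ, Equiv.Perm.mul_apply, ← Equiv.Perm.mul_apply π, ← zpow_one_add, hιz, hιx]
    intro z w h
    induction h with
    | rel z w h =>
      rcases h with rfl | rfl
      · exact ⟨hσ1 z, fun h => by
          have := hσ1 _ h
          rwa [show σ (stackLine b₁ b₂ z) = z from stackLine_stackLine b₁ b₂ z] at this⟩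
      · exact ⟨hι1 z, fun h => by
          have := hι1 _ h
          rwa [show ι (glue z) = z from glue_glue z] at this⟩
    | refl => exact Iff.rfl
    | symm _ _ _ ih => exact ih.symm
    | trans _ _ _ _ _ ih1 ih2 => exact ih1.trans ih2
  have hcurve : ∀ k : ℕ, stackCurves b₁ b₂ (outer x) ((π ^ k) (outer x)) := by
    intro k
    induction k with
    | zero => exact Relation.EqvGen.refl _
    | succ k ih =>
      rw [pow_succ', Equiv.Perm.mul_apply]
      exact ih.trans _ _ _ (Relation.EqvGen.trans _ _ _
        (Relation.EqvGen.rel _ _ (Or.inl rfl)) (Relation.EqvGen.rel _ _ (Or.inr rfl)))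
  -- the period of `outer x` under `π` is positive and even
  have hper : ∀ k : ℤ, (π ^ k) (outer x) = outer x ↔
      (Function.minimalPeriod π (outer x) : ℤ) ∣ k := by
    intro k
    have := MulAction.zpow_smul_eq_iff_minimalPeriod_dvd (a := π) (b := outer x) (n := k)
    simpa using this
  have hpos : 0 < Function.minimalPeriod π (outer x) := by
    apply Function.minimalPeriod_pos_of_mem_periodicPts
    exact π.injective.mem_periodicPts _
  set p := Function.minimalPeriod π (outer x) with hp
  have heven : Even p := by
    by_contra hodd
    obtain ⟨m, hm⟩ := Nat.not_even_iff_odd.1 hodd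
    apply stackLine_ne b₁ b₂ ((π ^ (m : ℤ)) (outer x))
    change σ _ = _
    rw [hσπ, Equiv.Perm.mul_apply, ← Equiv.Perm.mul_apply π, ← zpow_one_add, hιz, hιx]
    have h1 : (π ^ (p : ℤ)) (outer x) = outer x := (hper _).2 dvd_rfl
    conv_lhs => rw [← h1]
    rw [← Equiv.Perm.mul_apply, ← zpow_add]
    congr 2
    omega
  obtain ⟨m, hm⟩ := heven
  have hfix : ι ((π ^ (m : ℤ)) (outer x)) = (π ^ (m : ℤ)) (outer x) := by
    have h1 : (π ^ (p : ℤ)) (outer x) = outer x := (hper _).2 dvd_rfl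
    rw [hιz, hιx]
    conv_lhs => rw [← h1]
    rw [← Equiv.Perm.mul_apply, ← zpow_add]
    congr 2
    omega
  obtain ⟨y, hy⟩ := exists_outer_of_glue (x := (π ^ (m : ℤ)) (outer x)) hfix
  refine ⟨y, ⟨?_, ?_⟩, ?_⟩
  · rintro rfl
    have := (hper m).1 hy
    have := Nat.le_of_dvd (by omega) (Int.natCast_dvd_natCast.1 this)
    omega
  · rw [← hy, zpow_natCast]
    exact hcurve m
  · rintro z ⟨hz, hxz⟩
    obtain ⟨k, hk⟩ := (horbit _ _ hxz).1 ⟨0, rfl⟩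
    have h2 : (π ^ (-k)) (outer x) = (π ^ k) (outer x) := by
      conv_lhs => rw [← hιx, ← hιz, hk]
      rw [hk]
      exact glue_outer z
    have h3 : (π ^ (k + k)) (outer x) = outer x := by
      rw [zpow_add, Equiv.Perm.mul_apply, ← h2, ← Equiv.Perm.mul_apply, ← zpow_add]
      simp
    obtain ⟨t, ht⟩ := (hper _).1 h3
    have hkt : k = m * t := by
      have : 2 * k = 2 * (m * t) := by rw [two_mul, ht, hm]; push_cast; ring
      omega
    apply outer_injective
    rw [← hy, ← hk]
    rcases Int.even_or_odd' t with ⟨q, hq | hq⟩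
    · refine absurd (outer_injective ?_) hz
      rw [← hk]
      refine (hper k).2 ⟨q, ?_⟩
      rw [hkt, hq, hm]; push_cast; ring
    · have h4 : (π ^ ((p : ℤ) * q)) (outer x) = outer x := (hper _).2 ⟨q, rfl⟩
      have h5 : k = m + p * q := by rw [hkt, hq, hm]; push_cast; ring
      rw [h5, zpow_add, Equiv.Perm.mul_apply, h4]

/-- The diagram obtained by placing `b₁` below `b₂`, identifying the upper nodes of `b₁` with the
lower nodes of `b₂`, omitting the loops and straightening the lines: the partner of an outer node is
the other outer node on the same curve. -/
noncomputable def stack (b₁ b₂ : BrauerDiagram n) : BrauerDiagram n where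
  partner x := (existsUnique_stack b₁ b₂ x).choose
  partner_partner x := by
    have h1 := (existsUnique_stack b₁ b₂ x).choose_spec.1
    have h2 := (existsUnique_stack b₁ b₂ (existsUnique_stack b₁ b₂ x).choose).choose_spec.2
    exact (h2 x ⟨h1.1.symm, Relation.EqvGen.symm _ _ h1.2⟩).symm
  partner_ne x := (existsUnique_stack b₁ b₂ x).choose_spec.1.1

theorem stack_partner_eq_iff (b₁ b₂ : BrauerDiagram n) (x y : Fin n ⊕ Fin n) :
    (stack b₁ b₂).partner x = y ↔ y ≠ x ∧ stackCurves b₁ b₂ (outer x) (outer y) := by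
  constructor
  · rintro rfl
    exact (existsUnique_stack b₁ b₂ x).choose_spec.1
  · intro h
    exact ((existsUnique_stack b₁ b₂ x).choose_spec.2 y h).symm

/-- The number of loops in the stack of `b₁` below `b₂`: the curves without outer nodes. -/
noncomputable def loops (b₁ b₂ : BrauerDiagram n) : ℕ :=
  Nat.card {c : Quotient (stackCurves b₁ b₂) //
    ∀ x, (Quotient.mk (stackCurves b₁ b₂) (outer x)) ≠ c}

end BrauerDiagram

/-! ### The Brauer algebra -/

/-- The Brauer algebra `B_n(δ)`: the complex vector space with basis the Brauer diagrams. -/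
def BrauerAlgebra (n : ℕ) (_δ : ℂ) : Type := BrauerDiagram n →₀ ℂ

namespace BrauerAlgebra

variable {n : ℕ} {δ : ℂ}

noncomputable instance : AddCommGroup (BrauerAlgebra n δ) :=
  inferInstanceAs (AddCommGroup (BrauerDiagram n →₀ ℂ))

noncomputable instance : Module ℂ (BrauerAlgebra n δ) :=
  inferInstanceAs (Module ℂ (BrauerDiagram n →₀ ℂ))

/-- A diagram as an element of the Brauer algebra. -/
noncomputable def diagram (δ : ℂ) (b : BrauerDiagram n) : BrauerAlgebra n δ :=
  Finsupp.single b 1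

/-- The bilinear product with `b₁ b₂ = δ ^ ℓ • (b₁ stacked below b₂)` for diagrams, where `ℓ` is the
number of loops. -/
noncomputable instance : Mul (BrauerAlgebra n δ) where
  mul x y := Finsupp.sum x fun b₁ r => Finsupp.sum y fun b₂ t =>
    (r * t * δ ^ BrauerDiagram.loops b₁ b₂) • diagram δ (BrauerDiagram.stack b₁ b₂)

/-- A permutation as an element of the Brauer algebra. -/
noncomputable def perm (δ : ℂ) (s : Equiv.Perm (Fin n)) : BrauerAlgebra n δ :=
  diagram δ (BrauerDiagram.ofPerm s)

/-- The average `γ_b = ∑_s s b s⁻¹` of a diagram `b` over the symmetric group. -/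
noncomputable def average (δ : ℂ) (b : BrauerDiagram n) : BrauerAlgebra n δ :=
  ∑ s : Equiv.Perm (Fin n), perm δ s * diagram δ b * perm δ s⁻¹

theorem add_mul' (x y z : BrauerAlgebra n δ) : (x + y) * z = x * z + y * z := by
  refine Finsupp.sum_add_index' (f := x) (g := y) (fun b => ?_) (fun b r r' => ?_)
  · simp [Finsupp.sum]
  · refine Eq.trans (Finsupp.sum_congr fun c _ => ?_) (Finsupp.sum_add (f := z))
    rw [← add_smul]; congr 1; ring

theorem mul_add' (x y z : BrauerAlgebra n δ) : x * (y + z) = x * y + x * z := by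
  refine Eq.trans (Finsupp.sum_congr fun b _ => ?_) (Finsupp.sum_add (f := x))
  refine Finsupp.sum_add_index' (f := y) (g := z) (fun c => ?_) (fun c r r' => ?_)
  · simp
  · rw [← add_smul]; congr 1; ring

theorem smul_mul' (a : ℂ) (x y : BrauerAlgebra n δ) : (a • x) * y = a • (x * y) := by
  refine (Finsupp.sum_smul_index (g := x) (b := a) (fun b => ?_)).trans ?_
  · simp [Finsupp.sum]
  · refine Eq.trans (Finsupp.sum_congr fun b _ => ?_) (Finsupp.smul_sum (v := x)).symm
    refine Eq.trans (Finsupp.sum_congr fun c _ => ?_) (Finsupp.smul_sum (v := y)).symm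
    rw [smul_smul]; congr 1; ring

theorem mul_smul' (a : ℂ) (x y : BrauerAlgebra n δ) : x * (a • y) = a • (x * y) := by
  refine Eq.trans (Finsupp.sum_congr fun b _ => ?_) (Finsupp.smul_sum (v := x)).symm
  refine (Finsupp.sum_smul_index (g := y) (b := a) (fun c => ?_)).trans ?_
  · simp
  · refine Eq.trans (Finsupp.sum_congr fun c _ => ?_) (Finsupp.smul_sum (v := y)).symm
    rw [smul_smul]; congr 1; ring

/-- The algebra `C_n(δ)`: the centraliser of the symmetric group in the Brauer algebra. -/
noncomputable def centraliser (n : ℕ) (δ : ℂ) : Submodule ℂ (BrauerAlgebra n δ) where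
  carrier := {u | ∀ s : Equiv.Perm (Fin n), u * perm δ s = perm δ s * u}
  zero_mem' s := by
    have h1 := smul_mul' (0 : ℂ) (0 : BrauerAlgebra n δ) (perm δ s)
    have h2 := mul_smul' (0 : ℂ) (perm δ s) (0 : BrauerAlgebra n δ)
    simp only [zero_smul] at h1 h2
    rw [h1, h2]
  add_mem' {u v} hu hv s := by rw [add_mul', mul_add', hu s, hv s]
  smul_mem' a u hu s := by rw [smul_mul', mul_smul', hu s]

/-- The element `A_n = ∑_{i < j} d_{ij}`. -/
noncomputable def arcSum (n : ℕ) (δ : ℂ) : BrauerAlgebra n δ :=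
  ∑ ij : Fin n × Fin n with ij.1 < ij.2, diagram δ (BrauerDiagram.arcs ij.1 ij.2)

end BrauerAlgebra

/-! ### Bracelets -/

/-- The letters `n`, `s`, `p`, the letters `s`, `p` with one dot and the letter `s` with two dots. -/
inductive Letter
  | n | s | p | sDot | pDot | sDotDot
  deriving DecidableEq

namespace Letter

/-- The number of dots above a letter. -/
def dots : Letter → ℕ
  | n => 0 | s => 0 | p => 0 | sDot => 1 | pDot => 1 | sDotDot => 2

/-- Removing the dots above a letter. -/
def undot : Letter → Letter
  | n => n | s => s | p => p | sDot => s | pDot => p | sDotDot => s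

/-- The derivative of a letter, with `none` standing for `0`. -/
def derivative : Letter → Option Letter
  | s => some sDot | p => some pDot | sDot => some sDotDot | n => none | pDot => none | sDotDot => none

end Letter

/-- Two words are equivalent iff they are related by cyclic permutations and inversion. -/
def braceletSetoid : Setoid (List Letter) where
  r w w' := w ~r w' ∨ w.reverse ~r w'
  iseqv :=
    { refl := fun w => Or.inl (List.IsRotated.refl w)
      symm := by
        rintro w w' (h | h)
        · exact Or.inl h.symm
        · right
          have := h.symm.reverse
          rwa [List.reverse_reverse] at this
      trans := by
        rintro u v w (h | h) (h' | h')
        · exact Or.inl (h.trans h')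
        · exact Or.inr (h.reverse.trans h')
        · exact Or.inr (h.trans h')
        · left
          have := h.reverse.trans h'
          rwa [List.reverse_reverse] at this }

/-- Bracelets over the extended alphabet (the class of the empty word is excluded from the sets
`plainBracelets` and `dottedBracelets` below). -/
def Bracelet : Type := Quotient braceletSetoid

namespace Bracelet

/-- The bracelet `[w]` of a word `w`. -/
def mk (w : List Letter) : Bracelet := Quotient.mk braceletSetoid w

theorem perm_of_rel {w w' : List Letter} (h : braceletSetoid w w') : w.Perm w' := by
  rcases h with h | h
  · exact h.perm
  · exact (List.reverse_perm w).symm.trans h.perm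

/-- The length of a bracelet. -/
def length : Bracelet → ℕ :=
  Quotient.lift List.length fun _ _ h => (perm_of_rel h).length_eq

/-- The number of dots in a bracelet. -/
def dots : Bracelet → ℕ :=
  Quotient.lift (fun w => (w.map Letter.dots).sum) fun _ _ h =>
    ((perm_of_rel h).map _).sum_eq

/-- Removing all the dots in a bracelet. -/
def undot : Bracelet → Bracelet :=
  Quotient.map (sa := braceletSetoid) (sb := braceletSetoid) (List.map Letter.undot) (by
    rintro w w' (h | h)
    · exact Or.inl (h.map _)
    · right
      rw [← List.map_reverse]
      exact h.map _)

/-- The set `𝔟(𝒜)`: non-empty ternary bracelets with as many letters `n` as letters `s`, such that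
in any representative there is a letter `s` between any two letters `n` and a letter `n` between any
two letters `s`. -/
def plainBracelets : Set Bracelet :=
  {β | ∀ w, mk w = β → w ≠ [] ∧ (∀ a ∈ w, a.dots = 0) ∧
    w.count Letter.n = w.count Letter.s ∧
    (∀ x y z, w = x ++ Letter.n :: y ++ Letter.n :: z → Letter.s ∈ y) ∧
    (∀ x y z, w = x ++ Letter.s :: y ++ Letter.s :: z → Letter.n ∈ y)}

/-- The set of bracelets obtained from those in `𝔟(𝒜)` by dotting letters. -/
def dottedBracelets : Set Bracelet := {β | β.undot ∈ plainBracelets}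

end Bracelet

/-- The polynomial algebra generated by all bracelets over the extended alphabet. -/
abbrev BraceletPoly : Type := MvPolynomial Bracelet ℂ

namespace BraceletPoly

open Bracelet

/-- The generator `[w]`. -/
noncomputable def br (w : List Letter) : BraceletPoly := X (Bracelet.mk w)

/-- The algebra `ℂ[𝔟(𝒜)]`. -/
noncomputable def plain : Subalgebra ℂ BraceletPoly := supported ℂ plainBracelets

/-- The space `ℂ[𝔟(𝒜)]_n` of polynomials of degree `n`, a bracelet having its length as degree. -/
noncomputable def plainDegree (n : ℕ) : Submodule ℂ BraceletPoly :=
  Subalgebra.toSubmodule plain ⊓ weightedHomogeneousSubmodule ℂ Bracelet.length n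

/-- The space of polynomials in dotted bracelets all of whose monomials carry two dots. -/
noncomputable def twoDots : Submodule ℂ BraceletPoly :=
  Subalgebra.toSubmodule (supported ℂ dottedBracelets) ⊓
    weightedHomogeneousSubmodule ℂ Bracelet.dots 2

/-! #### The derivation -/

/-- The words obtained from a word by replacing one letter `a` by its derivative, one for every
position at which the derivative is not `0`. -/
def derivedWords : List Letter → List (List Letter)
  | [] => []
  | a :: w => a.derivative.toList.map (fun a' => a' :: w) ++ (derivedWords w).map (fun w' => a :: w')

theorem derivedWords_append (u v : List Letter) : derivedWords (u ++ v) =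
    (derivedWords u).map (fun w => w ++ v) ++ (derivedWords v).map (fun w => u ++ w) := by
  induction u with
  | nil => simp [derivedWords]
  | cons a u ih => simp [derivedWords, ih, Function.comp_def]

theorem derivedWords_reverse (w : List Letter) :
    (derivedWords w.reverse).Perm ((derivedWords w).map List.reverse) := by
  induction w with
  | nil => simp [derivedWords]
  | cons a w ih =>
    rw [List.reverse_cons, derivedWords_append]
    refine List.perm_append_comm.trans ?_
    simp only [derivedWords, List.map_append, List.map_map, List.map_nil, List.append_nil]
    refine List.Perm.append ?_ ?_
    · simp [Function.comp_def]
    · refine (ih.map _).trans ?_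
      simp [Function.comp_def]

/-- The derivative of a bracelet: `∂[a₁ … a_ℓ] = ∑_j [a₁ … ∂(a_j) … a_ℓ]`. -/
noncomputable def braceletDerivative : Bracelet → BraceletPoly :=
  Quotient.lift (s := braceletSetoid) (fun w => ((derivedWords w).map br).sum) (by
    have hrot : ∀ w w' : List Letter, w ~r w' →
        ((derivedWords w).map br).sum = ((derivedWords w').map br).sum := by
      rintro w w' ⟨k, rfl⟩
      induction k generalizing w with
      | zero => simp
      | succ k ih =>
        rw [show w.rotate (k + 1) = (w.rotate 1).rotate k by rw [List.rotate_rotate, add_comm],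
          ← ih]
        cases w with
        | nil => simp
        | cons a w =>
          rw [List.rotate_cons_succ, List.rotate_zero, derivedWords_append,
            ← List.singleton_append, derivedWords_append]
          simp only [List.map_append, List.sum_append, List.map_map]
          rw [add_comm]
          congr 2 <;> refine List.map_congr_left fun v _ => ?_
          · exact congrArg X (Quotient.sound (Or.inl List.isRotated_append))
          · exact congrArg X (Quotient.sound (Or.inl List.isRotated_append))
    rintro w w' (h | h)
    · exact hrot w w' h
    · rw [← hrot _ _ h, ((derivedWords_reverse w).map br).sum_eq, List.map_map]
      congr 1
      refine List.map_congr_left fun v _ => ?_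
      exact congrArg X (Quotient.sound (Or.inr (List.IsRotated.refl _))))

/-- The derivation `∂`. -/
noncomputable def del : Derivation ℂ BraceletPoly BraceletPoly :=
  mkDerivation ℂ braceletDerivative

/-! #### The trace -/

/-- A word without dots. -/
def Undotted (w : List Letter) : Prop := ∀ a ∈ w, a.dots = 0

/-- A word is fit if it is empty, or if its bracelet lies in `𝔟(𝒜)` and each occurrence of `s` is
followed by an occurrence of `n` at some position on the right. -/
def Fit (w : List Letter) : Prop :=
  w = [] ∨ (Bracelet.mk w ∈ plainBracelets ∧ ∀ x y, w = x ++ Letter.s :: y → Letter.n ∈ y)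

open Letter in
/-- The rules of the trace: `TraceRule δ f g` says that `f ↦ g` is an instance of one of them. The
word `I(v)` is `v.reverse`. -/
inductive TraceRule (δ : ℂ) : BraceletPoly → BraceletPoly → Prop
  | s2 (u : List Letter) (hu : Undotted u)
      (h : Bracelet.mk (sDotDot :: u) ∈ dottedBracelets) :
      TraceRule δ (br (sDotDot :: u)) (C (2 * δ) * br (s :: u))
  | ss (u v : List Letter) (hu : Undotted u) (hv : Undotted v)
      (h : Bracelet.mk (sDot :: u ++ sDot :: v) ∈ dottedBracelets) :
      TraceRule δ (br (sDot :: u ++ sDot :: v))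
        (2 * (br (s :: u ++ s :: v.reverse) + br (s :: u) * br (s :: v)))
  | s_s (u v : List Letter) (hu : Undotted u) (hv : Undotted v)
      (h : Bracelet.mk (sDot :: u) ∈ dottedBracelets)
      (h' : Bracelet.mk (sDot :: v) ∈ dottedBracelets) :
      TraceRule δ (br (sDot :: u) * br (sDot :: v))
        (2 * (br (s :: u ++ s :: v) + br (s :: u ++ s :: v.reverse)))
  | ps (u v : List Letter) (hu : Undotted u) (hv : Undotted v) (hfit : Fit u)
      (h : Bracelet.mk (pDot :: u ++ sDot :: v) ∈ dottedBracelets) :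
      TraceRule δ (br (pDot :: u ++ sDot :: v))
        (br (p :: u ++ s :: v.reverse) + br (p :: u) * br (s :: v))
  | p_s (u v : List Letter) (hu : Undotted u) (hv : Undotted v) (hfit : Fit u)
      (h : Bracelet.mk (pDot :: u) ∈ dottedBracelets)
      (h' : Bracelet.mk (sDot :: v) ∈ dottedBracelets) :
      TraceRule δ (br (pDot :: u) * br (sDot :: v))
        (br (p :: u ++ s :: v) + br (p :: u ++ s :: v.reverse))
  | pp (u v : List Letter) (hu : Undotted u) (hv : Undotted v) (hfit : Fit u) (hfit' : Fit v)
      (h : Bracelet.mk (pDot :: u ++ pDot :: v) ∈ dottedBracelets) :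
      TraceRule δ (br (pDot :: u ++ pDot :: v)) (br (n :: u ++ s :: v.reverse))
  | ppUnfit (u v : List Letter) (hu : Undotted u) (hv : Undotted v)
      (hlt : u.count Letter.n <
        u.count Letter.s)
      (h : Bracelet.mk (pDot :: u ++ pDot :: v) ∈ dottedBracelets) :
      TraceRule δ (br (pDot :: u ++ pDot :: v)) (br (n :: u) * br (s :: v))
  | p_p (u v : List Letter) (hu : Undotted u) (hv : Undotted v) (hfit : Fit u) (hfit' : Fit v)
      (h : Bracelet.mk (pDot :: u) ∈ dottedBracelets)
      (h' : Bracelet.mk (pDot :: v) ∈ dottedBracelets) :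
      TraceRule δ (br (pDot :: u) * br (pDot :: v)) (br (n :: u ++ s :: v.reverse))

open Classical in
/-- The value of the trace on a monomial without undotted factors, according to the rules. -/
noncomputable def ruleValue (δ : ℂ) (m : Bracelet →₀ ℕ) : BraceletPoly :=
  if h : ∃ g, TraceRule δ (monomial m 1) g then h.choose else 0

/-- The trace `τ`: on a monomial, the product of the undotted factors with the value given by the
rules on the product of the dotted factors, extended linearly. (It is used on `twoDots` only.) -/
noncomputable def trace (δ : ℂ) : BraceletPoly →ₗ[ℂ] BraceletPoly :=
  (basisMonomials Bracelet ℂ).constr ℂ fun m =>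
    monomial (m.filter fun β => β.dots = 0) 1 * ruleValue δ (m.filter fun β => β.dots ≠ 0)

/-- The defining properties of the trace: it is a `ℂ[𝔟(𝒜)]`-linear map from `twoDots` to `ℂ[𝔟(𝒜)]`
and obeys the rules. -/
structure IsTrace (δ : ℂ) (τ : BraceletPoly →ₗ[ℂ] BraceletPoly) : Prop where
  mem_plain : ∀ g ∈ twoDots, τ g ∈ plain
  map_mul : ∀ f ∈ plain, ∀ g ∈ twoDots, τ (f * g) = f * τ g
  rule : ∀ f g, TraceRule δ f g → τ f = g

end BraceletPoly

/-! ### Bracelets of a diagram -/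

namespace BrauerDiagram

variable {n : ℕ}

/-- The letter of the line of `b` through the node `x`: `n` for an arc in the upper row, `s` for an
arc in the lower row, `p` for a vertical line. -/
def letterAt (b : BrauerDiagram n) (x : Fin n ⊕ Fin n) : Letter :=
  match x, b.partner x with
  | Sum.inl _, Sum.inl _ => Letter.n
  | Sum.inr _, Sum.inr _ => Letter.s
  | Sum.inl _, Sum.inr _ => Letter.p
  | Sum.inr _, Sum.inl _ => Letter.p

/-- Follow the line through `x` to its other end, then pass to the vertically aligned node. -/
def next (b : BrauerDiagram n) (x : Fin n ⊕ Fin n) : Fin n ⊕ Fin n := (b.partner x).swap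

/-- The word read along the loop through `x`, starting with the line through `x`, after the upper
nodes have been identified with the corresponding lower nodes. -/
noncomputable def loopWord (b : BrauerDiagram n) (x : Fin n ⊕ Fin n) : List Letter :=
  (List.range (Function.minimalPeriod b.next x)).map fun k => b.letterAt (b.next^[k] x)


theorem next_partner (b : BrauerDiagram n) (x : Fin n ⊕ Fin n) :
    b.next (b.partner x) = x.swap := by
  simp [next, partner_partner]

theorem partner_next_next (b : BrauerDiagram n) (x : Fin n ⊕ Fin n) :
    b.next (b.partner (b.next x)) = b.partner x := by
  simp [next, partner_partner]

theorem next_injective (b : BrauerDiagram n) : Function.Injective b.next := by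
  intro x y h
  have h1 := congrArg (fun z => b.partner (Sum.swap z)) h
  simpa [next, partner_partner] using h1

theorem letterAt_partner (b : BrauerDiagram n) (x : Fin n ⊕ Fin n) :
    b.letterAt (b.partner x) = b.letterAt x := by
  unfold letterAt
  rw [partner_partner]
  rcases x with i | i <;> rcases b.partner _ with j | j <;> rfl

theorem mk_loopWord_next (b : BrauerDiagram n) (x : Fin n ⊕ Fin n) :
    Bracelet.mk (b.loopWord (b.next x)) = Bracelet.mk (b.loopWord x) := by
  refine Quotient.sound (Or.inl (List.IsRotated.symm ⟨1, ?_⟩))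
  have hx : x ∈ Function.periodicPts b.next := b.next_injective.mem_periodicPts x
  have hp := Function.minimalPeriod_apply hx
  have hpos := Function.minimalPeriod_pos_of_mem_periodicPts hx
  have hit := Function.iterate_minimalPeriod (f := b.next) (x := x)
  unfold loopWord
  rw [hp]
  obtain ⟨k, hk⟩ : ∃ k, Function.minimalPeriod b.next x = k + 1 := ⟨_, (Nat.sub_add_cancel hpos).symm⟩
  rw [hk] at hit ⊢
  conv_lhs => rw [List.range_succ_eq_map]
  conv_rhs => rw [List.range_succ]
  simp only [List.map_cons, List.rotate_cons_succ, List.rotate_zero, List.map_append, List.map_map,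
    List.map_nil, Function.comp_def, Function.iterate_succ_apply, Function.iterate_zero, id]
  rw [← Function.iterate_succ_apply, hit]

theorem mk_loopWord_partner (b : BrauerDiagram n) (x : Fin n ⊕ Fin n) :
    Bracelet.mk (b.loopWord (b.partner x)) = Bracelet.mk (b.loopWord x) := by
  have hiter : ∀ (k : ℕ) (y : Fin n ⊕ Fin n),
      b.next^[k] (b.partner (b.next^[k] y)) = b.partner y := by
    intro k
    induction k with
    | zero => intro y; rfl
    | succ k ih =>
      intro y
      rw [Function.iterate_succ_apply' _ _ y, Function.iterate_succ_apply, partner_next_next, ih]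
  have hpp : ∀ (m : ℕ) (y : Fin n ⊕ Fin n), Function.IsPeriodicPt b.next m y →
      Function.IsPeriodicPt b.next m (b.partner y) := by
    intro m y h
    have h1 := hiter m y
    rwa [h.eq] at h1
  have hper : Function.minimalPeriod b.next (b.partner x) = Function.minimalPeriod b.next x := by
    refine Function.minimalPeriod_eq_minimalPeriod_iff.2 fun m => ⟨fun h => ?_, hpp m x⟩
    have := hpp m _ h
    rwa [partner_partner] at this
  rw [← mk_loopWord_next b (b.partner x)]
  have hx : b.partner x ∈ Function.periodicPts b.next := b.next_injective.mem_periodicPts _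
  symm
  refine Quotient.sound (Or.inr ?_)
  suffices h : (b.loopWord x).reverse = b.loopWord (b.next (b.partner x)) by
    rw [h]
  unfold loopWord
  rw [Function.minimalPeriod_apply hx, hper]
  refine List.ext_getElem (by simp) fun i h1 h2 => ?_
  simp only [List.length_map, List.length_range, List.length_reverse] at h1 h2
  simp only [List.getElem_reverse, List.getElem_map, List.getElem_range, List.length_map,
    List.length_range]
  rw [← letterAt_partner, ← Function.iterate_succ_apply]
  congr 1
  have h3 := hiter (i + 1) (b.next^[Function.minimalPeriod b.next x - 1 - i] x)
  rw [← Function.iterate_add_apply,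
    show i + 1 + (Function.minimalPeriod b.next x - 1 - i) = Function.minimalPeriod b.next x by omega,
    Function.iterate_minimalPeriod] at h3
  exact h3.symm

/-- The loops of a diagram whose upper nodes are identified with the corresponding lower nodes. -/
abbrev closure (b : BrauerDiagram n) : Setoid (Fin n ⊕ Fin n) := curveSetoid b.partner Sum.swap

/-- The bracelet of a loop. -/
noncomputable def loopBracelet (b : BrauerDiagram n) : Quotient b.closure → Bracelet :=
  Quotient.lift (fun x => Bracelet.mk (b.loopWord x)) (by
    intro x y h
    induction h with
    | rel x y h =>
      rcases h with rfl | rfl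
      · exact (mk_loopWord_partner b x).symm
      · rw [← next_partner, mk_loopWord_next, mk_loopWord_partner]
    | refl => rfl
    | symm _ _ _ ih => exact ih.symm
    | trans _ _ _ _ _ ih1 ih2 => exact ih1.trans ih2)

/-- The product of the bracelets of all the loops of a diagram. -/
noncomputable def bracelets (b : BrauerDiagram n) : BraceletPoly :=
  ∏ c : Quotient b.closure, X (b.loopBracelet c)

end BrauerDiagram

namespace BrauerAlgebra

/-- The linear map `Φ`: a diagram is sent to `1 / n!` times the product of its bracelets. -/
noncomputable def toBracelets (n : ℕ) (δ : ℂ) : BrauerAlgebra n δ →ₗ[ℂ] BraceletPoly :=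
  Finsupp.linearCombination ℂ fun b : BrauerDiagram n => (1 / (n.factorial : ℂ)) • b.bracelets

open Classical in
/-- The linear map `ζ ↦ e_ζ`: on a monic monomial `ζ`, it is the average `γ_b` with
`Φ(γ_b) = ζ`. (It is used on `BraceletPoly.plainDegree n` only.) -/
noncomputable def ofBracelets (n : ℕ) (δ : ℂ) : BraceletPoly →ₗ[ℂ] BrauerAlgebra n δ :=
  (basisMonomials Bracelet ℂ).constr ℂ fun m =>
    if h : ∃ b : BrauerDiagram n, toBracelets n δ (average δ b) = monomial m 1
    then average δ h.choose else 0

end BrauerAlgebra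

/-! Left multiplication by `d_{ij}` performs a surgery on a diagram `b`: the lines at the lower
nodes `i` and `j` are cut, these two nodes are joined with each other, and so are the two remaining
endpoints. If `i` and `j` are already joined, the diagram does not change and a factor `δ` appears
(`stack_arcs`, `loops_arcs`). As `A_n` is invariant under conjugation by permutations, `A_n γ_b` is
half the sum, over ordered pairs of different lower nodes, of the averages of the diagrams after
surgery, with these factors (`arcSum_mul_average`).

The product of the bracelets of `b` has one letter for each line of `b`, so `∂²` of it is a sum over
ordered pairs of lines. The heart of the proof is that `τ` turns the term of a pair of lines into
the sum, over the lower endpoints of the two lines, of the products of bracelets after surgery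
(`lineTerm`, `trace_secondTerm`). Summing over the pairs of lines gives the sum over the pairs of
lower nodes (`trace_del_del_bracelets`), which is the formula for `A_n γ_b`.

The comparison is made on readings: a loop is represented by the list of the nodes in which its
lines start (`Loop`, `IsReading`), and rotating and reversing this list realises the equivalence of
words. Surgery at two lines of the same loop reverses the segment between them or splits the loop;
at lines of different loops it merges the loops, with or without a reversal. The letters of the new
lines, and how often each surgery occurs, depend only on the rows of the endpoints. A word is a walk
between the two rows (`Walk`): `s` takes it from the lower row to the upper one, `n` takes it back,
`p` stays. A fit word is a closed walk from the lower row, or a word in `p` alone, for which both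
directions give the same result (`Walk.of_fit`). Hence the hypotheses of a rule fix the rows as far
as they matter, and a case analysis yields its right-hand side (`oneLoop_ss` to `twoLoops_pp`).

The same comparison shows that the rules are consistent: a left-hand side with two single dots is
realised by a diagram with two marked lines, and every applicable rule returns its `lineTerm`, in
which no rule appears (`TraceRule.exists_value`). Every product of dotted bracelets with two dots in
total is covered, since the words can be rotated and reversed until a rule applies (`exists_rule`).
This gives existence and uniqueness of `τ`.

For the basis, the averages span the centraliser (`centraliser_le_span`). Diagrams with the same
bracelets are renumberings of each other (`exists_relabel_of_bracelets_eq`), and every monic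
monomial of degree `n` comes from a diagram (`exists_bracelets_eq`). So `Φ` is a left inverse of `ζ
↦ e_ζ`, which yields linear independence and the uniqueness of `Δ`. -/

namespace BrauerDiagram

variable {n : ℕ}

/-! ### Conjugating a diagram by a permutation of the nodes -/

/-- The diagram obtained by moving the endpoints of the lines by a permutation of the nodes. -/
def conj (τ : Equiv.Perm (Fin n ⊕ Fin n)) (b : BrauerDiagram n) : BrauerDiagram n where
  partner x := τ (b.partner (τ.symm x))
  partner_partner x := by simp [partner_partner]
  partner_ne x h := b.partner_ne (τ.symm x) (by rw [Equiv.eq_symm_apply, h])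

theorem conj_partner (τ : Equiv.Perm (Fin n ⊕ Fin n)) (b : BrauerDiagram n) (x : Fin n ⊕ Fin n) :
    (conj τ b).partner x = τ (b.partner (τ.symm x)) := rfl

theorem conj_partner_apply (τ : Equiv.Perm (Fin n ⊕ Fin n)) (b : BrauerDiagram n)
    (x : Fin n ⊕ Fin n) : (conj τ b).partner (τ x) = τ (b.partner x) := by
  simp [conj_partner]

theorem conj_conj (τ σ : Equiv.Perm (Fin n ⊕ Fin n)) (b : BrauerDiagram n) :
    conj τ (conj σ b) = conj (τ * σ) b := by
  ext x; simp [conj_partner, Equiv.Perm.mul_def]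

theorem conj_one (b : BrauerDiagram n) : conj 1 b = b := by
  ext x; simp [conj_partner, Equiv.Perm.one_def]

/-- Renumbering the nodes of both rows by a permutation. -/
def relabel (s : Equiv.Perm (Fin n)) (b : BrauerDiagram n) : BrauerDiagram n :=
  conj (Equiv.sumCongr s s) b

theorem relabel_mul (s t : Equiv.Perm (Fin n)) (b : BrauerDiagram n) :
    relabel (s * t) b = relabel s (relabel t b) := by
  unfold relabel
  rw [conj_conj]
  congr 1
  ext x
  rcases x with x | x <;> simp

/-- Surgery: the lines through `x` and `y` are replaced by a line joining `x`, `y` and a line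
joining their other endpoints. -/
def surgery (b : BrauerDiagram n) (x y : Fin n ⊕ Fin n) : BrauerDiagram n :=
  conj (Equiv.swap (b.partner x) y) b

theorem partner_injective (b : BrauerDiagram n) : Function.Injective b.partner :=
  Function.LeftInverse.injective b.partner_partner

theorem partner_eq_iff (b : BrauerDiagram n) {x y : Fin n ⊕ Fin n} :
    b.partner x = y ↔ x = b.partner y := by
  constructor <;> rintro rfl <;> simp [partner_partner]

theorem surgery_partner_left (b : BrauerDiagram n) {x y : Fin n ⊕ Fin n} (h : x ≠ y) :
    (surgery b x y).partner x = y := by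
  simp only [surgery, conj_partner, Equiv.symm_swap]
  rw [Equiv.swap_apply_of_ne_of_ne (b.partner_ne x).symm h, Equiv.swap_apply_left]

theorem surgery_partner_partner_left (b : BrauerDiagram n) {x y : Fin n ⊕ Fin n} (h : x ≠ y) : (surgery b x y).partner (b.partner x) = b.partner y := by
  simp only [surgery, conj_partner, Equiv.symm_swap, Equiv.swap_apply_left]
  rw [Equiv.swap_apply_of_ne_of_ne (fun e => h (b.partner_injective e).symm) (b.partner_ne y)]

theorem surgery_partner_of_ne (b : BrauerDiagram n) {x y z : Fin n ⊕ Fin n} (h1 : z ≠ x)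
    (h2 : z ≠ y) (h3 : z ≠ b.partner x) (h4 : z ≠ b.partner y) :
    (surgery b x y).partner z = b.partner z := by
  simp only [surgery, conj_partner, Equiv.symm_swap]
  rw [Equiv.swap_apply_of_ne_of_ne h3 h2,
    Equiv.swap_apply_of_ne_of_ne (fun e => h1 (b.partner_injective e))
      (fun e => h4 (b.partner_eq_iff.1 e))]

theorem surgery_partner_right (b : BrauerDiagram n) {x y : Fin n ⊕ Fin n} (h : x ≠ y) :
    (surgery b x y).partner y = x := by
  rw [partner_eq_iff, surgery_partner_left b h]

theorem surgery_partner_partner_right (b : BrauerDiagram n) {x y : Fin n ⊕ Fin n} (h : x ≠ y) : (surgery b x y).partner (b.partner y) = b.partner x := by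
  rw [partner_eq_iff, surgery_partner_partner_left b h]

/-- The transposition in the surgery is then trivial. This is the case in which multiplication by
`d_{ij}` produces a closed loop, so that one formula for the stack serves both cases and only the
scalar distinguishes them. -/
theorem surgery_eq_self (b : BrauerDiagram n) {x y : Fin n ⊕ Fin n} (h : b.partner x = y) :
    surgery b x y = b := by
  rw [surgery, h, Equiv.swap_self]
  exact conj_one b

theorem surgery_comm (b : BrauerDiagram n) (x y : Fin n ⊕ Fin n) :
    surgery b x y = surgery b y x := by
  by_cases h : x = y
  · rw [h]
  by_cases h' : b.partner x = y
  · rw [surgery_eq_self b h', surgery_eq_self b (b.partner_eq_iff.1 h').symm]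
  have h'' : b.partner y ≠ x := fun e => h' (b.partner_eq_iff.1 e).symm
  ext z : 2
  by_cases h1 : z = x
  · rw [h1, surgery_partner_left b h, surgery_partner_right b (Ne.symm h)]
  by_cases h2 : z = y
  · rw [h2, surgery_partner_left b (Ne.symm h), surgery_partner_right b h]
  by_cases h3 : z = b.partner x
  · rw [h3, surgery_partner_partner_left b h, surgery_partner_partner_right b (Ne.symm h)]
  by_cases h4 : z = b.partner y
  · rw [h4, surgery_partner_partner_left b (Ne.symm h), surgery_partner_partner_right b h]
  rw [surgery_partner_of_ne b h1 h2 h3 h4, surgery_partner_of_ne b h2 h1 h4 h3]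

theorem surgery_partner_partner (b : BrauerDiagram n) (x y : Fin n ⊕ Fin n) :
    surgery b (b.partner x) (b.partner y) = surgery b x y := by
  by_cases h : x = y
  · subst h
    ext z : 2
    simp [surgery, partner_partner, Equiv.swap_comm]
  have h' : b.partner x ≠ b.partner y := fun e => h (b.partner_injective e)
  ext z : 2
  by_cases h1 : z = x
  · have := surgery_partner_partner_left b h'
    rw [partner_partner, partner_partner] at this
    rw [h1, surgery_partner_left b h, this]
  by_cases h2 : z = y
  · have := surgery_partner_partner_right b h'
    rw [partner_partner, partner_partner] at this
    rw [h2, surgery_partner_right b h, this]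
  by_cases h3 : z = b.partner x
  · rw [h3, surgery_partner_partner_left b h, surgery_partner_left b h']
  by_cases h4 : z = b.partner y
  · rw [h4, surgery_partner_partner_right b h, surgery_partner_right b h']
  rw [surgery_partner_of_ne b h1 h2 h3 h4, surgery_partner_of_ne b h3 h4] <;>
    simpa [partner_partner]

/-- Surgery is conjugation by a transposition, and a renumbering conjugates this transposition to
the one of the renumbered nodes. -/
theorem relabel_surgery (s : Equiv.Perm (Fin n)) (b : BrauerDiagram n) (x y : Fin n ⊕ Fin n) :
    relabel s (surgery b x y) =
      surgery (relabel s b) (Equiv.sumCongr s s x) (Equiv.sumCongr s s y) := by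
  unfold surgery relabel
  rw [conj_partner_apply, conj_conj, conj_conj, Equiv.mul_swap_eq_swap_mul]

/-! ### Stacking with permutations and with the diagrams `d_{ij}` -/

theorem stackCurves_line (b₁ b₂ : BrauerDiagram n) (x : StackNode n) :
    stackCurves b₁ b₂ x (stackLine b₁ b₂ x) := Relation.EqvGen.rel _ _ (Or.inl rfl)

theorem stackCurves_glue (b₁ b₂ : BrauerDiagram n) (x : StackNode n) :
    stackCurves b₁ b₂ x (glue x) := Relation.EqvGen.rel _ _ (Or.inr rfl)

/-- An outer node shares its curve with just one other outer node, so it is enough to exhibit one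
path for each outer node. -/
theorem stack_eq_of_curves {b₁ b₂ b : BrauerDiagram n}
    (h : ∀ x, stackCurves b₁ b₂ (outer x) (outer (b.partner x))) : stack b₁ b₂ = b := by
  ext x : 2
  exact (stack_partner_eq_iff b₁ b₂ x _).2 ⟨b.partner_ne x, h x⟩

theorem loops_eq_zero {b₁ b₂ : BrauerDiagram n}
    (h : ∀ z, ∃ x, stackCurves b₁ b₂ z (outer x)) : loops b₁ b₂ = 0 := by
  unfold loops
  rw [Nat.card_eq_zero]
  left
  constructor
  rintro ⟨c, hc⟩
  induction c using Quotient.inductionOn with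
  | h z =>
    obtain ⟨x, hx⟩ := h z
    exact hc x (Quotient.sound (hx.symm))

/-! ### Stacking with a permutation. -/

section ofPerm

variable (s : Equiv.Perm (Fin n)) (b : BrauerDiagram n)

theorem curves_ofPerm_left (z : Fin n ⊕ Fin n) :
    stackCurves (ofPerm s) b (Sum.inr z) (outer (Equiv.sumCongr (1 : Equiv.Perm (Fin n)) s z)) := by
  rcases z with i | i
  · exact Relation.EqvGen.refl _
  · exact (stackCurves_glue (ofPerm s) b (Sum.inr (Sum.inr i))).trans _ _ _
      (stackCurves_line (ofPerm s) b (Sum.inl (Sum.inl i)))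

theorem curves_ofPerm_right (z : Fin n ⊕ Fin n) :
    stackCurves b (ofPerm s) (Sum.inl z) (outer (Equiv.sumCongr s⁻¹ (1 : Equiv.Perm (Fin n)) z)) := by
  rcases z with i | i
  · exact (stackCurves_glue b (ofPerm s) (Sum.inl (Sum.inl i))).trans _ _ _
      (stackCurves_line b (ofPerm s) (Sum.inr (Sum.inr i)))
  · exact Relation.EqvGen.refl _

theorem stack_ofPerm_left : stack (ofPerm s) b = conj (Equiv.sumCongr (1 : Equiv.Perm (Fin n)) s) b := by
  refine stack_eq_of_curves fun x => ?_
  obtain ⟨z, rfl⟩ := (Equiv.sumCongr (1 : Equiv.Perm (Fin n)) s).surjective x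
  rw [conj_partner_apply]
  exact (curves_ofPerm_left s b z).symm.trans _ _ _
    ((stackCurves_line (ofPerm s) b (Sum.inr z)).trans _ _ _ (curves_ofPerm_left s b _))

/-- The inverse appears because the upper node `i` of `b` is glued to the lower node `i` of the
permutation, whose line leads up to `s⁻¹ i`. -/
theorem stack_ofPerm_right : stack b (ofPerm s) = conj (Equiv.sumCongr s⁻¹ (1 : Equiv.Perm (Fin n))) b := by
  refine stack_eq_of_curves fun x => ?_
  obtain ⟨z, rfl⟩ := (Equiv.sumCongr s⁻¹ (1 : Equiv.Perm (Fin n))).surjective x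
  rw [conj_partner_apply]
  exact (curves_ofPerm_right s b z).symm.trans _ _ _
    ((stackCurves_line b (ofPerm s) (Sum.inl z)).trans _ _ _ (curves_ofPerm_right s b _))

theorem loops_ofPerm_left : loops (ofPerm s) b = 0 := by
  refine loops_eq_zero ?_
  rintro (z | z)
  · rcases z with i | i
    · exact ⟨_, (stackCurves_glue (ofPerm s) b (Sum.inl (Sum.inl i))).trans _ _ _
        (curves_ofPerm_left s b (Sum.inr i))⟩
    · exact ⟨Sum.inr i, Relation.EqvGen.refl _⟩
  · exact ⟨_, curves_ofPerm_left s b z⟩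

theorem loops_ofPerm_right : loops b (ofPerm s) = 0 := by
  refine loops_eq_zero ?_
  rintro (z | z)
  · exact ⟨_, curves_ofPerm_right s b z⟩
  · rcases z with i | i
    · exact ⟨Sum.inl i, Relation.EqvGen.refl _⟩
    · exact ⟨_, (stackCurves_glue b (ofPerm s) (Sum.inr (Sum.inr i))).trans _ _ _
        (curves_ofPerm_right s b (Sum.inl i))⟩

end ofPerm

/-! ### Stacking with a diagram `d_{ij}`. -/

section arcs

variable {i j : Fin n} (b : BrauerDiagram n)

theorem curves_arcs {z : Fin n ⊕ Fin n} (h1 : z ≠ Sum.inr i) (h2 : z ≠ Sum.inr j) :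
    stackCurves (arcs i j) b (Sum.inr z) (outer z) := by
  rcases z with k | k
  · exact Relation.EqvGen.refl _
  · have h := stackCurves_line (arcs i j) b (Sum.inl (Sum.inl k))
    have hk : Equiv.swap i j k = k :=
      Equiv.swap_apply_of_ne_of_ne (fun e => h1 (by rw [e])) (fun e => h2 (by rw [e]))
    simp only [stackLine, Sum.map_inl, arcs, Sum.elim_inl, hk, if_true] at h
    exact (stackCurves_glue (arcs i j) b (Sum.inr (Sum.inr k))).trans _ _ _ h

theorem curves_arcs_inner (hij : i ≠ j) :
    stackCurves (arcs i j) b (Sum.inr (Sum.inr i)) (Sum.inr (Sum.inr j)) := by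
  have h := stackCurves_line (arcs i j) b (Sum.inl (Sum.inl i))
  simp only [stackLine, Sum.map_inl, arcs, Sum.elim_inl, Equiv.swap_apply_left, hij.symm,
    if_false] at h
  exact ((stackCurves_glue (arcs i j) b (Sum.inr (Sum.inr i))).trans _ _ _ h).trans _ _ _
    (stackCurves_glue (arcs i j) b (Sum.inl (Sum.inl j)))

theorem curves_arcs_outer (hij : i ≠ j) :
    stackCurves (arcs i j) b (outer (Sum.inr i)) (outer (Sum.inr j)) := by
  have h := stackCurves_line (arcs i j) b (Sum.inl (Sum.inr i))
  simp only [stackLine, Sum.map_inl, arcs, Sum.elim_inr, Equiv.swap_apply_left, hij.symm,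
    if_false] at h
  exact h

/-- The lower arc of `d_{ij}` survives as the line joining the lower nodes `i` and `j`. Its upper
arc links the lower nodes `i` and `j` of `b`, and so connects the other ends of their lines.
Elsewhere `d_{ij}` consists of vertical lines. -/
theorem stack_arcs (hij : i ≠ j) : stack (arcs i j) b = surgery b (Sum.inr i) (Sum.inr j) := by
  have hIJ : (Sum.inr i : Fin n ⊕ Fin n) ≠ Sum.inr j := fun e => hij (Sum.inr_injective e)
  have hin := curves_arcs_inner b hij
  refine stack_eq_of_curves fun x => ?_
  by_cases h1 : x = Sum.inr i
  · rw [h1, surgery_partner_left b hIJ]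
    exact curves_arcs_outer b hij
  by_cases h2 : x = Sum.inr j
  · rw [h2, surgery_partner_right b hIJ]
    exact (curves_arcs_outer b hij).symm
  have hx := ((curves_arcs b h1 h2).symm).trans _ _ _ (stackCurves_line (arcs i j) b (Sum.inr x))
  simp only [stackLine, Sum.map_inr] at hx
  by_cases h3 : x = b.partner (Sum.inr i)
  · have h' : b.partner (Sum.inr i) ≠ Sum.inr j := fun e => h2 (h3.trans e)
    rw [h3] at hx ⊢
    rw [partner_partner] at hx
    rw [surgery_partner_partner_left b hIJ]
    have hy := stackCurves_line (arcs i j) b (Sum.inr (Sum.inr j))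
    refine ((hx.trans _ _ _ hin).trans _ _ _ hy).trans _ _ _ (curves_arcs b ?_ (b.partner_ne _))
    exact fun e => h' (b.partner_eq_iff.1 e).symm
  by_cases h4 : x = b.partner (Sum.inr j)
  · have h' : b.partner (Sum.inr i) ≠ Sum.inr j := fun e => h1 (h4.trans (b.partner_eq_iff.1 e).symm)
    rw [h4] at hx ⊢
    rw [partner_partner] at hx
    rw [surgery_partner_partner_right b hIJ]
    have hy := stackCurves_line (arcs i j) b (Sum.inr (Sum.inr i))
    exact ((hx.trans _ _ _ hin.symm).trans _ _ _ hy).trans _ _ _ (curves_arcs b (b.partner_ne _) h')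
  · rw [surgery_partner_of_ne b h1 h2 h3 h4]
    exact hx.trans _ _ _ (curves_arcs b (fun e => h3 (b.partner_eq_iff.1 e))
      (fun e => h4 (b.partner_eq_iff.1 e)))

/-- A closed loop cannot use a vertical line of `d_{ij}`, as such a line leads to an outer node. It
must consist of the upper arc of `d_{ij}` and a line of `b` joining the lower nodes `i` and `j`. -/
theorem loops_arcs (hij : i ≠ j) :
    loops (arcs i j) b = if b.partner (Sum.inr i) = Sum.inr j then 1 else 0 := by
  have hin := curves_arcs_inner b hij
  split_ifs with h
  -- These four nodes form the closed loop. Stability under lines and gluing makes `S` a union of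
  -- curves.
  · let S : Set (StackNode n) :=
      {z | z = Sum.inr (Sum.inr i) ∨ z = Sum.inr (Sum.inr j) ∨ z = Sum.inl (Sum.inl i) ∨
        z = Sum.inl (Sum.inl j)}
    have h' : b.partner (Sum.inr j) = Sum.inr i := (b.partner_eq_iff.1 h).symm
    have hline : ∀ z ∈ S, stackLine (arcs i j) b z ∈ S := by
      rintro z (rfl | rfl | rfl | rfl)
      · simp [S, stackLine, h]
      · simp [S, stackLine, h']
      · simp [S, stackLine, arcs, hij.symm]
      · simp [S, stackLine, arcs, hij]
    have hglue : ∀ z ∈ S, glue z ∈ S := by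
      rintro z (rfl | rfl | rfl | rfl) <;> simp [S, glue]
    have hS : ∀ z w, stackCurves (arcs i j) b z w → (z ∈ S ↔ w ∈ S) := by
      intro z w hzw
      induction hzw with
      | rel z w h =>
        rcases h with rfl | rfl
        · exact ⟨hline z, fun h => by simpa [stackLine_stackLine] using hline _ h⟩
        · exact ⟨hglue z, fun h => by simpa [glue_glue] using hglue _ h⟩
      | refl => exact Iff.rfl
      | symm _ _ _ ih => exact ih.symm
      | trans _ _ _ _ _ ih1 ih2 => exact ih1.trans ih2
    have hout : ∀ x, outer x ∉ S := by rintro (k | k) <;> simp [S, outer]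
    have hcurve : ∀ z ∈ S, stackCurves (arcs i j) b z (Sum.inr (Sum.inr i)) := by
      rintro z (rfl | rfl | rfl | rfl)
      · exact Relation.EqvGen.refl _
      · exact hin.symm
      · exact stackCurves_glue (arcs i j) b (Sum.inl (Sum.inl i))
      · exact (stackCurves_glue (arcs i j) b (Sum.inl (Sum.inl j))).trans _ _ _ hin.symm
    unfold loops
    rw [Nat.card_eq_one_iff_unique]
    constructor
    · constructor
      have key : ∀ c : {c : Quotient (stackCurves (arcs i j) b) //
          ∀ x, (Quotient.mk (stackCurves (arcs i j) b) (outer x)) ≠ c},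
          c.1 = Quotient.mk _ (Sum.inr (Sum.inr i)) := by
        rintro ⟨c, hc⟩
        induction c using Quotient.inductionOn with
        | h z =>
          refine Quotient.sound (hcurve z ?_)
          by_contra hz
          have aux : ∀ z : Fin n ⊕ Fin n, (Sum.inr z : StackNode n) ∉ S →
              stackCurves (arcs i j) b (Sum.inr z) (outer z) := by
            intro z hz
            exact curves_arcs b (fun e => hz (by simp [S, e])) (fun e => hz (by simp [S, e]))
          rcases z with (k | k) | z
          · have hk : (Sum.inr (Sum.inr k) : StackNode n) ∉ S := fun h => hz (hglue _ h)
            exact hc _ (Quotient.sound (Relation.EqvGen.symm _ _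
              ((stackCurves_glue (arcs i j) b (Sum.inl (Sum.inl k))).trans _ _ _ (aux _ hk))))
          · exact hc (Sum.inr k) rfl
          · exact hc _ (Quotient.sound (aux z hz).symm)
      exact fun c d => Subtype.ext ((key c).trans (key d).symm)
    · refine ⟨⟨Quotient.mk _ (Sum.inr (Sum.inr i)), fun x hx => ?_⟩⟩
      exact hout x ((hS _ _ (Quotient.exact hx)).2 (Or.inl rfl))
  · have h' : b.partner (Sum.inr j) ≠ Sum.inr i := fun e => h (b.partner_eq_iff.1 e).symm
    have key : ∀ z, ∃ x, stackCurves (arcs i j) b (Sum.inr z) (outer x) := by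
      intro z
      by_cases h1 : z = Sum.inr i
      · rw [h1]
        exact ⟨_, (stackCurves_line (arcs i j) b (Sum.inr (Sum.inr i))).trans _ _ _
          (curves_arcs b (b.partner_ne _) h)⟩
      by_cases h2 : z = Sum.inr j
      · rw [h2]
        exact ⟨_, (stackCurves_line (arcs i j) b (Sum.inr (Sum.inr j))).trans _ _ _
          (curves_arcs b h' (b.partner_ne _))⟩
      exact ⟨_, curves_arcs b h1 h2⟩
    refine loops_eq_zero ?_
    rintro ((k | k) | z)
    · obtain ⟨x, hx⟩ := key (Sum.inr k)
      exact ⟨x, (stackCurves_glue (arcs i j) b (Sum.inl (Sum.inl k))).trans _ _ _ hx⟩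
    · exact ⟨Sum.inr k, Relation.EqvGen.refl _⟩
    · exact key z

end arcs

end BrauerDiagram

namespace BrauerAlgebra

open BrauerDiagram

variable {n : ℕ} {δ : ℂ}

/-! ### Products with permutations and the averages -/

/-- The product of the Brauer algebra as a bilinear map. -/
noncomputable def mulBilin (n : ℕ) (δ : ℂ) :
    BrauerAlgebra n δ →ₗ[ℂ] BrauerAlgebra n δ →ₗ[ℂ] BrauerAlgebra n δ :=
  LinearMap.mk₂ ℂ (· * ·) add_mul' smul_mul' mul_add' mul_smul'

theorem mulBilin_apply (x y : BrauerAlgebra n δ) : mulBilin n δ x y = x * y := rfl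

theorem induction_diagram {p : BrauerAlgebra n δ → Prop} (zero : p 0)
    (add : ∀ x y, p x → p y → p (x + y)) (smul : ∀ (a : ℂ) b, p (a • diagram δ b))
    (x : BrauerAlgebra n δ) : p x := by
  refine Finsupp.induction_linear (motive := p) x zero add fun b a => ?_
  have h : a • diagram δ b = (Finsupp.single b a : BrauerDiagram n →₀ ℂ) :=
    (Finsupp.smul_single a b (1 : ℂ)).trans (by simp)
  have h' := smul a b
  rwa [h] at h'

theorem diagram_mul_diagram (b₁ b₂ : BrauerDiagram n) :
    diagram δ b₁ * diagram δ b₂ = δ ^ loops b₁ b₂ • diagram δ (stack b₁ b₂) := by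
  change Finsupp.sum (Finsupp.single b₁ 1) _ = _
  rw [Finsupp.sum_single_index, diagram, Finsupp.sum_single_index]
  · simp
  · simp
  · simp [Finsupp.sum]

theorem perm_mul_diagram (s : Equiv.Perm (Fin n)) (b : BrauerDiagram n) :
    perm δ s * diagram δ b = diagram δ (conj (Equiv.sumCongr (1 : Equiv.Perm (Fin n)) s) b) := by
  rw [perm, diagram_mul_diagram, loops_ofPerm_left, stack_ofPerm_left, pow_zero, one_smul]

theorem diagram_mul_perm (s : Equiv.Perm (Fin n)) (b : BrauerDiagram n) :
    diagram δ b * perm δ s = diagram δ (conj (Equiv.sumCongr s⁻¹ (1 : Equiv.Perm (Fin n))) b) := by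
  rw [perm, diagram_mul_diagram, loops_ofPerm_right, stack_ofPerm_right, pow_zero, one_smul]

theorem perm_mul_diagram_mul_perm (s : Equiv.Perm (Fin n)) (b : BrauerDiagram n) :
    perm δ s * diagram δ b * perm δ s⁻¹ = diagram δ (relabel s b) := by
  rw [perm_mul_diagram, diagram_mul_perm, conj_conj, relabel, inv_inv]
  congr 2
  ext x
  rcases x with x | x <;> simp

theorem average_eq (b : BrauerDiagram n) :
    average δ b = ∑ s : Equiv.Perm (Fin n), diagram δ (relabel s b) :=
  Finset.sum_congr rfl fun s _ => perm_mul_diagram_mul_perm s b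

theorem average_relabel (t : Equiv.Perm (Fin n)) (b : BrauerDiagram n) :
    average δ (relabel t b) = average δ b := by
  rw [average_eq, average_eq]
  simp_rw [← relabel_mul]
  exact Fintype.sum_equiv (Equiv.mulRight t) _ _ fun _ => rfl

theorem average_mem_centraliser (b : BrauerDiagram n) : average δ b ∈ centraliser n δ := by
  intro t
  rw [average_eq, ← mulBilin_apply, ← mulBilin_apply, map_sum, map_sum, LinearMap.sum_apply]
  simp only [mulBilin_apply, perm_mul_diagram, diagram_mul_perm, relabel, conj_conj]
  symm
  refine Fintype.sum_equiv (Equiv.mulLeft t) _ _ fun s => ?_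
  congr 2
  ext x
  rcases x with x | x <;> simp

/-- Multiplication by a permutation merely moves endpoints and creates no loops, so the cancellation
can be checked on diagrams; associativity of the whole algebra is not needed. -/
theorem mul_perm_mul_perm_inv (u : BrauerAlgebra n δ) (s : Equiv.Perm (Fin n)) :
    u * perm δ s * perm δ s⁻¹ = u := by
  induction u using induction_diagram with
  | zero => simp only [← mulBilin_apply, map_zero, LinearMap.zero_apply]
  | add x y hx hy => rw [add_mul', add_mul', hx, hy]
  | smul a b =>
    rw [smul_mul', smul_mul', diagram_mul_perm, diagram_mul_perm, conj_conj]
    congr 2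
    convert conj_one b using 2
    ext x
    rcases x with x | x <;> simp

theorem sum_conj_mem_span (u : BrauerAlgebra n δ) :
    ∑ s : Equiv.Perm (Fin n), perm δ s * u * perm δ s⁻¹ ∈
      Submodule.span ℂ (Set.range (average (n := n) δ)) := by
  induction u using induction_diagram with
  | zero => simp [← mulBilin_apply]
  | add x y hx hy =>
    simp only [mul_add', add_mul', Finset.sum_add_distrib]
    exact add_mem hx hy
  | smul a b =>
    simp only [mul_smul', smul_mul', ← Finset.smul_sum]
    exact Submodule.smul_mem _ _ (Submodule.subset_span ⟨b, rfl⟩)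

/-- An element commuting with all permutations equals the mean of its conjugates, and the sum of the
conjugates of a diagram is an average `γ_b`. -/
theorem centraliser_le_span :
    centraliser n δ ≤ Submodule.span ℂ (Set.range (average (n := n) δ)) := by
  intro u hu
  have h1 : ∑ s : Equiv.Perm (Fin n), perm δ s * u * perm δ s⁻¹ = (n.factorial : ℂ) • u := by
    rw [Finset.sum_congr rfl fun s _ => show perm δ s * u * perm δ s⁻¹ = u by
      rw [← hu s, mul_perm_mul_perm_inv]]
    simp [Finset.card_univ, Fintype.card_perm, Nat.cast_smul_eq_nsmul]
  have h2 := Submodule.smul_mem _ ((n.factorial : ℂ)⁻¹) (sum_conj_mem_span u)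
  rwa [h1, smul_smul, inv_mul_cancel₀ (Nat.cast_ne_zero.2 n.factorial_ne_zero), one_smul] at h2

/-! ### Multiplication by `A_n` -/

/-- The exponent of `δ` in the product of `d_{ij}` with a diagram. -/
noncomputable def arcScalar (δ : ℂ) (b : BrauerDiagram n) (x y : Fin n ⊕ Fin n) : ℂ :=
  if b.partner x = y then δ else 1

theorem arcs_mul_diagram {i j : Fin n} (hij : i ≠ j) (b : BrauerDiagram n) :
    diagram δ (arcs i j) * diagram δ b =
      arcScalar δ b (Sum.inr i) (Sum.inr j) • diagram δ (surgery b (Sum.inr i) (Sum.inr j)) := by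
  rw [diagram_mul_diagram, stack_arcs b hij, loops_arcs b hij, arcScalar]
  split_ifs <;> simp

theorem arcScalar_relabel (s : Equiv.Perm (Fin n)) (b : BrauerDiagram n) (x y : Fin n ⊕ Fin n) :
    arcScalar δ (relabel s b) (Equiv.sumCongr s s x) (Equiv.sumCongr s s y) = arcScalar δ b x y := by
  simp only [arcScalar, relabel, conj_partner_apply, EmbeddingLike.apply_eq_iff_eq]

/-- This is where the factor `½` of `Δ` comes from: `A_n` runs over unordered pairs, whereas `∂²`
produces ordered ones. -/
theorem sum_lt_eq_half {M : Type*} [AddCommGroup M] [Module ℂ M] (F : Fin n → Fin n → M)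
    (hF : ∀ i j, F i j = F j i) :
    ∑ ij : Fin n × Fin n with ij.1 < ij.2, F ij.1 ij.2 =
      (1 / 2 : ℂ) • ∑ i, ∑ j, if i = j then 0 else F i j := by
  have h1 : ∑ ij : Fin n × Fin n with ij.2 < ij.1, F ij.1 ij.2 =
      ∑ ij : Fin n × Fin n with ij.1 < ij.2, F ij.1 ij.2 := by
    refine Finset.sum_equiv (Equiv.prodComm _ _) (by simp) fun ij _ => ?_
    exact hF _ _
  have h2 : ∑ i, ∑ j, (if i = j then 0 else F i j) =
      ∑ ij : Fin n × Fin n with ij.1 < ij.2, F ij.1 ij.2 +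
      ∑ ij : Fin n × Fin n with ij.2 < ij.1, F ij.1 ij.2 := by
    rw [← Fintype.sum_prod_type' (f := fun i j => if i = j then 0 else F i j),
      Finset.sum_filter, Finset.sum_filter, ← Finset.sum_add_distrib]
    refine Finset.sum_congr rfl fun ij _ => ?_
    rcases lt_trichotomy ij.1 ij.2 with h | h | h
    · simp [h, h.ne, h.not_gt]
    · simp [h]
    · simp [h, h.ne', h.not_gt]
  rw [h2, h1, ← two_smul ℂ, smul_smul]
  norm_num

theorem surgery_scalar_comm {M : Type*} [AddCommGroup M] [Module ℂ M] (b : BrauerDiagram n)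
    (f : BrauerDiagram n → M) (x y : Fin n ⊕ Fin n) :
    arcScalar δ b x y • f (surgery b x y) = arcScalar δ b y x • f (surgery b y x) := by
  rw [surgery_comm, arcScalar, arcScalar]
  congr 2
  exact propext ⟨fun h => (b.partner_eq_iff.1 h).symm, fun h => (b.partner_eq_iff.1 h).symm⟩

theorem arcSum_mul_diagram (b : BrauerDiagram n) :
    arcSum n δ * diagram δ b = (1 / 2 : ℂ) • ∑ i, ∑ j, if i = j then 0 else
      arcScalar δ b (Sum.inr i) (Sum.inr j) • diagram δ (surgery b (Sum.inr i) (Sum.inr j)) := by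
  rw [arcSum, ← mulBilin_apply, map_sum, LinearMap.sum_apply, ← sum_lt_eq_half]
  · refine Finset.sum_congr rfl fun ij h => ?_
    exact arcs_mul_diagram (Finset.mem_filter.1 h).2.ne b
  · exact fun i j => surgery_scalar_comm b _ _ _

/-- In the summand of each permutation `s` the nodes `i`, `j` are reindexed by `s`. The renumbering
then moves outside the surgery, and the sum over `s` gives the average of the new diagram. -/
theorem arcSum_mul_average (b : BrauerDiagram n) :
    arcSum n δ * average δ b = (1 / 2 : ℂ) • ∑ i, ∑ j, if i = j then 0 else
      arcScalar δ b (Sum.inr i) (Sum.inr j) • average δ (surgery b (Sum.inr i) (Sum.inr j)) := by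
  rw [average_eq, ← mulBilin_apply, map_sum]
  simp only [mulBilin_apply, arcSum_mul_diagram]
  rw [← Finset.smul_sum]
  congr 1
  have h : ∀ s : Equiv.Perm (Fin n), (∑ i, ∑ j, if i = j then 0 else
      arcScalar δ (relabel s b) (Sum.inr i) (Sum.inr j) •
        diagram δ (surgery (relabel s b) (Sum.inr i) (Sum.inr j))) =
      ∑ i, ∑ j, if i = j then 0 else arcScalar δ b (Sum.inr i) (Sum.inr j) •
        diagram δ (relabel s (surgery b (Sum.inr i) (Sum.inr j))) := by
    intro s
    symm
    refine Fintype.sum_equiv s _ _ fun i => Fintype.sum_equiv s _ _ fun j => ?_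
    simp only [EmbeddingLike.apply_eq_iff_eq]
    rw [relabel_surgery, ← arcScalar_relabel s b]
    rfl
  simp only [h]
  rw [Finset.sum_comm]
  refine Finset.sum_congr rfl fun i _ => ?_
  rw [Finset.sum_comm]
  refine Finset.sum_congr rfl fun j _ => ?_
  split_ifs
  · simp
  · rw [average_eq, Finset.smul_sum]

end BrauerAlgebra

namespace BrauerDiagram

variable {n : ℕ}

/-! ### Readings of a diagram -/

/-- Starting at the node `z`, passing to the vertically aligned node and following the lines that
start at the nodes of `U`, one arrives at the node `w`, where the next line starts. -/
def Seg (b : BrauerDiagram n) : Fin n ⊕ Fin n → List (Fin n ⊕ Fin n) → Fin n ⊕ Fin n → Prop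
  | z, [], w => w = z.swap
  | z, x :: U, w => x = z.swap ∧ Seg b (b.partner x) U w

/-- The list of the starting nodes of the lines of a loop, in order. -/
def Loop (b : BrauerDiagram n) : List (Fin n ⊕ Fin n) → Prop
  | [] => False
  | a :: U => Seg b (b.partner a) U a

theorem seg_append (b : BrauerDiagram n) {z c w : Fin n ⊕ Fin n} {U V : List (Fin n ⊕ Fin n)} :
    Seg b z (U ++ c :: V) w ↔ Seg b z U c ∧ Seg b (b.partner c) V w := by
  induction U generalizing z with
  | nil => rfl
  | cons x U ih => simp only [List.cons_append, Seg, ih, and_assoc]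

/-- Going backwards, each line starts at its former other end. This is why reversing a reading also
applies `partner` to its entries. -/
theorem Seg.reverse {b : BrauerDiagram n} {z w : Fin n ⊕ Fin n} {U : List (Fin n ⊕ Fin n)}
    (h : Seg b z U w) : Seg b w (U.reverse.map b.partner) z := by
  induction U generalizing z with
  | nil =>
    obtain rfl : w = z.swap := h
    exact (Sum.swap_swap z).symm
  | cons x U ih =>
    obtain ⟨rfl, h⟩ := h
    rw [List.reverse_cons, List.map_append]
    refine (seg_append b).2 ⟨ih h, ?_⟩
    rw [partner_partner]
    exact (Sum.swap_swap z).symm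

theorem Seg.congr {b b' : BrauerDiagram n} {z w : Fin n ⊕ Fin n} {U : List (Fin n ⊕ Fin n)}
    (h : Seg b z U w) (hU : ∀ x ∈ U, b'.partner x = b.partner x) : Seg b' z U w := by
  induction U generalizing z with
  | nil => exact h
  | cons x U ih =>
    refine ⟨h.1, ?_⟩
    rw [hU x List.mem_cons_self]
    exact ih h.2 fun y hy => hU y (List.mem_cons_of_mem _ hy)

theorem Loop.congr {b b' : BrauerDiagram n} {L : List (Fin n ⊕ Fin n)}
    (h : Loop b L) (hL : ∀ x ∈ L, b'.partner x = b.partner x) : Loop b' L := by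
  cases L with
  | nil => exact h
  | cons a U =>
    have := Seg.congr h fun x hx => hL x (List.mem_cons_of_mem _ hx)
    rwa [← hL a List.mem_cons_self] at this

theorem Loop.append_comm {b : BrauerDiagram n} {A B : List (Fin n ⊕ Fin n)}
    (h : Loop b (A ++ B)) : Loop b (B ++ A) := by
  rcases A with _ | ⟨a, U⟩
  · simpa using h
  rcases B with _ | ⟨c, V⟩
  · simpa using h
  exact (seg_append b).2 ((seg_append b).1 h).symm

theorem Loop.isRotated {b : BrauerDiagram n} {L L' : List (Fin n ⊕ Fin n)}
    (h : Loop b L) (hr : L ~r L') : Loop b L' := by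
  obtain ⟨k, hk, rfl⟩ := List.isRotated_iff_mod.1 hr
  rw [List.rotate_eq_drop_append_take hk]
  apply Loop.append_comm
  rwa [List.take_append_drop]

theorem Loop.reverse {b : BrauerDiagram n} {L : List (Fin n ⊕ Fin n)}
    (h : Loop b L) : Loop b (L.reverse.map b.partner) := by
  cases L with
  | nil => exact h
  | cons a U =>
    rw [List.reverse_cons, List.map_append]
    refine Loop.append_comm (A := [b.partner a]) ?_
    change Seg b (b.partner (b.partner a)) _ _
    rw [partner_partner]
    exact Seg.reverse h

theorem seg_iff (b : BrauerDiagram n) {z w : Fin n ⊕ Fin n} {U : List (Fin n ⊕ Fin n)} :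
    Seg b z U w ↔ z.swap :: U.map b.next = U ++ [w] := by
  induction U generalizing z with
  | nil => simp [Seg, eq_comm]
  | cons x U ih =>
    simp only [Seg, ih, List.map_cons, List.cons_append, List.cons.injEq, next]
    constructor
    · rintro ⟨rfl, h⟩
      exact ⟨rfl, h⟩
    · rintro ⟨rfl, h⟩
      exact ⟨rfl, h⟩

/-- The cyclic form of the definition, convenient where the first element of the list should not
play a special role. -/
theorem loop_iff (b : BrauerDiagram n) {L : List (Fin n ⊕ Fin n)} :
    Loop b L ↔ L ≠ [] ∧ L.map b.next = L.rotate 1 := by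
  cases L with
  | nil => simp [Loop]
  | cons a U => simpa [Loop, next] using seg_iff b

/-- The endpoints of the lines starting at the nodes of a list. -/
def lineNodes (b : BrauerDiagram n) (L : List (Fin n ⊕ Fin n)) : Multiset (Fin n ⊕ Fin n) :=
  (L : Multiset (Fin n ⊕ Fin n)) + (L.map b.partner : List (Fin n ⊕ Fin n))

theorem lineNodes_append (b : BrauerDiagram n) (L L' : List (Fin n ⊕ Fin n)) :
    lineNodes b (L ++ L') = lineNodes b L + lineNodes b L' := by
  simp only [lineNodes, List.map_append, ← Multiset.coe_add]
  abel

theorem lineNodes_cons (b : BrauerDiagram n) (a : Fin n ⊕ Fin n) (L : List (Fin n ⊕ Fin n)) :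
    lineNodes b (a :: L) = {a} + {b.partner a} + lineNodes b L := by
  rw [← List.singleton_append, lineNodes_append]
  rfl

theorem lineNodes_perm (b : BrauerDiagram n) {L L' : List (Fin n ⊕ Fin n)} (h : L.Perm L') :
    lineNodes b L = lineNodes b L' := by
  rw [lineNodes, lineNodes, Multiset.coe_eq_coe.2 h, Multiset.coe_eq_coe.2 (h.map _)]

theorem lineNodes_reverse (b : BrauerDiagram n) (L : List (Fin n ⊕ Fin n)) :
    lineNodes b (L.reverse.map b.partner) = lineNodes b L := by
  rw [lineNodes_perm b (L' := L.map b.partner) ((List.reverse_perm L).map _), lineNodes, lineNodes,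
    List.map_map, show b.partner ∘ b.partner = id from funext b.partner_partner, List.map_id,
    add_comm]

theorem mem_lineNodes (b : BrauerDiagram n) {L : List (Fin n ⊕ Fin n)} {x : Fin n ⊕ Fin n} :
    x ∈ lineNodes b L ↔ x ∈ L ∨ b.partner x ∈ L := by
  simp only [lineNodes, Multiset.mem_add, Multiset.mem_coe, List.mem_map]
  refine or_congr_right ⟨?_, fun h => ⟨_, h, b.partner_partner x⟩⟩
  rintro ⟨y, hy, rfl⟩
  rwa [partner_partner]

theorem lineNodes_congr {b b' : BrauerDiagram n} {L : List (Fin n ⊕ Fin n)}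
    (h : ∀ x ∈ L, b'.partner x = b.partner x) : lineNodes b' L = lineNodes b L := by
  rw [lineNodes, lineNodes, List.map_congr_left h]

theorem nodup_of_lineNodes (b : BrauerDiagram n) {L : List (Fin n ⊕ Fin n)}
    (h : (lineNodes b L).Nodup) : L.Nodup :=
  Multiset.coe_nodup.1 (Multiset.nodup_add.1 h).1

/-- The endpoints of the lines of a family of loops form a union of curves: they are stable under
`partner` by construction, and under `Sum.swap` because `next` permutes the entries of each loop. -/
theorem Loop.mem_cons {b : BrauerDiagram n} {𝓛 : List (List (Fin n ⊕ Fin n))}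
    (h : ∀ L ∈ 𝓛, Loop b L) {x y : Fin n ⊕ Fin n} (hxy : b.closure x y) :
    x ∈ lineNodes b 𝓛.flatten ↔ y ∈ lineNodes b 𝓛.flatten := by
  have hp : ∀ z, z ∈ lineNodes b 𝓛.flatten → b.partner z ∈ lineNodes b 𝓛.flatten := by
    intro z hz
    rw [mem_lineNodes] at hz ⊢
    rwa [partner_partner, or_comm]
  have hn : ∀ L ∈ 𝓛, ∀ z, z ∈ L.map b.next ↔ z ∈ L := by
    intro L hL z
    rw [((loop_iff b).1 (h L hL)).2, List.mem_rotate]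
  have hs : ∀ z, z ∈ lineNodes b 𝓛.flatten → Sum.swap z ∈ lineNodes b 𝓛.flatten := by
    intro z hz
    rw [mem_lineNodes] at hz ⊢
    simp only [List.mem_flatten] at hz ⊢
    rcases hz with ⟨L, hL, hz⟩ | ⟨L, hL, hz⟩
    · obtain ⟨y, hy, rfl⟩ := List.mem_map.1 ((hn L hL z).2 hz)
      exact Or.inr ⟨L, hL, by simpa [next, partner_partner] using hy⟩
    · refine Or.inl ⟨L, hL, (hn L hL _).1 (List.mem_map.2 ⟨_, hz, b.next_partner z⟩)⟩
  induction hxy with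
  | rel x y h =>
    rcases h with rfl | rfl
    · exact ⟨hp x, fun h => by simpa [partner_partner] using hp _ h⟩
    · exact ⟨hs x, fun h => by simpa using hs _ h⟩
  | refl => exact Iff.rfl
  | symm _ _ _ ih => exact ih.symm
  | trans _ _ _ _ _ ih1 ih2 => exact ih1.trans ih2

theorem closure_next (b : BrauerDiagram n) (x : Fin n ⊕ Fin n) : b.closure x (b.next x) :=
  Relation.EqvGen.trans _ _ _ (Relation.EqvGen.rel _ _ (Or.inl rfl))
    (Relation.EqvGen.rel _ _ (Or.inr rfl))

theorem closure_iterate (b : BrauerDiagram n) (x : Fin n ⊕ Fin n) (k : ℕ) :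
    b.closure x (b.next^[k] x) := by
  induction k with
  | zero => exact Relation.EqvGen.refl _
  | succ k ih =>
    rw [Function.iterate_succ_apply']
    exact ih.trans _ _ _ (b.closure_next _)

theorem Loop.getElem {b : BrauerDiagram n} {a : Fin n ⊕ Fin n} {U : List (Fin n ⊕ Fin n)}
    (h : Loop b (a :: U)) (k : ℕ) (hk : k < (a :: U).length) :
    (a :: U)[k] = b.next^[k] a := by
  have h1 := ((loop_iff b).1 h).2
  induction k with
  | zero => rfl
  | succ k ih =>
    rw [Function.iterate_succ_apply', ← ih (by omega)]
    have h2 := congrArg (fun l => l[k]?) h1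
    have hk' : k < (a :: U).length := by omega
    simp only [List.getElem?_map, List.getElem?_rotate hk', Nat.mod_eq_of_lt hk] at h2
    rw [List.getElem?_eq_getElem hk, List.getElem?_eq_getElem hk'] at h2
    exact (Option.some_injective _ h2).symm

theorem Loop.iterate_length {b : BrauerDiagram n} {a : Fin n ⊕ Fin n} {U : List (Fin n ⊕ Fin n)}
    (h : Loop b (a :: U)) : b.next^[(a :: U).length] a = a := by
  have h1 := ((loop_iff b).1 h).2
  have h3 := h.getElem U.length (by simp)
  rw [List.length_cons, Function.iterate_succ_apply', ← h3]
  have h2 := congrArg (fun l => l[U.length]?) h1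
  have hk' : U.length < (a :: U).length := by simp
  simp only [List.getElem?_map, List.getElem?_rotate hk', List.getElem?_eq_getElem hk'] at h2
  simpa using h2

theorem Loop.closure {b : BrauerDiagram n} {a : Fin n ⊕ Fin n} {U : List (Fin n ⊕ Fin n)}
    (h : Loop b (a :: U)) {x : Fin n ⊕ Fin n} (hx : x ∈ a :: U) : b.closure a x := by
  obtain ⟨k, hk, rfl⟩ := List.getElem_of_mem hx
  rw [h.getElem k hk]
  exact b.closure_iterate a k

/-- The entries of a loop are successive iterates of `next`. Without repetitions its length is
exactly the minimal period, so the loop is run through once. -/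
theorem Loop.loopWord {b : BrauerDiagram n} {a : Fin n ⊕ Fin n} {U : List (Fin n ⊕ Fin n)}
    (h : Loop b (a :: U)) (hU : (a :: U).Nodup) : b.loopWord a = (a :: U).map b.letterAt := by
  have hper : Function.minimalPeriod b.next a = (a :: U).length := by
    have hp : Function.IsPeriodicPt b.next (a :: U).length a := h.iterate_length
    refine le_antisymm (hp.minimalPeriod_le (by simp)) (not_lt.1 fun hlt => ?_)
    have h1 := h.getElem _ hlt
    rw [Function.iterate_minimalPeriod] at h1
    have h2 := (List.Nodup.getElem_inj_iff hU (hi := hlt) (hj := by simp) (j := 0)).1 h1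
    have h3 : a ∈ Function.periodicPts b.next := b.next_injective.mem_periodicPts _
    exact (Function.minimalPeriod_pos_of_mem_periodicPts h3).ne' h2
  unfold BrauerDiagram.loopWord
  rw [hper]
  refine List.ext_getElem (by simp) fun i h1 h2 => ?_
  simp only [List.length_map] at h2
  simp only [List.getElem_map, List.getElem_range, h.getElem i h2]

/-- A list of loops such that every line belongs to exactly one loop of the list, at exactly one
position and in one direction only. -/
structure IsReading (b : BrauerDiagram n) (𝓛 : List (List (Fin n ⊕ Fin n))) : Prop where
  loop : ∀ L ∈ 𝓛, Loop b L
  lineNodes_eq : lineNodes b 𝓛.flatten = Finset.univ.val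

/-- The product of the bracelets read off from a list of loops. -/
noncomputable def readProd (φ : Fin n ⊕ Fin n → Letter) (𝓛 : List (List (Fin n ⊕ Fin n))) :
    BraceletPoly :=
  (𝓛.map fun L => BraceletPoly.br (L.map φ)).prod

theorem readProd_cons (φ : Fin n ⊕ Fin n → Letter) (L : List (Fin n ⊕ Fin n))
    (𝓛 : List (List (Fin n ⊕ Fin n))) :
    readProd φ (L :: 𝓛) = BraceletPoly.br (L.map φ) * readProd φ 𝓛 := by
  simp [readProd]

theorem readProd_congr {φ φ' : Fin n ⊕ Fin n → Letter} {𝓛 : List (List (Fin n ⊕ Fin n))}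
    (h : ∀ L ∈ 𝓛, ∀ x ∈ L, φ x = φ' x) : readProd φ 𝓛 = readProd φ' 𝓛 := by
  unfold readProd
  congr 1
  exact List.map_congr_left fun L hL => by rw [List.map_congr_left (h L hL)]

-- Endpoints are not repeated, so different loops of the list lie on different curves, and each
-- curve that is met contributes its bracelet once.
open Classical in
theorem readProd_eq_prod_filter {b : BrauerDiagram n} {𝓛 : List (List (Fin n ⊕ Fin n))}
    (h : ∀ L ∈ 𝓛, Loop b L) (hnd : (lineNodes b 𝓛.flatten).Nodup) :
    readProd b.letterAt 𝓛 =
      ∏ c : Quotient b.closure with ∃ x ∈ 𝓛.flatten, Quotient.mk _ x = c, X (b.loopBracelet c) := by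
  induction 𝓛 with
  | nil => simp [readProd]
  | cons L 𝓛 ih =>
    rw [List.flatten_cons, lineNodes_append, Multiset.nodup_add] at hnd
    obtain ⟨h1, h2, h3⟩ := hnd
    have hL := h L List.mem_cons_self
    have h𝓛 : ∀ L ∈ 𝓛, Loop b L := fun L hL => h L (List.mem_cons_of_mem _ hL)
    obtain ⟨a, U, rfl⟩ : ∃ a U, L = a :: U := by
      cases L with
      | nil => exact hL.elim
      | cons a U => exact ⟨a, U, rfl⟩
    have hset : (Finset.univ.filter fun c : Quotient b.closure =>
        ∃ x ∈ ((a :: U) :: 𝓛).flatten, Quotient.mk _ x = c) =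
        insert (Quotient.mk _ a) (Finset.univ.filter fun c : Quotient b.closure =>
          ∃ x ∈ 𝓛.flatten, Quotient.mk _ x = c) := by
      ext c
      simp only [Finset.mem_filter, Finset.mem_univ, true_and, Finset.mem_insert, List.flatten_cons,
        List.mem_append]
      constructor
      · rintro ⟨x, hx | hx, rfl⟩
        · exact Or.inl (Quotient.sound (hL.closure hx)).symm
        · exact Or.inr ⟨x, hx, rfl⟩
      · rintro (rfl | ⟨x, hx, rfl⟩)
        · exact ⟨a, Or.inl List.mem_cons_self, rfl⟩
        · exact ⟨x, Or.inr hx, rfl⟩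
    rw [hset, Finset.prod_insert, readProd_cons, ih h𝓛 h2]
    · congr 1
      exact congrArg (fun w => BraceletPoly.br w) (hL.loopWord (nodup_of_lineNodes b h1)).symm
    · simp only [Finset.mem_filter, Finset.mem_univ, true_and, not_exists, not_and]
      intro x hx hxa
      refine Multiset.disjoint_left.1 h3 ((mem_lineNodes b).2 (Or.inl (List.mem_cons_self (a := a)))) ?_
      exact (Loop.mem_cons h𝓛 (Quotient.exact hxa)).1 ((mem_lineNodes b).2 (Or.inl hx))

theorem IsReading.mem {b : BrauerDiagram n} {𝓛 : List (List (Fin n ⊕ Fin n))}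
    (h : IsReading b 𝓛) (x : Fin n ⊕ Fin n) : x ∈ 𝓛.flatten ∨ b.partner x ∈ 𝓛.flatten := by
  rw [← mem_lineNodes, h.lineNodes_eq]
  exact Finset.mem_univ x

theorem IsReading.nodup {b : BrauerDiagram n} {𝓛 : List (List (Fin n ⊕ Fin n))}
    (h : IsReading b 𝓛) : (lineNodes b 𝓛.flatten).Nodup := by
  rw [h.lineNodes_eq]
  exact Finset.univ.nodup

/-- Every reading computes the product of the bracelets of the loops. -/
theorem IsReading.readProd_eq {b : BrauerDiagram n} {𝓛 : List (List (Fin n ⊕ Fin n))}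
    (h : IsReading b 𝓛) : readProd b.letterAt 𝓛 = b.bracelets := by
  classical
  rw [readProd_eq_prod_filter h.loop h.nodup, bracelets]
  refine Finset.prod_congr ?_ fun _ _ => rfl
  rw [Finset.filter_eq_self]
  intro c _
  induction c using Quotient.inductionOn with
  | h x =>
    rcases h.mem x with hx | hx
    · exact ⟨x, hx, rfl⟩
    · exact ⟨_, hx, Quotient.sound (Relation.EqvGen.symm _ _ (Relation.EqvGen.rel _ _ (Or.inl rfl)))⟩

theorem IsReading.perm {b : BrauerDiagram n} {𝓛 𝓛' : List (List (Fin n ⊕ Fin n))}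
    (h : IsReading b 𝓛) (hp : 𝓛.Perm 𝓛') : IsReading b 𝓛' :=
  ⟨fun L hL => h.loop L (hp.mem_iff.2 hL),
    (lineNodes_perm b hp.flatten).symm.trans h.lineNodes_eq⟩

theorem IsReading.replace {b : BrauerDiagram n} {𝓛 : List (List (Fin n ⊕ Fin n))}
    {L L' : List (Fin n ⊕ Fin n)} (h : IsReading b (L :: 𝓛)) (h' : Loop b L')
    (hn : lineNodes b L' = lineNodes b L) : IsReading b (L' :: 𝓛) := by
  refine ⟨fun M hM => ?_, ?_⟩
  · rcases List.mem_cons.1 hM with rfl | hM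
    · exact h'
    · exact h.loop M (List.mem_cons_of_mem _ hM)
  · have := h.lineNodes_eq
    rw [List.flatten_cons, lineNodes_append] at this ⊢
    rw [hn, this]

/-- No loop traverses a line in both directions. Otherwise the reversal of the walk would map the
loop to itself and have a fixed place halfway. -/
theorem partner_iterate_ne (b : BrauerDiagram n) (x : Fin n ⊕ Fin n) (k j : ℕ) :
    b.partner (b.next^[k] x) ≠ b.next^[j] x := by
  have hiter : ∀ (k : ℕ) (y : Fin n ⊕ Fin n),
      b.next^[k] (b.partner (b.next^[k] y)) = b.partner y := by
    intro k
    induction k with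
    | zero => intro y; rfl
    | succ k ih =>
      intro y
      rw [Function.iterate_succ_apply' _ _ y, Function.iterate_succ_apply, partner_next_next, ih]
  intro h
  have h1 := hiter k x
  rw [h, ← Function.iterate_add_apply] at h1
  -- The halfway place is a node equal to its own partner in the even case, and a node equal to its
  -- vertically opposite node in the odd case. Both are impossible.
  rcases Nat.even_or_odd' (k + j) with ⟨t, ht | ht⟩
  · rw [ht, ← hiter t, two_mul, Function.iterate_add_apply] at h1
    exact b.partner_ne _ ((b.next_injective.iterate t) h1).symm
  · rw [ht, ← hiter t, show 2 * t + 1 = t + (t + 1) by ring, Function.iterate_add_apply,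
      Function.iterate_succ_apply'] at h1
    have h2 := (b.next_injective.iterate t) h1
    simp only [next] at h2
    generalize b.partner _ = y at h2
    rcases y with y | y <;> simp at h2

theorem exists_loop (b : BrauerDiagram n) (x : Fin n ⊕ Fin n) :
    ∃ U, Loop b (x :: U) ∧ (lineNodes b (x :: U)).Nodup := by
  have hx : x ∈ Function.periodicPts b.next := b.next_injective.mem_periodicPts x
  have hpos := Function.minimalPeriod_pos_of_mem_periodicPts hx
  have hit := Function.iterate_minimalPeriod (f := b.next) (x := x)
  obtain ⟨m, hm⟩ : ∃ m, Function.minimalPeriod b.next x = m + 1 := ⟨_, (Nat.sub_add_cancel hpos).symm⟩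
  rw [hm] at hit
  have hlist : (List.range (m + 1)).map (fun k => b.next^[k] x) =
      x :: (List.range m).map (fun k => b.next^[k + 1] x) := by
    rw [List.range_succ_eq_map]
    simp [Function.comp_def]
  refine ⟨(List.range m).map (fun k => b.next^[k + 1] x), ?_, ?_⟩
  · rw [loop_iff]
    refine ⟨by simp, ?_⟩
    conv_rhs => rw [List.rotate_cons_succ, List.rotate_zero]
    rw [← hlist, List.range_succ]
    simp only [List.map_append, List.map_map, List.map_cons, List.map_nil, Function.comp_def,
      ← Function.iterate_succ_apply', hit]
  · rw [← hlist, lineNodes, Multiset.nodup_add, Multiset.coe_nodup, Multiset.coe_nodup]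
    have hnd : ((List.range (m + 1)).map (fun k => b.next^[k] x)).Nodup := by
      refine List.Nodup.map_on (fun i hi j hj hij => ?_) List.nodup_range
      rw [List.mem_range] at hi hj
      exact Function.iterate_injOn_Iio_minimalPeriod (f := b.next) (x := x)
        (by simpa [hm] using hi) (by simpa [hm] using hj) hij
    refine ⟨hnd, hnd.map b.partner_injective, ?_⟩
    rw [Multiset.disjoint_left]
    intro y hy hy'
    simp only [Multiset.mem_coe, List.mem_map] at hy hy'
    obtain ⟨j, _, rfl⟩ := hy
    obtain ⟨_, ⟨k, _, rfl⟩, h⟩ := hy'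
    exact b.partner_iterate_ne x k j h

/-- Loops through nodes not yet covered are added one after the other. The induction is on a bound
for the number of uncovered nodes, and a new loop covers whole curves, hence only nodes not covered
before. -/
theorem exists_reading (b : BrauerDiagram n) : ∃ 𝓛, IsReading b 𝓛 := by
  suffices h : ∀ (k : ℕ) (𝓛 : List (List (Fin n ⊕ Fin n))), (∀ L ∈ 𝓛, Loop b L) →
      (lineNodes b 𝓛.flatten).Nodup →
      Fintype.card (Fin n ⊕ Fin n) ≤ Multiset.card (lineNodes b 𝓛.flatten) + k →
      ∃ 𝓛, IsReading b 𝓛 from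
    h (Fintype.card (Fin n ⊕ Fin n)) [] (by simp) (by simp [lineNodes]) (by simp)
  intro k
  induction k with
  | zero =>
    intro 𝓛 h1 h2 h3
    refine ⟨𝓛, h1, ?_⟩
    refine Multiset.eq_of_le_of_card_le ?_ h3
    exact (Multiset.le_iff_subset h2).2 fun x _ => Finset.mem_univ x
  | succ k ih =>
    intro 𝓛 h1 h2 h3
    by_cases hall : ∀ x, x ∈ lineNodes b 𝓛.flatten
    · refine ⟨𝓛, h1, Multiset.Nodup.ext h2 Finset.univ.nodup |>.2 fun x => ?_⟩
      simp [hall x]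
    push Not at hall
    obtain ⟨x, hx⟩ := hall
    obtain ⟨U, hU, hnd⟩ := b.exists_loop x
    refine ih ((x :: U) :: 𝓛) ?_ ?_ ?_
    · intro L hL
      rcases List.mem_cons.1 hL with rfl | hL
      · exact hU
      · exact h1 L hL
    · rw [List.flatten_cons, lineNodes_append, Multiset.nodup_add]
      refine ⟨hnd, h2, Multiset.disjoint_left.2 ?_⟩
      intro y hy hy'
      apply hx
      rcases (mem_lineNodes b).1 hy with hy | hy
      · exact (Loop.mem_cons h1 (hU.closure hy)).2 hy'
      · refine (Loop.mem_cons h1 (hU.closure hy)).2 ?_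
        rw [mem_lineNodes, partner_partner, or_comm]
        exact (mem_lineNodes b).1 hy'
    · rw [List.flatten_cons, lineNodes_append, lineNodes_cons]
      simp only [Multiset.card_add, Multiset.card_singleton]
      omega

/-- A loop can be rotated and reversed so as to spell any given representative of its bracelet. -/
theorem Loop.exists_map_eq {b : BrauerDiagram n} {L : List (Fin n ⊕ Fin n)} (h : Loop b L)
    {ψ : Fin n ⊕ Fin n → Letter} (hψ : ∀ x, ψ (b.partner x) = ψ x) {w : List Letter}
    (hw : Bracelet.mk (L.map ψ) = Bracelet.mk w) :
    ∃ L', Loop b L' ∧ lineNodes b L' = lineNodes b L ∧ L'.map ψ = w := by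
  rcases Quotient.exact hw with ⟨k, hk⟩ | ⟨k, hk⟩
  · refine ⟨L.rotate k, h.isRotated ⟨k, rfl⟩, lineNodes_perm b (List.rotate_perm L k), ?_⟩
    rw [List.map_rotate, hk]
  · refine ⟨(L.reverse.map b.partner).rotate k, h.reverse.isRotated ⟨k, rfl⟩, ?_, ?_⟩
    · rw [lineNodes_perm b (List.rotate_perm _ k), lineNodes_reverse]
    · rw [List.map_rotate, List.map_map, show ψ ∘ b.partner = ψ from funext hψ, List.map_reverse, hk]

end BrauerDiagram

/-! ### Words as walks between the two rows -/

namespace Letter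

/-- The letter of a line that starts in the row `q` and after which the next line starts in the row
`r`, the lower row being `true`. -/
def step : Bool → Bool → Letter
  | true, true => p
  | true, false => s
  | false, true => n
  | false, false => p

/-- The word `w` can be read along lines such that the first line starts in the row `q` and the line
after the last one starts in the row `q'`. -/
def Walk : Bool → List Letter → Bool → Prop
  | q, [], q' => q' = q
  | q, a :: w, q' => ∃ r, a = step q r ∧ Walk r w q'

theorem walk_nil {q q' : Bool} : Walk q [] q' ↔ q' = q := Iff.rfl

theorem walk_p {q q' : Bool} {w : List Letter} : Walk q (p :: w) q' ↔ Walk q w q' := by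
  cases q <;> simp [Walk, step]

theorem walk_s {q q' : Bool} {w : List Letter} :
    Walk q (s :: w) q' ↔ q = true ∧ Walk false w q' := by
  cases q <;> simp [Walk, step]

theorem walk_n {q q' : Bool} {w : List Letter} :
    Walk q (n :: w) q' ↔ q = false ∧ Walk true w q' := by
  cases q <;> simp [Walk, step]

theorem walk_append {q q' : Bool} {u v : List Letter} :
    Walk q (u ++ v) q' ↔ ∃ r, Walk q u r ∧ Walk r v q' := by
  induction u generalizing q with
  | nil => simp [Walk]
  | cons a u ih =>
    simp only [List.cons_append, Walk, ih]
    constructor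
    · rintro ⟨r, h, t, h1, h2⟩
      exact ⟨t, ⟨r, h, h1⟩, h2⟩
    · rintro ⟨t, ⟨r, h, h1⟩, h2⟩
      exact ⟨r, h, t, h1, h2⟩

theorem Walk.reverse {q q' : Bool} {w : List Letter} (h : Walk q w q') :
    Walk (!q') w.reverse (!q) := by
  induction w generalizing q with
  | nil => rw [walk_nil.1 h]; rfl
  | cons a w ih =>
    obtain ⟨r, rfl, h⟩ := h
    rw [List.reverse_cons, walk_append]
    refine ⟨!r, ih h, ?_⟩
    cases q <;> cases r <;> simp [Walk, step]

theorem Walk.undotted {q q' : Bool} {w : List Letter} (h : Walk q w q') : ∀ a ∈ w, a.dots = 0 := by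
  induction w generalizing q with
  | nil => simp
  | cons a w ih =>
    obtain ⟨r, rfl, h⟩ := h
    rintro a (_ | ⟨_, ha⟩)
    · cases q <;> cases r <;> rfl
    · exact ih h a ha

/-- Each `s` leaves the lower row and each `n` returns to it, so the difference of their numbers
records the change of row. Most statements about the rows of a word are deduced from this balance.
-/
theorem Walk.count {q q' : Bool} {w : List Letter} (h : Walk q w q') :
    w.count s + q'.toNat = w.count n + q.toNat := by
  induction w generalizing q with
  | nil => rw [walk_nil.1 h]; rfl
  | cons a w ih =>
    obtain ⟨r, rfl, h⟩ := h
    have := ih h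
    cases q <;> cases r <;> simp [step] at this ⊢ <;> omega

theorem Walk.s_mem {w : List Letter} (h : Walk true w false) : s ∈ w := by
  have := h.count
  simp only [Bool.toNat_true, Bool.toNat_false] at this
  exact List.count_pos_iff.1 (by omega)

theorem Walk.n_mem {w : List Letter} (h : Walk false w true) : n ∈ w := by
  have := h.count
  simp only [Bool.toNat_true, Bool.toNat_false] at this
  exact List.count_pos_iff.1 (by omega)

theorem walk_of_forall_eq_p {w : List Letter} (h : ∀ a ∈ w, a = p) (q : Bool) : Walk q w q := by
  induction w with
  | nil => rfl
  | cons a w ih =>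
    rw [h a List.mem_cons_self, walk_p]
    exact ih fun a ha => h a (List.mem_cons_of_mem _ ha)

theorem forall_eq_p {w : List Letter} (hw : ∀ a ∈ w, a.dots = 0) (hn : n ∉ w) (hs : s ∉ w) :
    ∀ a ∈ w, a = p := by
  intro a ha
  have := hw a ha
  cases a <;> simp_all [dots]

theorem reverse_of_forall_eq_p {w : List Letter} (h : ∀ a ∈ w, a = p) : w.reverse = w := by
  rw [List.eq_replicate_of_mem h, List.reverse_replicate]

/-- A letter `n` or `s` fixes the row in which its line starts. Words in `p` alone are therefore the
only ones that leave the rows undetermined. -/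
theorem Walk.forall_eq_p {w : List Letter} {q q' : Bool} (h : Walk true w q) (h' : Walk false w q') :
    ∀ a ∈ w, a = p := by
  induction w generalizing q q' with
  | nil => simp
  | cons a w ih =>
    have ha := h.undotted a List.mem_cons_self
    cases a with
    | n => simp [walk_n] at h
    | s => simp [walk_s] at h'
    | p =>
      rw [walk_p] at h h'
      simpa using ih h h'
    | _ => simp [dots] at ha

/-- The conditions on `n` and `s` say that these letters alternate, which is what is needed to
assign rows consistently. The walk is built from the right. -/
theorem exists_walk {w : List Letter} (hw : ∀ a ∈ w, a.dots = 0)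
    (hn : ∀ x y z, w = x ++ n :: y ++ n :: z → s ∈ y)
    (hs : ∀ x y z, w = x ++ s :: y ++ s :: z → n ∈ y) : ∃ q q', Walk q w q' := by
  induction w with
  | nil => exact ⟨true, true, rfl⟩
  | cons a w ih =>
    have hw' : ∀ a ∈ w, a.dots = 0 := fun b hb => hw b (List.mem_cons_of_mem _ hb)
    obtain ⟨q, q', h⟩ := ih hw'
      (fun x y z e => hn (a :: x) y z (by rw [e]; rfl))
      (fun x y z e => hs (a :: x) y z (by rw [e]; rfl))
    have ha := hw a List.mem_cons_self
    cases a with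
    | p => exact ⟨q, q', walk_p.2 h⟩
    | n =>
      cases q with
      | true => exact ⟨false, q', walk_n.2 ⟨rfl, h⟩⟩
      | false =>
        -- The walk of the tail starts in the wrong row. If the tail contains another `n`, the part
        -- before the first one contains an `s` but no `n`, against the balance of letters. If not,
        -- the tail has no `s` either, consists of letters `p`, and can be read from the other row.
        by_cases hmem : n ∈ w
        · obtain ⟨y, z, rfl, hy⟩ := List.eq_append_cons_of_mem hmem
          have hsy := hn [] y z rfl
          obtain ⟨r, h1, h2⟩ := walk_append.1 h
          obtain ⟨rfl, _⟩ := walk_n.1 h2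
          have hc := h1.count
          rw [List.count_eq_zero_of_not_mem hy] at hc
          have := List.count_pos_iff.2 hsy
          simp at hc
          omega
        · have hc := h.count
          rw [List.count_eq_zero_of_not_mem hmem] at hc
          simp only [Bool.toNat_false] at hc
          have hs' : s ∉ w := List.count_eq_zero.1 (by omega)
          exact ⟨false, true, walk_n.2 ⟨rfl, walk_of_forall_eq_p (Letter.forall_eq_p hw' hmem hs') _⟩⟩
    | s =>
      cases q with
      | false => exact ⟨true, q', walk_s.2 ⟨rfl, h⟩⟩
      | true =>
        by_cases hmem : s ∈ w
        · obtain ⟨y, z, rfl, hy⟩ := List.eq_append_cons_of_mem hmem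
          have hny := hs [] y z rfl
          obtain ⟨r, h1, h2⟩ := walk_append.1 h
          obtain ⟨rfl, _⟩ := walk_s.1 h2
          have hc := h1.count
          rw [List.count_eq_zero_of_not_mem hy] at hc
          have := List.count_pos_iff.2 hny
          simp at hc
          omega
        · have hc := h.count
          rw [List.count_eq_zero_of_not_mem hmem] at hc
          have hq : q'.toNat ≤ 1 := Bool.toNat_le q'
          simp only [Bool.toNat_true] at hc
          have hn' : n ∉ w := List.count_eq_zero.1 (by omega)
          exact ⟨true, false, walk_s.2 ⟨rfl, walk_of_forall_eq_p (Letter.forall_eq_p hw' hn' hmem) _⟩⟩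
    | _ => simp [dots] at ha

theorem walk_of_rel {w w' : List Letter} (h : braceletSetoid w w') (hw : ∃ q, Walk q w q) :
    ∃ q, Walk q w' q := by
  have hrot : ∀ w w' : List Letter, w ~r w' → (∃ q, Walk q w q) → ∃ q, Walk q w' q := by
    rintro w w' hr ⟨q, hq⟩
    obtain ⟨k, hk, rfl⟩ := List.isRotated_iff_mod.1 hr
    rw [List.rotate_eq_drop_append_take hk]
    rw [← List.take_append_drop k w, walk_append] at hq
    obtain ⟨r, h1, h2⟩ := hq
    exact ⟨r, walk_append.2 ⟨q, h2, h1⟩⟩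
  rcases h with h | h
  · exact hrot _ _ h hw
  · refine hrot _ _ h ?_
    obtain ⟨q, hq⟩ := hw
    exact ⟨_, hq.reverse⟩

/-- The bracelets in `𝔟(𝒜)` are those of the non-empty closed walks. -/
theorem mk_mem_plainBracelets {w : List Letter} :
    Bracelet.mk w ∈ Bracelet.plainBracelets ↔ w ≠ [] ∧ ∃ q, Walk q w q := by
  constructor
  · intro h
    obtain ⟨h1, h2, h3, h4, h5⟩ := h w rfl
    obtain ⟨q, q', hq⟩ := exists_walk h2 h4 h5
    refine ⟨h1, q, ?_⟩
    have hc := hq.count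
    rw [h3] at hc
    have : q' = q := by cases q <;> cases q' <;> simp at hc ⊢
    rwa [this] at hq
  · rintro ⟨h1, h2⟩ w' hw'
    have hrel : braceletSetoid w w' := Quotient.exact hw'.symm
    obtain ⟨q, hq⟩ := walk_of_rel hrel h2
    refine ⟨?_, hq.undotted, ?_, ?_, ?_⟩
    · rintro rfl
      exact h1 (List.perm_nil.1 (Bracelet.perm_of_rel hrel))
    · have := hq.count
      omega
    · rintro x y z rfl
      rw [List.append_assoc, walk_append] at hq
      obtain ⟨r, _, h⟩ := hq
      rw [List.cons_append, walk_n, walk_append] at h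
      obtain ⟨_, t, h, h'⟩ := h
      rw [(walk_n.1 h').1] at h
      exact h.s_mem
    · rintro x y z rfl
      rw [List.append_assoc, walk_append] at hq
      obtain ⟨r, _, h⟩ := hq
      rw [List.cons_append, walk_s, walk_append] at h
      obtain ⟨_, t, h, h'⟩ := h
      rw [(walk_s.1 h').1] at h
      exact h.n_mem

theorem Walk.fit {u : List Letter} (h : Walk true u true) : BraceletPoly.Fit u := by
  by_cases hu : u = []
  · exact Or.inl hu
  refine Or.inr ⟨mk_mem_plainBracelets.2 ⟨hu, _, h⟩, ?_⟩
  rintro x y rfl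
  obtain ⟨r, _, h⟩ := walk_append.1 h
  exact (walk_s.1 h).2.n_mem

/-- Fitness is how a word remembers that it starts in the lower row. A closed walk from the upper
row returns there with its last `s`, if it has one, and cannot be followed by an `n`; so a fit one
has no `s`, and by balance no `n`. -/
theorem Walk.of_fit {u : List Letter} {q q' : Bool} (h : Walk q u q') (hu : BraceletPoly.Fit u) :
    q' = q ∧ (q = false → ∀ a ∈ u, a = p) := by
  rcases hu with rfl | ⟨h1, h2⟩
  · exact ⟨h, by simp⟩
  obtain ⟨_, r, hr⟩ := mk_mem_plainBracelets.1 h1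
  have hc := h.count
  have hc' := hr.count
  have hq : q' = q := by cases q <;> cases q' <;> simp at hc ⊢ <;> omega
  refine ⟨hq, ?_⟩
  rintro rfl
  subst hq
  have hs : s ∉ u := by
    intro hs
    obtain ⟨y, x, hu, hy⟩ := List.eq_append_cons_of_mem (List.mem_reverse.2 hs)
    obtain rfl : u = x.reverse ++ s :: y.reverse := by
      rw [← List.reverse_reverse u, hu]
      simp
    have hny := h2 _ _ rfl
    obtain ⟨r, _, h⟩ := walk_append.1 h
    have hc := (walk_s.1 h).2.count
    rw [List.count_eq_zero_of_not_mem (by simpa using hy)] at hc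
    have := List.count_pos_iff.2 hny
    simp only [Bool.toNat_false] at hc
    omega
  refine Letter.forall_eq_p h.undotted ?_ hs
  rw [List.count_eq_zero_of_not_mem hs] at hc
  exact List.count_eq_zero.1 (by omega)

/-- The rows in which the lines of a walk start. -/
def rows : Bool → List Letter → List Bool
  | _, [] => []
  | q, n :: w => q :: rows true w
  | q, s :: w => q :: rows false w
  | q, _ :: w => q :: rows q w

theorem rows_step (q r : Bool) (w : List Letter) : rows q (step q r :: w) = q :: rows r w := by
  cases q <;> cases r <;> rfl

end Letter

namespace BrauerDiagram

open Letter

variable {n : ℕ}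

theorem letterAt_eq_step (b : BrauerDiagram n) (x : Fin n ⊕ Fin n) :
    b.letterAt x = step x.isRight (b.next x).isRight := by
  unfold letterAt next
  rcases x with x | x <;> rcases b.partner _ with y | y <;> rfl

theorem Seg.walk {b : BrauerDiagram n} {z w : Fin n ⊕ Fin n} {U : List (Fin n ⊕ Fin n)}
    (h : Seg b z U w) : Walk z.swap.isRight (U.map b.letterAt) w.isRight := by
  induction U generalizing z with
  | nil =>
    obtain rfl : w = z.swap := h
    rfl
  | cons x U ih =>
    obtain ⟨rfl, h⟩ := h
    exact ⟨_, letterAt_eq_step b _, ih h⟩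

theorem Seg.rows {b : BrauerDiagram n} {z w : Fin n ⊕ Fin n} {U : List (Fin n ⊕ Fin n)}
    (h : Seg b z U w) : U.map Sum.isRight = rows z.swap.isRight (U.map b.letterAt) := by
  induction U generalizing z with
  | nil => rfl
  | cons x U ih =>
    obtain ⟨rfl, h⟩ := h
    rw [List.map_cons, List.map_cons, letterAt_eq_step, rows_step, ih h]
    rfl

theorem Loop.walk {b : BrauerDiagram n} {a : Fin n ⊕ Fin n} {U : List (Fin n ⊕ Fin n)}
    (h : Loop b (a :: U)) : Walk a.isRight ((a :: U).map b.letterAt) a.isRight :=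
  ⟨_, letterAt_eq_step b a, Seg.walk h⟩

theorem Loop.rows {b : BrauerDiagram n} {a : Fin n ⊕ Fin n} {U : List (Fin n ⊕ Fin n)}
    (h : Loop b (a :: U)) :
    (a :: U).map Sum.isRight = Letter.rows a.isRight ((a :: U).map b.letterAt) := by
  rw [List.map_cons, List.map_cons, letterAt_eq_step, rows_step, Seg.rows h]
  rfl

theorem Loop.mk_mem_plainBracelets {b : BrauerDiagram n} {L : List (Fin n ⊕ Fin n)}
    (h : Loop b L) : Bracelet.mk (L.map b.letterAt) ∈ Bracelet.plainBracelets := by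
  cases L with
  | nil => exact h.elim
  | cons a U => exact Letter.mk_mem_plainBracelets.2 ⟨by simp, _, h.walk⟩

/-! ### Diagrams with the same bracelets -/

open Classical in
/-- The rows of the starting nodes along a standard walk with a given bracelet. -/
noncomputable def standardRows (β : Bracelet) : List Bool :=
  Letter.rows (if Walk true (Quotient.out β) true then true else false) (Quotient.out β)

/-- The loop is rotated and reversed until it spells the chosen representative of its bracelet. The
word then determines the rows, except when it consists of letters `p` only; such a loop can be
reversed without changing the word. -/
theorem Loop.exists_standard {b : BrauerDiagram n} {L : List (Fin n ⊕ Fin n)} (h : Loop b L) :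
    ∃ L', Loop b L' ∧ lineNodes b L' = lineNodes b L ∧
      L'.map Sum.isRight = standardRows (Bracelet.mk (L.map b.letterAt)) := by
  set w := Quotient.out (Bracelet.mk (L.map b.letterAt)) with hw
  obtain ⟨L', h1, h2, h3⟩ := h.exists_map_eq b.letterAt_partner (w := w)
    (Quotient.out_eq (Bracelet.mk (L.map b.letterAt))).symm
  rcases L' with _ | ⟨a, U⟩
  · exact h1.elim
  have hwalk := h1.walk
  rw [h3] at hwalk
  unfold standardRows
  rw [← hw]
  by_cases ha : a.isRight = true
  · rw [ha] at hwalk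
    refine ⟨_, h1, h2, ?_⟩
    rw [if_pos hwalk, h1.rows, h3, ha]
  by_cases hwt : Walk true w true
  · rw [if_pos hwt]
    rw [Bool.not_eq_true] at ha
    rw [ha] at hwalk
    -- The word is readable from both rows, so all its letters are `p`. The loop, which starts in
    -- the upper row, is reversed so as to start in the lower row as the convention demands.
    have hp := hwt.forall_eq_p hwalk
    have hpa : b.letterAt a = p := hp _ (by rw [← h3]; exact List.mem_cons_self)
    have hside : (b.partner a).isRight = true := by
      rw [letterAt_eq_step, ha, next] at hpa
      generalize b.partner a = y at hpa
      rcases y with y | y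
      · simp [step] at hpa
      · rfl
    have h4 : Loop b (b.partner a :: U.reverse.map b.partner) := by
      have := h1.reverse
      rw [List.reverse_cons, List.map_append] at this
      exact this.append_comm
    refine ⟨_, h4, ?_, ?_⟩
    · rw [← h2, lineNodes_cons, lineNodes_cons, lineNodes_reverse, partner_partner,
        add_comm {b.partner a}]
    · rw [h4.rows, hside]
      congr 1
      rw [← reverse_of_forall_eq_p hp, ← h3]
      have hp' : (a :: U).map b.letterAt = b.letterAt a :: U.map b.letterAt := rfl
      have hU : ∀ c ∈ U.map b.letterAt, c = p := by
        intro c hc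
        exact hp c (by rw [← h3]; exact List.mem_cons_of_mem _ hc)
      rw [← h3] at hp
      rw [reverse_of_forall_eq_p hp, List.map_cons, List.map_cons, letterAt_partner, List.map_map,
        show b.letterAt ∘ b.partner = b.letterAt from funext b.letterAt_partner, List.map_reverse,
        reverse_of_forall_eq_p hU]
  · rw [if_neg hwt]
    refine ⟨_, h1, h2, ?_⟩
    rw [Bool.not_eq_true] at ha
    rw [h1.rows, h3, ha]

theorem IsReading.exists_standard {b : BrauerDiagram n} {𝓛 : List (List (Fin n ⊕ Fin n))}
    (h : IsReading b 𝓛) : ∃ 𝓛', IsReading b 𝓛' ∧ 𝓛'.map (List.map Sum.isRight) =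
      (𝓛.map fun L => Bracelet.mk (L.map b.letterAt)).map standardRows := by
  suffices H : ∀ 𝓛 : List (List (Fin n ⊕ Fin n)), (∀ L ∈ 𝓛, Loop b L) →
      ∃ 𝓛' : List (List (Fin n ⊕ Fin n)), (∀ L ∈ 𝓛', Loop b L) ∧ lineNodes b 𝓛'.flatten = lineNodes b 𝓛.flatten ∧
        𝓛'.map (List.map Sum.isRight) =
          (𝓛.map fun L => Bracelet.mk (L.map b.letterAt)).map standardRows by
    obtain ⟨𝓛', h1, h2, h3⟩ := H 𝓛 h.loop
    exact ⟨𝓛', ⟨h1, h2.trans h.lineNodes_eq⟩, h3⟩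
  intro 𝓛 h
  induction 𝓛 with
  | nil => exact ⟨[], by simp, rfl, rfl⟩
  | cons L 𝓛 ih =>
    obtain ⟨𝓛', h1, h2, h3⟩ := ih fun L hL => h L (List.mem_cons_of_mem _ hL)
    obtain ⟨L', h4, h5, h6⟩ := (h L List.mem_cons_self).exists_standard
    refine ⟨L' :: 𝓛', ?_, ?_, ?_⟩
    · intro M hM
      rcases List.mem_cons.1 hM with rfl | hM
      exacts [h4, h1 M hM]
    · rw [List.flatten_cons, List.flatten_cons, lineNodes_append, lineNodes_append, h2, h5]
    · simp only [List.map_cons, h6, h3]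

end BrauerDiagram

/-! ### Matching and regrouping lists. -/

namespace List

variable {α β γ : Type*}

theorem exists_equiv_map_eq {A : List α} {B : List β} (hA : A.Nodup) (hA' : ∀ x, x ∈ A)
    (hB : B.Nodup) (hB' : ∀ y, y ∈ B) (h : A.length = B.length) : ∃ e : α ≃ β, A.map e = B := by
  classical
  let eA := hA.getEquivOfForallMemList A hA'
  let eB := hB.getEquivOfForallMemList B hB'
  refine ⟨eA.symm.trans ((finCongr h).trans eB), ?_⟩
  refine List.ext_getElem (by simpa using h) fun i h1 h2 => ?_
  have h1' : i < A.length := by simpa using h1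
  have : eA.symm A[i] = ⟨i, h1'⟩ := by
    rw [Equiv.symm_apply_eq]
    rfl
  simp only [getElem_map, Equiv.trans_apply, this]
  rfl

theorem eq_of_flatten_eq {K K' : List (List α)} (h : K.flatten = K'.flatten)
    (hl : K.map length = K'.map length) : K = K' := by
  induction K generalizing K' with
  | nil =>
    cases K' with
    | nil => rfl
    | cons => simp at hl
  | cons A K ih =>
    cases K' with
    | nil => simp at hl
    | cons A' K' =>
      simp only [map_cons, cons.injEq] at hl
      simp only [flatten_cons] at h
      obtain ⟨h1, h2⟩ := append_inj h hl.1
      rw [h1, ih h2 hl.2]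

theorem exists_flatten_eq (W : List (List α)) (A : List β) (h : A.length = W.flatten.length) :
    ∃ K : List (List β), K.flatten = A ∧ K.map length = W.map length := by
  induction W generalizing A with
  | nil => exact ⟨[], by simpa [eq_comm] using h, rfl⟩
  | cons w W ih =>
    rw [flatten_cons, length_append] at h
    obtain ⟨K, h1, h2⟩ := ih (A.drop w.length) (by rw [length_drop]; omega)
    refine ⟨A.take w.length :: K, by rw [flatten_cons, h1, take_append_drop], ?_⟩
    rw [map_cons, map_cons, h2, length_take, min_eq_left (by omega)]

theorem exists_perm_map_eq {f : α → γ} {A : List α} {C : List γ} (h : C.Perm (A.map f)) :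
    ∃ B : List α, B.Perm A ∧ B.map f = C := by
  obtain ⟨B, hB, hB'⟩ := perm_comp_forall₂ (r := fun c a => c = f a) h
    (forall₂_map_left_iff.2 (forall₂_same.2 fun _ _ => rfl))
  refine ⟨B, hB', ?_⟩
  have : Forall₂ (· = ·) C (B.map f) := forall₂_map_right_iff.2 hB
  rw [forall₂_eq_eq_eq] at this
  exact this.symm

end List

namespace BrauerDiagram

open Letter

variable {n : ℕ}

/-- Matching the two readings place by place gives a bijection of the nodes that commutes with
`partner` and with `next`, hence with `Sum.swap`, and preserves the rows. Such a bijection is one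
permutation acting on both rows. -/
theorem IsReading.exists_relabel {b b' : BrauerDiagram n} {𝓛 𝓛' : List (List (Fin n ⊕ Fin n))}
    (h : IsReading b 𝓛) (h' : IsReading b' 𝓛')
    (hrow : 𝓛.map (List.map Sum.isRight) = 𝓛'.map (List.map Sum.isRight)) :
    ∃ s, b' = relabel s b := by
  have hlen : 𝓛.map List.length = 𝓛'.map List.length := by
    have := congrArg (List.map List.length) hrow
    simpa [Function.comp_def] using this
  have hlen' : 𝓛.flatten.length = 𝓛'.flatten.length := by
    rw [List.length_flatten, List.length_flatten, hlen]
  -- The starting nodes of a reading followed by the other ends of the lines enumerate all nodes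
  -- exactly once.
  obtain ⟨e, he⟩ := List.exists_equiv_map_eq
    (A := 𝓛.flatten ++ 𝓛.flatten.map b.partner) (B := 𝓛'.flatten ++ 𝓛'.flatten.map b'.partner)
    (Multiset.coe_nodup.1 h.nodup) (fun x => (mem_lineNodes b).2 (h.mem x) |> fun hx => by
      simpa [lineNodes] using hx)
    (Multiset.coe_nodup.1 h'.nodup) (fun x => (mem_lineNodes b').2 (h'.mem x) |> fun hx => by
      simpa [lineNodes] using hx)
    (by rw [List.length_append, List.length_append, List.length_map, List.length_map, hlen'])
  rw [List.map_append] at he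
  obtain ⟨he1, he2⟩ := List.append_inj he (by rw [List.length_map, hlen'])
  have hpart : ∀ x ∈ 𝓛.flatten, e (b.partner x) = b'.partner (e x) := by
    rw [← he1, List.map_map, List.map_map] at he2
    exact List.map_inj_left.1 he2
  have hpart' : ∀ x, e (b.partner x) = b'.partner (e x) := by
    intro x
    rcases h.mem x with hx | hx
    · exact hpart x hx
    · have := hpart _ hx
      rw [partner_partner] at this
      rw [this, partner_partner]
  have hmap : 𝓛.map (List.map e) = 𝓛' := by
    refine List.eq_of_flatten_eq ?_ ?_
    · rw [← List.map_flatten, he1]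
    · rw [← hlen]
      simp [Function.comp_def]
  have hnext : ∀ x ∈ 𝓛.flatten, e (b.next x) = b'.next (e x) := by
    intro x hx
    obtain ⟨L, hL, hx⟩ := List.mem_flatten.1 hx
    have h1 := ((loop_iff b).1 (h.loop L hL)).2
    have h2 := ((loop_iff b').1 (h'.loop (L.map e) (by rw [← hmap]; exact List.mem_map_of_mem hL))).2
    rw [← List.map_rotate, ← h1, List.map_map, List.map_map] at h2
    exact (List.map_inj_left.1 h2 x hx).symm
  have hback : ∀ y ∈ 𝓛.flatten, ∃ x ∈ 𝓛.flatten, b.next x = y := by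
    intro y hy
    obtain ⟨L, hL, hy⟩ := List.mem_flatten.1 hy
    rw [← List.mem_rotate (n := 1), ← ((loop_iff b).1 (h.loop L hL)).2, List.mem_map] at hy
    obtain ⟨x, hx, rfl⟩ := hy
    exact ⟨x, List.mem_flatten.2 ⟨L, hL, hx⟩, rfl⟩
  have hfwd : ∀ x ∈ 𝓛.flatten, b.next x ∈ 𝓛.flatten := by
    intro x hx
    obtain ⟨L, hL, hx⟩ := List.mem_flatten.1 hx
    refine List.mem_flatten.2 ⟨L, hL, ?_⟩
    rw [← List.mem_rotate (n := 1), ← ((loop_iff b).1 (h.loop L hL)).2]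
    exact List.mem_map_of_mem hx
  have hswap1 : ∀ x ∈ 𝓛.flatten, e (b.partner x).swap = (e (b.partner x)).swap := by
    intro x hx
    rw [hpart']
    exact hnext x hx
  have hswap : ∀ x, e x.swap = (e x).swap := by
    intro x
    rcases h.mem x with hx | hx
    · obtain ⟨y, hy, rfl⟩ := hback x hx
      rw [next, hswap1 y hy, Sum.swap_swap, Sum.swap_swap]
    · have := hswap1 _ hx
      rwa [partner_partner] at this
  have hside1 : ∀ x ∈ 𝓛.flatten, (e x).isRight = x.isRight := by
    have := congrArg List.flatten hrow
    rw [← List.map_flatten, ← List.map_flatten, ← he1, List.map_map] at this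
    exact fun x hx => (List.map_inj_left.1 this x hx).symm
  have hside : ∀ x, (e x).isRight = x.isRight := by
    intro x
    rcases h.mem x with hx | hx
    · exact hside1 x hx
    · have := hside1 _ (hfwd _ hx)
      rw [next, partner_partner, hswap] at this
      generalize e x = y at this ⊢
      rcases x with x | x <;> rcases y with y | y <;> simp at this ⊢
  have hl : ∀ i, ∃ j, e (Sum.inl i) = Sum.inl j := by
    intro i
    have := hside (Sum.inl i)
    rcases hi : e (Sum.inl i) with j | j
    · exact ⟨j, rfl⟩
    · rw [hi] at this
      simp at this
  choose f hf using hl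
  have hf' : ∀ i, e (Sum.inr i) = Sum.inr (f i) := by
    intro i
    have := hswap (Sum.inl i)
    rwa [hf] at this
  have hinj : Function.Injective f := by
    intro i j hij
    have : e (Sum.inl i) = e (Sum.inl j) := by rw [hf, hf, hij]
    exact Sum.inl_injective (e.injective this)
  let s := Equiv.ofBijective f ((Fintype.bijective_iff_injective_and_card f).2 ⟨hinj, rfl⟩)
  have hes : e = Equiv.sumCongr s s := by
    ext x
    rcases x with i | i
    · rw [hf]; rfl
    · rw [hf']; rfl
  refine ⟨s, ?_⟩
  ext x : 2
  obtain ⟨y, rfl⟩ := e.surjective x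
  rw [relabel, ← hes, conj_partner_apply, hpart']

theorem prod_map_X_eq_monomial (l : List Bracelet) :
    (l.map (X : Bracelet → BraceletPoly)).prod =
      monomial ((l.map fun β => Finsupp.single β 1).sum) 1 := by
  induction l with
  | nil => simp
  | cons β l ih =>
    rw [List.map_cons, List.prod_cons, ih, List.map_cons, List.sum_cons, X, monomial_mul, one_mul]

open Classical in
theorem sum_single_apply (l : List Bracelet) (β : Bracelet) :
    ((l.map fun β => Finsupp.single β 1).sum : Bracelet →₀ ℕ) β = l.count β := by
  induction l with
  | nil => simp
  | cons γ l ih =>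
    rw [List.map_cons, List.sum_cons, Finsupp.add_apply, ih, List.count_cons, Finsupp.single_apply,
      add_comm]
    simp

theorem perm_of_prod_map_X_eq {l l' : List Bracelet}
    (h : (l.map (X : Bracelet → BraceletPoly)).prod = (l'.map X).prod) : l.Perm l' := by
  classical
  rw [prod_map_X_eq_monomial, prod_map_X_eq_monomial] at h
  have h1 := monomial_left_injective (one_ne_zero : (1 : ℂ) ≠ 0) h
  rw [List.perm_iff_count]
  intro β
  rw [← sum_single_apply, ← sum_single_apply, h1]

theorem readProd_eq_prod_map_X (φ : Fin n ⊕ Fin n → Letter) (𝓛 : List (List (Fin n ⊕ Fin n))) :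
    readProd φ 𝓛 = ((𝓛.map fun L => Bracelet.mk (L.map φ)).map X).prod := by
  rw [readProd, List.map_map]
  rfl

/-- Diagrams with the same bracelets differ by a renumbering only. -/
theorem exists_relabel_of_bracelets_eq {b b' : BrauerDiagram n} (h : b.bracelets = b'.bracelets) :
    ∃ s, b' = relabel s b := by
  obtain ⟨𝓛, h𝓛⟩ := b.exists_reading
  obtain ⟨𝓛', h𝓛'⟩ := b'.exists_reading
  rw [← h𝓛.readProd_eq, ← h𝓛'.readProd_eq, readProd_eq_prod_map_X, readProd_eq_prod_map_X] at h
  have hperm := perm_of_prod_map_X_eq h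
  obtain ⟨𝓜, h1, h2⟩ := h𝓛.exists_standard
  obtain ⟨𝓜', h1', h2'⟩ := h𝓛'.exists_standard
  have h3 := hperm.map standardRows
  rw [← h2, ← h2'] at h3
  -- The multisets of bracelets agree, so the loops of the second standard reading can be reordered
  -- to have the same rows as those of the first.
  obtain ⟨𝓝, h4, h5⟩ := List.exists_perm_map_eq h3
  exact h1.exists_relabel (h1'.perm h4.symm) h5.symm

/-! ### Diagrams with prescribed bracelets -/

section ofCycles

variable (σ : Equiv.Perm (Fin n)) (q : Fin n → Bool)

/-- The node in the position `k` and the row `q k`. -/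
def nodeAt (k : Fin n) : Fin n ⊕ Fin n := if q k then Sum.inr k else Sum.inl k

theorem nodeAt_isRight (k : Fin n) : (nodeAt q k).isRight = q k := by
  unfold nodeAt
  split_ifs with h <;> simp [h]

theorem elim_nodeAt (k : Fin n) : Sum.elim id id (nodeAt q k) = k := by
  unfold nodeAt
  split_ifs <;> rfl

theorem elim_swap_nodeAt (k : Fin n) : Sum.elim id id (nodeAt q k).swap = k := by
  unfold nodeAt
  split_ifs <;> rfl

theorem nodeAt_ne_swap (j k : Fin n) : nodeAt q j ≠ (nodeAt q k).swap := by
  intro h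
  have h1 := congrArg (Sum.elim id id) h
  rw [elim_nodeAt, elim_swap_nodeAt] at h1
  subst h1
  have h2 := congrArg Sum.isRight h
  rw [Sum.isRight_swap] at h2
  generalize nodeAt q j = y at h2
  rcases y with y | y <;> simp at h2

theorem eq_nodeAt_or_swap (x : Fin n ⊕ Fin n) : ∃ k, x = nodeAt q k ∨ x = (nodeAt q k).swap := by
  rcases x with k | k <;> refine ⟨k, ?_⟩ <;> cases h : q k <;> simp [nodeAt, h]

/-- The diagram whose lines join the node `nodeAt q k` to the node opposite to
`nodeAt q (σ k)`. -/
def ofCycles : BrauerDiagram n where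
  partner x := if x = nodeAt q (Sum.elim id id x) then (nodeAt q (σ (Sum.elim id id x))).swap
    else nodeAt q (σ⁻¹ (Sum.elim id id x))
  partner_partner x := by
    obtain ⟨k, rfl | rfl⟩ := eq_nodeAt_or_swap q x
    · simp [elim_nodeAt, elim_swap_nodeAt, (nodeAt_ne_swap q _ _).symm]
    · simp [elim_nodeAt, elim_swap_nodeAt, (nodeAt_ne_swap q _ _).symm]
  partner_ne x := by
    obtain ⟨k, rfl | rfl⟩ := eq_nodeAt_or_swap q x
    · simp [elim_nodeAt, (nodeAt_ne_swap q _ _).symm]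
    · simp [elim_swap_nodeAt, nodeAt_ne_swap q _ _, (nodeAt_ne_swap q _ _).symm]

theorem ofCycles_partner (k : Fin n) :
    (ofCycles σ q).partner (nodeAt q k) = (nodeAt q (σ k)).swap := by
  simp [ofCycles, elim_nodeAt]

theorem ofCycles_next (k : Fin n) : (ofCycles σ q).next (nodeAt q k) = nodeAt q (σ k) := by
  rw [next, ofCycles_partner, Sum.swap_swap]

/-- In each position one of the two nodes starts a line and the opposite node ends one. The cycles
of `σ` listed in `𝓚` thus become the loops. -/
theorem isReading_ofCycles {𝓚 : List (List (Fin n))} (h1 : 𝓚.flatten = List.finRange n)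
    (h2 : ∀ K ∈ 𝓚, K ≠ []) (h3 : ∀ K ∈ 𝓚, K.map σ = K.rotate 1) :
    IsReading (ofCycles σ q) (𝓚.map (List.map (nodeAt q))) := by
  have hinj : Function.Injective (nodeAt q) := by
    intro j k h
    rw [← elim_nodeAt q j, h, elim_nodeAt]
  constructor
  · intro L hL
    obtain ⟨K, hK, rfl⟩ := List.mem_map.1 hL
    rw [loop_iff]
    refine ⟨by simpa using h2 K hK, ?_⟩
    rw [← List.map_rotate, ← h3 K hK, List.map_map, List.map_map]
    exact List.map_congr_left fun k _ => ofCycles_next σ q k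
  · rw [← List.map_flatten, h1]
    refine (Multiset.Nodup.ext ?_ Finset.univ.nodup).2 fun x => ?_
    · rw [lineNodes, Multiset.nodup_add, Multiset.coe_nodup, Multiset.coe_nodup]
      refine ⟨(List.nodup_finRange n).map hinj,
        ((List.nodup_finRange n).map hinj).map (ofCycles σ q).partner_injective, ?_⟩
      rw [Multiset.disjoint_left]
      intro y hy hy'
      simp only [Multiset.mem_coe, List.mem_map] at hy hy'
      obtain ⟨j, _, rfl⟩ := hy
      obtain ⟨_, ⟨k, _, rfl⟩, h⟩ := hy'
      rw [ofCycles_partner] at h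
      exact nodeAt_ne_swap q _ _ h.symm
    · simp only [Finset.mem_val, Finset.mem_univ, iff_true, mem_lineNodes]
      obtain ⟨k, rfl | rfl⟩ := eq_nodeAt_or_swap q x
      · exact Or.inl (List.mem_map_of_mem (List.mem_finRange k))
      · refine Or.inr (List.mem_map.2 ⟨σ⁻¹ k, List.mem_finRange _, ?_⟩)
        rw [eq_comm, partner_eq_iff, ofCycles_partner]
        simp

end ofCycles

theorem exists_zipWith_step {q q' : Bool} {w : List Letter} (h : Walk q w q') (hw : w ≠ []) :
    ∃ R : List Bool, List.zipWith step (q :: R) (R ++ [q']) = w := by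
  induction w generalizing q with
  | nil => exact (hw rfl).elim
  | cons a w ih =>
    obtain ⟨r, rfl, h⟩ := h
    by_cases hw' : w = []
    · subst hw'
      rw [walk_nil.1 h]
      exact ⟨[], rfl⟩
    · obtain ⟨R, hR⟩ := ih h hw'
      refine ⟨r :: R, ?_⟩
      rw [List.cons_append, List.zipWith_cons_cons, hR]

/-- `Q` lists the rows in which the lines start; each letter is determined by its row and the
cyclically next one. -/
theorem exists_rows {w : List Letter} (h : Bracelet.mk w ∈ Bracelet.plainBracelets) :
    ∃ Q : List Bool, Q.length = w.length ∧ List.zipWith step Q (Q.rotate 1) = w := by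
  obtain ⟨hw, q, hq⟩ := mk_mem_plainBracelets.1 h
  obtain ⟨R, hR⟩ := exists_zipWith_step hq hw
  refine ⟨q :: R, ?_, by simpa using hR⟩
  rw [← hR]
  simp

/-- Any list of words with bracelets in `𝔟(𝒜)` can be read off from a diagram. -/
theorem exists_diagram (W : List (List Letter)) (hW : ∀ w ∈ W, Bracelet.mk w ∈ Bracelet.plainBracelets)
    (hn : n = W.flatten.length) :
    ∃ (b : BrauerDiagram n) (𝓛 : List (List (Fin n ⊕ Fin n))), IsReading b 𝓛 ∧
      𝓛.map (List.map b.letterAt) = W := by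
  choose! Q hQ1 hQ2 using fun w (hw : w ∈ W) => exists_rows (hW w hw)
  have hQlen : (W.map Q).map List.length = W.map List.length := by
    rw [List.map_map]
    exact List.map_congr_left hQ1
  -- The positions are cut into consecutive blocks, one for each word and of its length.
  obtain ⟨𝓚, h1, h2⟩ := List.exists_flatten_eq W (List.finRange n) (by simpa using hn)
  have hlen : (W.map Q).flatten.length = n := by
    rw [List.length_flatten, hQlen, ← List.length_flatten, ← hn]
  let q : Fin n → Bool := fun i => (W.map Q).flatten[i]
  have hq : 𝓚.map (List.map q) = W.map Q := by
    refine List.eq_of_flatten_eq ?_ ?_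
    · rw [← List.map_flatten, h1]
      refine List.ext_getElem (by simp [hlen]) fun i _ _ => ?_
      simp [q]
    · rw [hQlen, ← h2]
      simp [Function.comp_def]
  -- `σ` is to rotate every block by one place, so that each block becomes a single loop.
  obtain ⟨σ, hσ⟩ := List.exists_equiv_map_eq (A := List.finRange n)
    (B := (𝓚.map fun K => K.rotate 1).flatten) (List.nodup_finRange n) List.mem_finRange
    (by
      refine List.Perm.nodup ?_ (List.nodup_finRange n)
      rw [← h1]
      refine List.Perm.symm ?_
      clear * -
      induction 𝓚 with
      | nil => simp
      | cons K 𝓚 ih =>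
        simp only [List.map_cons, List.flatten_cons]
        exact (List.rotate_perm K 1).append ih)
    (by
      intro y
      have : y ∈ 𝓚.flatten := by rw [h1]; exact List.mem_finRange y
      obtain ⟨K, hK, hy⟩ := List.mem_flatten.1 this
      exact List.mem_flatten.2 ⟨_, List.mem_map_of_mem hK, List.mem_rotate.2 hy⟩)
    (by
      rw [← h1, List.length_flatten, List.length_flatten, List.map_map]
      simp [Function.comp_def])
  have hσ' : 𝓚.map (List.map σ) = 𝓚.map fun K => K.rotate 1 := by
    refine List.eq_of_flatten_eq ?_ ?_
    · rw [← List.map_flatten, h1, hσ]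
    · simp [Function.comp_def]
  have hσ'' := List.map_inj_left.1 hσ'
  refine ⟨ofCycles σ q, 𝓚.map (List.map (nodeAt q)), isReading_ofCycles σ q h1 ?_ hσ'', ?_⟩
  · rintro K hK rfl
    have h0 : 0 ∈ W.map List.length := by
      rw [← h2]
      exact List.mem_map.2 ⟨[], hK, rfl⟩
    obtain ⟨w, hw, hw0⟩ := List.mem_map.1 h0
    exact (mk_mem_plainBracelets.1 (hW w hw)).1 (List.length_eq_zero_iff.1 hw0)
  · have h3 : W = (W.map Q).map fun Q => List.zipWith step Q (Q.rotate 1) := by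
      rw [List.map_map]
      conv_lhs => rw [← List.map_id W]
      exact List.map_congr_left fun w hw => (hQ2 w hw).symm
    rw [h3, ← hq, List.map_map, List.map_map]
    refine List.map_congr_left fun K hK => ?_
    simp only [Function.comp_apply]
    rw [← List.map_rotate, ← hσ'' K hK, List.map_map, List.map_map, List.zipWith_map_left,
      List.zipWith_map_right, List.zipWith_self]
    refine List.map_congr_left fun k _ => ?_
    simp only [Function.comp_apply]
    rw [letterAt_eq_step, ofCycles_next, nodeAt_isRight, nodeAt_isRight]

end BrauerDiagram

namespace BrauerDiagram

open Letter

variable {n : ℕ}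

/-! ### The bracelets after a surgery -/

theorem lineNodes_nodup_cons {b : BrauerDiagram n} {a c : Fin n ⊕ Fin n} {M : List (Fin n ⊕ Fin n)}
    (h : (lineNodes b (a :: c :: M)).Nodup) :
    a ≠ c ∧ b.partner a ≠ c ∧ ∀ x ∈ M, x ≠ a ∧ x ≠ c ∧ x ≠ b.partner a ∧ x ≠ b.partner c := by
  rw [lineNodes_cons, Multiset.nodup_add] at h
  obtain ⟨_, h1, h2⟩ := h
  rw [lineNodes_cons] at h1 h2
  replace h1 := (Multiset.nodup_add.1 h1).2.2
  rw [Multiset.disjoint_left] at h1 h2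
  refine ⟨?_, ?_, fun x hx => ⟨?_, ?_, ?_, ?_⟩⟩
  · rintro rfl
    exact h2 (a := a) (by simp) (by simp)
  · rintro rfl
    exact h2 (a := b.partner a) (by simp) (by simp)
  · rintro rfl
    exact h2 (a := x) (by simp) (by simp [mem_lineNodes, hx])
  · rintro rfl
    exact h1 (a := x) (by simp) (by simp [mem_lineNodes, hx])
  · rintro rfl
    exact h2 (a := b.partner a) (by simp) (by simp [mem_lineNodes, hx])
  · rintro rfl
    exact h1 (a := b.partner c) (by simp) (by simp [mem_lineNodes, hx])

theorem surgery_partner_of_mem {b : BrauerDiagram n} {a c : Fin n ⊕ Fin n}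
    {M : List (Fin n ⊕ Fin n)} (h : (lineNodes b (a :: c :: M)).Nodup) {x : Fin n ⊕ Fin n}
    (hx : x ∈ M) : (surgery b a c).partner x = b.partner x := by
  obtain ⟨h1, h2, h3, h4⟩ := (lineNodes_nodup_cons h).2.2 x hx
  exact surgery_partner_of_ne b h1 h2 h3 h4

theorem lineNodes_swap (b : BrauerDiagram n) (a c : Fin n ⊕ Fin n) (M : List (Fin n ⊕ Fin n)) :
    lineNodes b (a :: b.partner c :: M) = lineNodes b (a :: c :: M) := by
  simp only [lineNodes_cons, partner_partner]
  rw [add_comm {b.partner c}]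

theorem lineNodes_surgery {b : BrauerDiagram n} {a c : Fin n ⊕ Fin n}
    {M : List (Fin n ⊕ Fin n)} (h : (lineNodes b (a :: c :: M)).Nodup) :
    lineNodes (surgery b a c) (a :: b.partner a :: M) = lineNodes b (a :: c :: M) := by
  have h1 := (lineNodes_nodup_cons h).1
  simp only [lineNodes_cons, surgery_partner_left b h1, surgery_partner_partner_left b h1]
  rw [lineNodes_congr fun x hx => surgery_partner_of_mem h hx]
  abel

theorem lineNodes_surgery' {b : BrauerDiagram n} {a c : Fin n ⊕ Fin n}
    {M : List (Fin n ⊕ Fin n)} (h : (lineNodes b (a :: c :: M)).Nodup) :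
    lineNodes (surgery b a (b.partner c)) (a :: c :: M) = lineNodes b (a :: c :: M) := by
  rw [← lineNodes_swap] at h
  have h1 := (lineNodes_nodup_cons h).1
  have h2 := surgery_partner_partner_right b h1
  rw [partner_partner] at h2
  simp only [lineNodes_cons, surgery_partner_left b h1, h2]
  rw [lineNodes_congr fun x hx => surgery_partner_of_mem h hx]
  abel

theorem letterAt_eq (b : BrauerDiagram n) (x : Fin n ⊕ Fin n) :
    b.letterAt x = step x.isRight (!(b.partner x).isRight) := by
  rw [letterAt_eq_step, next]
  rcases b.partner x with y | y <;> rfl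

theorem letterAt_congr {b b' : BrauerDiagram n} {x : Fin n ⊕ Fin n}
    (h : b'.partner x = b.partner x) : b'.letterAt x = b.letterAt x := by
  rw [letterAt_eq, letterAt_eq, h]

theorem letterAt_map_reverse (b : BrauerDiagram n) (U : List (Fin n ⊕ Fin n)) :
    (U.reverse.map b.partner).map b.letterAt = (U.map b.letterAt).reverse := by
  rw [List.map_map, show b.letterAt ∘ b.partner = b.letterAt from funext b.letterAt_partner,
    List.map_reverse]

/-- The common frame of the four surgeries below: the loops of `𝓡` are untouched, and the new loops
need only be loops and use up the same endpoints as the old ones. -/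
theorem IsReading.surgery {b b' : BrauerDiagram n} {𝓓 𝓓' 𝓡 : List (List (Fin n ⊕ Fin n))}
    (h : IsReading b (𝓓 ++ 𝓡)) (hR : ∀ x ∈ 𝓡.flatten, b'.partner x = b.partner x)
    (hD : ∀ L ∈ 𝓓', Loop b' L)
    (hn : lineNodes b' (𝓓' ++ 𝓡).flatten = lineNodes b (𝓓 ++ 𝓡).flatten) :
    IsReading b' (𝓓' ++ 𝓡) := by
  refine ⟨fun L hL => ?_, hn.trans h.lineNodes_eq⟩
  rcases List.mem_append.1 hL with hL | hL
  · exact hD L hL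
  · exact (h.loop L (List.mem_append_right _ hL)).congr fun x hx =>
      hR x (List.mem_flatten.2 ⟨L, hL, hx⟩)

theorem readProd_letterAt_congr {b b' : BrauerDiagram n} {𝓡 : List (List (Fin n ⊕ Fin n))}
    (hR : ∀ x ∈ 𝓡.flatten, b'.partner x = b.partner x) :
    readProd b'.letterAt 𝓡 = readProd b.letterAt 𝓡 :=
  readProd_congr fun L hL x hx => letterAt_congr (hR x (List.mem_flatten.2 ⟨L, hL, hx⟩))

theorem map_letterAt_congr {b b' : BrauerDiagram n} {U : List (Fin n ⊕ Fin n)}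
    (hU : ∀ x ∈ U, b'.partner x = b.partner x) : U.map b'.letterAt = U.map b.letterAt :=
  List.map_congr_left fun x hx => letterAt_congr (hU x hx)

open BraceletPoly

/-! ### Surgery at two lines of the same loop. -/

section oneLoop

variable {b : BrauerDiagram n} {a c : Fin n ⊕ Fin n} {U V : List (Fin n ⊕ Fin n)}
  {𝓡 : List (List (Fin n ⊕ Fin n))}

theorem IsReading.nodup_one (h : IsReading b ((a :: (U ++ c :: V)) :: 𝓡)) :
    (lineNodes b (a :: c :: (U ++ V ++ 𝓡.flatten))).Nodup := by
  have := h.nodup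
  rw [List.flatten_cons] at this
  rwa [lineNodes_perm b (L' := (a :: (U ++ c :: V)) ++ 𝓡.flatten)]
  rw [List.cons_append, List.perm_cons, List.append_assoc, List.append_assoc, List.cons_append]
  exact List.perm_middle.symm

/-- Once the starts of the two lines are joined, the walk from `a` reaches `c`, runs backwards
through `U` to the old end of the first line, crosses to the old end of the second one and continues
with `V`. The loop stays in one piece. -/
theorem IsReading.bracelets_surgery_one (h : IsReading b ((a :: (U ++ c :: V)) :: 𝓡)) :
    (BrauerDiagram.surgery b a c).bracelets =
      br (step a.isRight (!c.isRight) :: ((U.map b.letterAt).reverse ++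
        step (b.partner a).isRight (!(b.partner c).isRight) :: V.map b.letterAt)) *
      readProd b.letterAt 𝓡 := by
  have hnd := h.nodup_one
  have hM : lineNodes b (a :: c :: (U.reverse.map b.partner ++ V ++ 𝓡.flatten)) =
      lineNodes b (a :: c :: (U ++ V ++ 𝓡.flatten)) := by
    simp only [lineNodes_cons, lineNodes_append, lineNodes_reverse]
  rw [← hM] at hnd
  have h1 := (lineNodes_nodup_cons hnd).1
  have hp : ∀ x ∈ U.reverse.map b.partner ++ V ++ 𝓡.flatten,
      (BrauerDiagram.surgery b a c).partner x = b.partner x :=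
    fun x hx => surgery_partner_of_mem hnd hx
  have hU : ∀ x ∈ U.reverse.map b.partner,
      (BrauerDiagram.surgery b a c).partner x = b.partner x := fun x hx => hp x (by simp_all)
  have hV : ∀ x ∈ V, (BrauerDiagram.surgery b a c).partner x = b.partner x :=
    fun x hx => hp x (by simp [hx])
  have hR : ∀ x ∈ 𝓡.flatten, (BrauerDiagram.surgery b a c).partner x = b.partner x :=
    fun x hx => hp x (List.mem_append_right _ hx)
  have hloop : Seg b (b.partner a) U c ∧ Seg b (b.partner c) V a :=
    (seg_append b).1 (h.loop _ List.mem_cons_self)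
  have hread : IsReading (BrauerDiagram.surgery b a c)
      ([a :: (U.reverse.map b.partner ++ b.partner a :: V)] ++ 𝓡) := by
    refine IsReading.surgery (𝓓 := [a :: (U ++ c :: V)]) h hR ?_ ?_
    · simp only [List.mem_singleton, forall_eq]
      refine (seg_append _).2 ⟨?_, ?_⟩
      · rw [surgery_partner_left b h1]
        exact hloop.1.reverse.congr hU
      · rw [surgery_partner_partner_left b h1]
        exact hloop.2.congr hV
    · have e1 := lineNodes_surgery hnd
      rw [hM] at e1
      simp only [List.flatten_cons, List.cons_append, lineNodes_append,
        lineNodes_cons] at e1 ⊢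
      simp only [← add_assoc] at e1 ⊢
      convert e1 using 1
      · abel
      · abel
  rw [← hread.readProd_eq, List.singleton_append, readProd_cons, readProd_letterAt_congr hR]
  congr 2
  rw [List.map_cons, List.map_append, List.map_cons, map_letterAt_congr hU, map_letterAt_congr hV,
    letterAt_map_reverse, letterAt_eq, letterAt_eq, surgery_partner_left b h1,
    surgery_partner_partner_left b h1]

/-- Joining the start of each line to the end of the other one closes up `U` and `V` separately, so
that the loop splits. -/
theorem IsReading.bracelets_surgery_one' (h : IsReading b ((a :: (U ++ c :: V)) :: 𝓡)) :
    (BrauerDiagram.surgery b a (b.partner c)).bracelets =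
      br (step a.isRight (!(b.partner c).isRight) :: V.map b.letterAt) *
      br (step c.isRight (!(b.partner a).isRight) :: U.map b.letterAt) *
      readProd b.letterAt 𝓡 := by
  have hnd := h.nodup_one
  have e1 := lineNodes_surgery' hnd
  rw [← lineNodes_swap] at hnd
  have h1 := (lineNodes_nodup_cons hnd).1
  have h2 := surgery_partner_partner_right b h1
  rw [partner_partner] at h2
  set b' := BrauerDiagram.surgery b a (b.partner c)
  have hp : ∀ x ∈ U ++ V ++ 𝓡.flatten, b'.partner x = b.partner x :=
    fun x hx => surgery_partner_of_mem hnd hx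
  have hU : ∀ x ∈ U, b'.partner x = b.partner x := fun x hx => hp x (by simp_all)
  have hV : ∀ x ∈ V, b'.partner x = b.partner x := fun x hx => hp x (by simp [hx])
  have hR : ∀ x ∈ 𝓡.flatten, b'.partner x = b.partner x :=
    fun x hx => hp x (List.mem_append_right _ hx)
  have hloop : Seg b (b.partner a) U c ∧ Seg b (b.partner c) V a :=
    (seg_append b).1 (h.loop _ List.mem_cons_self)
  have h3 : b'.partner a = b.partner c := surgery_partner_left b h1
  have hread : IsReading b' ([a :: V, c :: U] ++ 𝓡) := by
    refine IsReading.surgery (𝓓 := [a :: (U ++ c :: V)]) h hR ?_ ?_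
    · simp only [List.mem_cons, List.not_mem_nil, or_false, forall_eq_or_imp, forall_eq]
      constructor
      · change Seg b' (b'.partner a) V a
        rw [h3]
        exact hloop.2.congr hV
      · change Seg b' (b'.partner c) U c
        rw [h2]
        exact hloop.1.congr hU
    · simp only [List.flatten_cons, List.cons_append, lineNodes_append,
        lineNodes_cons, List.nil_append] at e1 ⊢
      simp only [← add_assoc] at e1 ⊢
      convert e1 using 1
      · abel
      · abel
  rw [← hread.readProd_eq, List.cons_append, List.singleton_append, readProd_cons, readProd_cons,
    readProd_letterAt_congr hR, mul_assoc]
  rw [List.map_cons, List.map_cons, map_letterAt_congr hU, map_letterAt_congr hV, letterAt_eq b',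
    letterAt_eq b', h2, h3]

end oneLoop

/-! ### Surgery at lines of two different loops. -/

section twoLoops

variable {b : BrauerDiagram n} {a c : Fin n ⊕ Fin n} {U V : List (Fin n ⊕ Fin n)}
  {𝓡 : List (List (Fin n ⊕ Fin n))}

theorem IsReading.nodup_two (h : IsReading b ((a :: U) :: (c :: V) :: 𝓡)) :
    (lineNodes b (a :: c :: (U ++ V ++ 𝓡.flatten))).Nodup := by
  have := h.nodup
  rw [List.flatten_cons, List.flatten_cons] at this
  rwa [lineNodes_perm b (L' := (a :: U) ++ ((c :: V) ++ 𝓡.flatten))]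
  rw [List.cons_append, List.perm_cons, List.append_assoc, List.cons_append]
  exact List.perm_middle.symm

/-- The new lines lead from each loop into the other one, respecting both directions of reading, so
the loops merge without a reversal. -/
theorem IsReading.bracelets_surgery_two' (h : IsReading b ((a :: U) :: (c :: V) :: 𝓡)) :
    (BrauerDiagram.surgery b a (b.partner c)).bracelets =
      br (step a.isRight (!(b.partner c).isRight) :: (V.map b.letterAt ++
        step c.isRight (!(b.partner a).isRight) :: U.map b.letterAt)) *
      readProd b.letterAt 𝓡 := by
  have hnd := h.nodup_two
  have e1 := lineNodes_surgery' hnd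
  rw [← lineNodes_swap] at hnd
  have h1 := (lineNodes_nodup_cons hnd).1
  have h2 := surgery_partner_partner_right b h1
  rw [partner_partner] at h2
  set b' := BrauerDiagram.surgery b a (b.partner c)
  have hp : ∀ x ∈ U ++ V ++ 𝓡.flatten, b'.partner x = b.partner x :=
    fun x hx => surgery_partner_of_mem hnd hx
  have hU : ∀ x ∈ U, b'.partner x = b.partner x := fun x hx => hp x (by simp_all)
  have hV : ∀ x ∈ V, b'.partner x = b.partner x := fun x hx => hp x (by simp [hx])
  have hR : ∀ x ∈ 𝓡.flatten, b'.partner x = b.partner x :=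
    fun x hx => hp x (List.mem_append_right _ hx)
  have hloop1 : Seg b (b.partner a) U a := h.loop (a :: U) (by simp)
  have hloop2 : Seg b (b.partner c) V c := h.loop (c :: V) (by simp)
  have h3 : b'.partner a = b.partner c := surgery_partner_left b h1
  have hread : IsReading b' ([a :: (V ++ c :: U)] ++ 𝓡) := by
    refine IsReading.surgery (𝓓 := [a :: U, c :: V]) h hR ?_ ?_
    · simp only [List.mem_singleton, forall_eq]
      refine (seg_append _).2 ⟨?_, ?_⟩
      · rw [h3]
        exact hloop2.congr hV
      · rw [h2]
        exact hloop1.congr hU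
    · simp only [List.flatten_cons, List.cons_append, lineNodes_append,
        lineNodes_cons, List.nil_append] at e1 ⊢
      simp only [← add_assoc] at e1 ⊢
      convert e1 using 1
      · abel
      · abel
  rw [← hread.readProd_eq, List.singleton_append, readProd_cons, readProd_letterAt_congr hR]
  rw [List.map_cons, List.map_append, List.map_cons, map_letterAt_congr hU, map_letterAt_congr hV,
    letterAt_eq b', letterAt_eq b', h2, h3]

/-- Reading the second loop backwards interchanges the start and the end of its line, which reduces
this to the previous surgery. -/
theorem IsReading.bracelets_surgery_two (h : IsReading b ((a :: U) :: (c :: V) :: 𝓡)) :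
    (BrauerDiagram.surgery b a c).bracelets =
      br (step a.isRight (!c.isRight) :: ((V.map b.letterAt).reverse ++
        step (b.partner c).isRight (!(b.partner a).isRight) :: U.map b.letterAt)) *
      readProd b.letterAt 𝓡 := by
  have hl : Loop b (b.partner c :: V.reverse.map b.partner) := by
    have := (h.loop (c :: V) (by simp)).reverse
    rw [List.reverse_cons, List.map_append] at this
    exact this.append_comm
  have h' : IsReading b ((a :: U) :: (b.partner c :: V.reverse.map b.partner) :: 𝓡) := by
    refine ((h.perm (List.Perm.swap _ _ _)).replace hl ?_).perm (List.Perm.swap _ _ _)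
    rw [lineNodes_cons, lineNodes_cons, lineNodes_reverse, partner_partner, add_comm {b.partner c}]
  have := h'.bracelets_surgery_two'
  rwa [partner_partner, letterAt_map_reverse] at this

end twoLoops

/-! ### The sum over the lower endpoints of two lines -/

/-- The contribution of two nodes: `0` unless they are different lower nodes; otherwise the
bracelets after the surgery, with a factor `δ` if the nodes are joined. -/
noncomputable def nodeTerm (δ : ℂ) (b : BrauerDiagram n) (x y : Fin n ⊕ Fin n) : BraceletPoly :=
  if x.isRight ∧ y.isRight ∧ x ≠ y then
    BrauerAlgebra.arcScalar δ b x y • (surgery b x y).bracelets else 0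

/-- The contribution of the endpoints of the lines through two nodes. -/
noncomputable def lineTerm (δ : ℂ) (b : BrauerDiagram n) (x y : Fin n ⊕ Fin n) : BraceletPoly :=
  nodeTerm δ b x y + nodeTerm δ b x (b.partner y) +
    (nodeTerm δ b (b.partner x) y + nodeTerm δ b (b.partner x) (b.partner y))

theorem nodeTerm_comm (δ : ℂ) (b : BrauerDiagram n) (x y : Fin n ⊕ Fin n) :
    nodeTerm δ b x y = nodeTerm δ b y x := by
  unfold nodeTerm
  rw [BrauerAlgebra.surgery_scalar_comm b bracelets x y]
  congr 1
  exact propext ⟨fun ⟨h1, h2, h3⟩ => ⟨h2, h1, h3.symm⟩, fun ⟨h1, h2, h3⟩ => ⟨h2, h1, h3.symm⟩⟩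

theorem lineTerm_comm (δ : ℂ) (b : BrauerDiagram n) (x y : Fin n ⊕ Fin n) :
    lineTerm δ b x y = lineTerm δ b y x := by
  simp only [lineTerm, nodeTerm_comm δ b x, nodeTerm_comm δ b (b.partner x)]
  abel

theorem lineTerm_partner_left (δ : ℂ) (b : BrauerDiagram n) (x y : Fin n ⊕ Fin n) :
    lineTerm δ b (b.partner x) y = lineTerm δ b x y := by
  simp only [lineTerm, partner_partner]
  abel

theorem lineTerm_partner_right (δ : ℂ) (b : BrauerDiagram n) (x y : Fin n ⊕ Fin n) :
    lineTerm δ b x (b.partner y) = lineTerm δ b x y := by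
  rw [lineTerm_comm, lineTerm_partner_left, lineTerm_comm]

/-- The lines are different, so no pair of endpoints is joined and no `δ` occurs. Opposite pairs of
endpoints lead to the same surgery; the coefficients count the pairs lying in the lower row. -/
theorem lineTerm_of_ne (δ : ℂ) {b : BrauerDiagram n} {x y : Fin n ⊕ Fin n} (h : x ≠ y)
    (h' : b.partner x ≠ y) : lineTerm δ b x y =
      ((if x.isRight ∧ y.isRight then 1 else 0) +
        (if (b.partner x).isRight ∧ (b.partner y).isRight then 1 else 0)) *
          (surgery b x y).bracelets +
      ((if x.isRight ∧ (b.partner y).isRight then 1 else 0) +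
        (if (b.partner x).isRight ∧ y.isRight then 1 else 0)) *
          (surgery b x (b.partner y)).bracelets := by
  have h1 : x ≠ b.partner y := fun e => h' (b.partner_eq_iff.2 e)
  have h2 : b.partner x ≠ b.partner y := fun e => h (b.partner_injective e)
  have h3 := surgery_partner_partner b x (b.partner y)
  rw [partner_partner] at h3
  simp only [lineTerm, nodeTerm, BrauerAlgebra.arcScalar, partner_partner, surgery_partner_partner,
    h3, h, h1, h2, h', if_false, one_smul, ne_eq, not_false_eq_true, and_true, add_mul, ite_mul,
    one_mul, zero_mul]
  abel

/-- The two ends of a lower arc form two ordered pairs, each giving `δ` and leaving the diagram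
unchanged. This is the `2δ` of the rule for a doubly dotted `s`. -/
theorem lineTerm_self (δ : ℂ) {b : BrauerDiagram n} {x : Fin n ⊕ Fin n} (h : b.letterAt x = s) :
    lineTerm δ b x x = C (2 * δ) * b.bracelets := by
  rw [letterAt_eq] at h
  have h1 : x.isRight = true ∧ (b.partner x).isRight = true := by
    cases h1 : x.isRight <;> cases h2 : (b.partner x).isRight <;> rw [h1, h2] at h <;>
      simp [step] at h ⊢
  simp only [lineTerm, nodeTerm, h1.1, h1.2, BrauerAlgebra.arcScalar, partner_partner,
    b.partner_ne x, (b.partner_ne x).symm, surgery_eq_self, ne_eq, not_true_eq_false,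
    not_false_eq_true, and_true, and_false, if_true, if_false, zero_add, add_zero]
  rw [← two_smul ℂ, smul_smul, C_mul']

end BrauerDiagram

/-! ### The values of the trace rules -/

namespace Bracelet

theorem mk_append_comm (u v : List Letter) : mk (u ++ v) = mk (v ++ u) :=
  Quotient.sound (Or.inl List.isRotated_append)

theorem mk_reverse (w : List Letter) : mk w.reverse = mk w :=
  Quotient.sound (Or.inr (by rw [List.reverse_reverse]))

theorem mk_cons_swap (a c : Letter) (u v : List Letter) :
    mk (a :: (u ++ c :: v)) = mk (c :: (v ++ a :: u)) :=
  mk_append_comm (a :: u) (c :: v)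

theorem mk_cons_reverse (a : Letter) (u : List Letter) : mk (a :: u.reverse) = mk (a :: u) := by
  rw [← mk_reverse, List.reverse_cons, List.reverse_reverse, mk_append_comm]
  rfl

theorem mk_cons_reverse' (a c : Letter) (u v : List Letter) :
    mk (a :: (v.reverse ++ c :: u.reverse)) = mk (a :: (u ++ c :: v)) := by
  rw [← mk_cons_reverse a (u ++ c :: v)]
  simp

theorem undot_mk (w : List Letter) : (mk w).undot = mk (w.map Letter.undot) := rfl

theorem dots_mk (w : List Letter) : (mk w).dots = (w.map Letter.dots).sum := rfl

end Bracelet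

namespace Letter

/-- Putting a dot above a letter `s` or `p`. -/
def dot : Letter → Letter
  | s => sDot
  | p => pDot
  | a => a

theorem dot_undot {a : Letter} (h : a.dots = 1) : a.undot.dot = a := by
  cases a <;> simp [dots] at h <;> rfl

theorem undot_dot {a : Letter} (h : a.dots = 0) : a.dot.undot = a := by
  cases a <;> simp [dots] at h <;> rfl

theorem undot_eq_self {a : Letter} (h : a.dots = 0) : a.undot = a := by
  cases a <;> simp [dots] at h <;> rfl

theorem eq_or_eq_of_dots {a : Letter} (h : a.dots = 1) : a = sDot ∨ a = pDot := by
  cases a <;> simp [dots] at h ⊢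

theorem map_undot_eq_self {u : List Letter} (h : BraceletPoly.Undotted u) : u.map undot = u := by
  conv_rhs => rw [← List.map_id u]
  exact List.map_congr_left fun a ha => undot_eq_self (h a ha)

end Letter

namespace BraceletPoly

open Letter Bracelet

/-- The sum over the lower endpoints of two lines of the same loop: `α`, `γ` are the rows in which
the lines start and `α'`, `γ'` those in which they end, `u` is read after the first line and `v`
after the second one. -/
noncomputable def oneLoop (α α' γ γ' : Bool) (u v : List Letter) : BraceletPoly :=
  ((if α ∧ γ then 1 else 0) + (if α' ∧ γ' then 1 else 0)) *
    br (step α (!γ) :: (u.reverse ++ step α' (!γ') :: v)) +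
  ((if α ∧ γ' then 1 else 0) + (if α' ∧ γ then 1 else 0)) *
    (br (step α (!γ') :: v) * br (step γ (!α') :: u))

/-- The sum over the lower endpoints of two lines of different loops. -/
noncomputable def twoLoops (α α' γ γ' : Bool) (u v : List Letter) : BraceletPoly :=
  ((if α ∧ γ then 1 else 0) + (if α' ∧ γ' then 1 else 0)) *
    br (step α (!γ) :: (v.reverse ++ step γ' (!α') :: u)) +
  ((if α ∧ γ' then 1 else 0) + (if α' ∧ γ then 1 else 0)) *
    br (step α (!γ') :: (v ++ step γ (!α') :: u))

theorem br_cons_swap (a c : Letter) (u v : List Letter) :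
    br (a :: (u ++ c :: v)) = br (c :: (v ++ a :: u)) := congrArg X (mk_cons_swap a c u v)

theorem br_cons_reverse' (a c : Letter) (u v : List Letter) :
    br (a :: (v.reverse ++ c :: u.reverse)) = br (a :: (u ++ c :: v)) :=
  congrArg X (mk_cons_reverse' a c u v)

theorem br_flip (a c : Letter) (u v : List Letter) :
    br (a :: (u.reverse ++ c :: v)) = br (c :: (u ++ a :: v.reverse)) := by
  rw [← br_cons_reverse' a c u.reverse v, List.reverse_reverse, br_cons_swap]

theorem rows_s {α α' : Bool} (h : s = step α (!α')) : α = true ∧ α' = true := by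
  cases α <;> cases α' <;> simp [step] at h ⊢

theorem rows_p {α α' : Bool} (h : p = step α (!α')) : α' = !α := by
  cases α <;> cases α' <;> simp [step] at h ⊢

/-- All four endpoints are lower nodes, so that each of the two surgeries occurs twice. -/
theorem oneLoop_ss {α α' γ γ' : Bool} {u v : List Letter} (hα : s = step α (!α'))
    (hγ : s = step γ (!γ')) : oneLoop α α' γ γ' u v =
      2 * (br (s :: u ++ s :: v.reverse) + br (s :: u) * br (s :: v)) := by
  obtain ⟨rfl, rfl⟩ := rows_s hα
  obtain ⟨rfl, rfl⟩ := rows_s hγ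
  simp only [oneLoop, step, Bool.not_true, and_self, if_true, List.cons_append]
  rw [br_flip]
  ring

/-- The single lower endpoint of the vertical line can be paired with either end of the lower arc,
so each surgery occurs once. Fitness of `u`, a walk ending in the lower row, forces the vertical
line to be read from below. -/
theorem oneLoop_ps {α α' γ γ' : Bool} {u v : List Letter} (hα : p = step α (!α'))
    (hγ : s = step γ (!γ')) (hu : Walk (!α') u γ) (hfit : Fit u) : oneLoop α α' γ γ' u v =
      br (p :: u ++ s :: v.reverse) + br (p :: u) * br (s :: v) := by
  obtain rfl := rows_p hα
  obtain ⟨rfl, rfl⟩ := rows_s hγ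
  obtain ⟨h1, -⟩ := hu.of_fit hfit
  rw [Bool.not_not] at h1
  subst h1
  simp only [oneLoop, step, Bool.not_true, Bool.not_false, Bool.false_eq_true, false_and, and_self,
    if_true, if_false, List.cons_append]
  rw [br_flip]
  ring

/-- Fitness makes both vertical lines be read in the same direction, so only the reversing surgery
joins lower nodes. Read from above, `u` and `v` consist of letters `p`, and reversing them has no
effect. -/
theorem oneLoop_pp {α α' γ γ' : Bool} {u v : List Letter} (hα : p = step α (!α'))
    (hγ : p = step γ (!γ')) (hu : Walk (!α') u γ) (hv : Walk (!γ') v α) (hfit : Fit u)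
    (hfit' : Fit v) : oneLoop α α' γ γ' u v = br (n :: u ++ s :: v.reverse) := by
  obtain rfl := rows_p hα
  obtain rfl := rows_p hγ
  rw [Bool.not_not] at hu hv
  obtain ⟨rfl, h2⟩ := hu.of_fit hfit
  obtain ⟨-, h3⟩ := hv.of_fit hfit'
  cases γ
  · simp only [oneLoop, step, Bool.not_true, Bool.not_false, Bool.false_eq_true, false_and,
      and_false, and_self, if_true, if_false, List.cons_append]
    rw [reverse_of_forall_eq_p (h2 rfl), reverse_of_forall_eq_p (h3 rfl)]
    ring
  · simp only [oneLoop, step, Bool.not_true, Bool.not_false, Bool.false_eq_true, false_and,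
      and_false, and_self, if_true, if_false, List.cons_append]
    rw [br_flip]
    ring

/-- An excess of `s` over `n` means that `u` goes from the lower row to the upper one. The first
vertical line is thus read from below and the second from above, and joining their lower ends splits
the loop. -/
theorem oneLoop_ppUnfit {α α' γ γ' : Bool} {u v : List Letter} (hα : p = step α (!α'))
    (hγ : p = step γ (!γ')) (hu : Walk (!α') u γ) (hlt : u.count n < u.count s) :
    oneLoop α α' γ γ' u v = br (n :: u) * br (s :: v) := by
  obtain rfl := rows_p hα
  obtain rfl := rows_p hγ
  have hc := hu.count
  cases α <;> cases γ <;> simp at hc <;> try omega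
  simp only [oneLoop, step, Bool.not_true, Bool.not_false, Bool.false_eq_true, false_and,
    and_false, and_self, if_true, if_false]
  ring

theorem twoLoops_ss {α α' γ γ' : Bool} {u v : List Letter} (hα : s = step α (!α'))
    (hγ : s = step γ (!γ')) : twoLoops α α' γ γ' u v =
      2 * (br (s :: u ++ s :: v) + br (s :: u ++ s :: v.reverse)) := by
  obtain ⟨rfl, rfl⟩ := rows_s hα
  obtain ⟨rfl, rfl⟩ := rows_s hγ
  simp only [twoLoops, step, Bool.not_true, and_self, if_true, List.cons_append]
  rw [br_cons_swap s s v, br_cons_swap s s v.reverse]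
  ring

/-- Each surgery occurs once, as there is one lower endpoint on the vertical line and there are two
on the arc. If the vertical line is read from above, `u` is a word in `p`, and reversing it only
exchanges the two summands. -/
theorem twoLoops_ps {α α' γ γ' : Bool} {u v : List Letter} (hα : p = step α (!α'))
    (hγ : s = step γ (!γ')) (hu : Walk (!α') u α) (hfit : Fit u) : twoLoops α α' γ γ' u v =
      br (p :: u ++ s :: v) + br (p :: u ++ s :: v.reverse) := by
  obtain rfl := rows_p hα
  obtain ⟨rfl, rfl⟩ := rows_s hγ
  rw [Bool.not_not] at hu
  obtain ⟨-, h2⟩ := hu.of_fit hfit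
  cases α
  · simp only [twoLoops, step, Bool.not_true, Bool.not_false, Bool.false_eq_true, false_and,
      and_self, if_true, if_false, List.cons_append]
    rw [← br_cons_reverse' p s v u, ← br_cons_reverse' p s v.reverse u, List.reverse_reverse,
      reverse_of_forall_eq_p (h2 rfl)]
    ring
  · simp only [twoLoops, step, Bool.not_true, Bool.not_false, Bool.false_eq_true, false_and,
      and_self, if_true, if_false, List.cons_append]
    rw [br_cons_swap s p v, br_cons_swap s p v.reverse]
    ring

/-- The directions of the two vertical lines are independent, and exactly one surgery joins the
lower ends. A loop whose line is read from above is a word in `p`, so all four cases give the same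
bracelet. -/
theorem twoLoops_pp {α α' γ γ' : Bool} {u v : List Letter} (hα : p = step α (!α'))
    (hγ : p = step γ (!γ')) (hu : Walk (!α') u α) (hv : Walk (!γ') v γ) (hfit : Fit u)
    (hfit' : Fit v) : twoLoops α α' γ γ' u v = br (n :: u ++ s :: v.reverse) := by
  obtain rfl := rows_p hα
  obtain rfl := rows_p hγ
  rw [Bool.not_not] at hu hv
  obtain ⟨-, h2⟩ := hu.of_fit hfit
  obtain ⟨-, h3⟩ := hv.of_fit hfit'
  cases α <;> cases γ <;>
    simp only [twoLoops, step, Bool.not_true, Bool.not_false, Bool.false_eq_true, false_and,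
      and_false, and_self, if_true, if_false, List.cons_append, add_zero, zero_add, one_mul,
      zero_mul]
  · rw [← br_cons_reverse', reverse_of_forall_eq_p (h2 rfl), List.reverse_reverse,
      reverse_of_forall_eq_p (h3 rfl)]
  · rw [← br_cons_reverse', reverse_of_forall_eq_p (h2 rfl)]
  · rw [br_cons_swap, reverse_of_forall_eq_p (h3 rfl)]
  · rw [br_cons_swap]

/-! ### Every monomial with two dots is covered by a rule -/

theorem map_undot_cons_append {A C : Letter} {u v : List Letter} (hu : Undotted u)
    (hv : Undotted v) :
    (A :: (u ++ C :: v)).map Letter.undot = A.undot :: (u ++ C.undot :: v) := by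
  rw [List.map_cons, List.map_append, List.map_cons, map_undot_eq_self hu, map_undot_eq_self hv]

theorem exists_walk_of_dotted {w : List Letter} (h : Bracelet.mk w ∈ dottedBracelets) :
    ∃ q, Walk q (w.map Letter.undot) q :=
  (mk_mem_plainBracelets.1 h).2

theorem Undotted.reverse {u : List Letter} (hu : Undotted u) : Undotted u.reverse :=
  fun a ha => hu a (List.mem_reverse.1 ha)

/-- If the vertical line is read from above, `u` need not be fit; the reversed spelling, in which
`I(v)` follows the dotted `p`, then satisfies the hypothesis. -/
theorem exists_rule_ps (δ : ℂ) {u v : List Letter} (hu : Undotted u) (hv : Undotted v)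
    (h : Bracelet.mk (pDot :: (u ++ sDot :: v)) ∈ dottedBracelets) :
    ∃ g, TraceRule δ (br (pDot :: (u ++ sDot :: v))) g := by
  obtain ⟨q, hq⟩ := exists_walk_of_dotted h
  rw [map_undot_cons_append hu hv, Letter.undot, Letter.undot, walk_p, walk_append] at hq
  obtain ⟨r, h1, h2⟩ := hq
  obtain ⟨rfl, h3⟩ := walk_s.1 h2
  cases q
  · replace h3 := h3.reverse
    rw [← mk_cons_reverse'] at h
    rw [← br_cons_reverse']
    exact ⟨_, TraceRule.ps v.reverse u.reverse hv.reverse hu.reverse h3.fit h⟩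
  · exact ⟨_, TraceRule.ps u v hu hv h1.fit h⟩

theorem exists_rule_one (δ : ℂ) {A C : Letter} {u v : List Letter} (hA : A.dots = 1)
    (hC : C.dots = 1) (hu : Undotted u) (hv : Undotted v)
    (h : Bracelet.mk (A :: (u ++ C :: v)) ∈ dottedBracelets) :
    ∃ g, TraceRule δ (br (A :: (u ++ C :: v))) g := by
  rcases eq_or_eq_of_dots hA with rfl | rfl <;> rcases eq_or_eq_of_dots hC with rfl | rfl
  · exact ⟨_, TraceRule.ss u v hu hv h⟩
  · rw [br_cons_swap]
    rw [mk_cons_swap] at h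
    exact exists_rule_ps δ hv hu h
  · exact exists_rule_ps δ hu hv h
  · obtain ⟨q, hq⟩ := exists_walk_of_dotted h
    rw [map_undot_cons_append hu hv, Letter.undot, walk_p, walk_append] at hq
    obtain ⟨r, h1, h2⟩ := hq
    rw [walk_p] at h2
    -- The cases are the directions of the two vertical lines. Both from above: reverse the
    -- bracelet. Opposite directions: one of the segments has more `s` than `n`, and it is put
    -- first. Both from below: the two segments are fit.
    cases q <;> cases r
    · rw [← mk_cons_reverse'] at h
      rw [← br_cons_reverse']
      exact ⟨_, TraceRule.pp v.reverse u.reverse hv.reverse hu.reverse h2.reverse.fit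
        h1.reverse.fit h⟩
    · rw [br_cons_swap]
      rw [mk_cons_swap] at h
      have hc := h2.count
      simp only [Bool.toNat_true, Bool.toNat_false] at hc
      exact ⟨_, TraceRule.ppUnfit v u hv hu (by omega) h⟩
    · have hc := h1.count
      simp only [Bool.toNat_true, Bool.toNat_false] at hc
      exact ⟨_, TraceRule.ppUnfit u v hu hv (by omega) h⟩
    · exact ⟨_, TraceRule.pp u v hu hv h1.fit h2.fit h⟩

theorem exists_fit {u : List Letter} (hu : Undotted u)
    (h : Bracelet.mk (pDot :: u) ∈ dottedBracelets) :
    ∃ u', Undotted u' ∧ Fit u' ∧ Bracelet.mk (pDot :: u') = Bracelet.mk (pDot :: u) := by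
  obtain ⟨q, hq⟩ := exists_walk_of_dotted h
  rw [List.map_cons, map_undot_eq_self hu, Letter.undot, walk_p] at hq
  cases q
  · exact ⟨u.reverse, hu.reverse, hq.reverse.fit, mk_cons_reverse _ _⟩
  · exact ⟨u, hu, hq.fit, rfl⟩

theorem exists_rule_p_s (δ : ℂ) {u v : List Letter} (hu : Undotted u) (hv : Undotted v)
    (h : Bracelet.mk (pDot :: u) ∈ dottedBracelets)
    (h' : Bracelet.mk (sDot :: v) ∈ dottedBracelets) :
    ∃ g, TraceRule δ (br (pDot :: u) * br (sDot :: v)) g := by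
  obtain ⟨u', h1, h2, h3⟩ := exists_fit hu h
  rw [← h3] at h
  rw [show br (pDot :: u) = br (pDot :: u') from congrArg X h3.symm]
  exact ⟨_, TraceRule.p_s u' v h1 hv h2 h h'⟩

theorem exists_rule_two (δ : ℂ) {A C : Letter} {u v : List Letter} (hA : A.dots = 1)
    (hC : C.dots = 1) (hu : Undotted u) (hv : Undotted v)
    (h : Bracelet.mk (A :: u) ∈ dottedBracelets) (h' : Bracelet.mk (C :: v) ∈ dottedBracelets) :
    ∃ g, TraceRule δ (br (A :: u) * br (C :: v)) g := by
  rcases eq_or_eq_of_dots hA with rfl | rfl <;> rcases eq_or_eq_of_dots hC with rfl | rfl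
  · exact ⟨_, TraceRule.s_s u v hu hv h h'⟩
  · rw [mul_comm]
    exact exists_rule_p_s δ hv hu h' h
  · exact exists_rule_p_s δ hu hv h h'
  · obtain ⟨u', h1, h2, h3⟩ := exists_fit hu h
    obtain ⟨v', h4, h5, h6⟩ := exists_fit hv h'
    rw [← h3] at h
    rw [← h6] at h'
    rw [show br (pDot :: u) = br (pDot :: u') from congrArg X h3.symm,
      show br (pDot :: v) = br (pDot :: v') from congrArg X h6.symm]
    exact ⟨_, TraceRule.p_p u' v' h1 h4 h2 h5 h h'⟩

end BraceletPoly

namespace BrauerDiagram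

open Letter BraceletPoly

variable {n : ℕ}

/-! ### Diagrams with two dotted lines -/

/-- The letter of the line through a node, with dots on the lines through `x` and `y`. -/
def dotted (b : BrauerDiagram n) (x y z : Fin n ⊕ Fin n) : Letter :=
  if z = x ∨ z = b.partner x ∨ z = y ∨ z = b.partner y then (b.letterAt z).dot else b.letterAt z

theorem letterAt_dots (b : BrauerDiagram n) (z : Fin n ⊕ Fin n) : (b.letterAt z).dots = 0 := by
  rw [letterAt_eq]
  generalize z.isRight = q
  generalize (!(b.partner z).isRight) = r
  cases q <;> cases r <;> rfl

theorem dotted_partner (b : BrauerDiagram n) (x y z : Fin n ⊕ Fin n) :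
    b.dotted x y (b.partner z) = b.dotted x y z := by
  unfold dotted
  rw [letterAt_partner]
  refine if_congr ?_ rfl rfl
  rw [b.partner_injective.eq_iff, b.partner_injective.eq_iff, b.partner_eq_iff, b.partner_eq_iff]
  tauto

theorem undot_dotted (b : BrauerDiagram n) (x y z : Fin n ⊕ Fin n) :
    (b.dotted x y z).undot = b.letterAt z := by
  unfold dotted
  split_ifs
  · exact undot_dot (b.letterAt_dots z)
  · exact undot_eq_self (b.letterAt_dots z)

theorem dotted_of_dots {b : BrauerDiagram n} {x y z : Fin n ⊕ Fin n}
    (h : (b.dotted x y z).dots ≠ 0) : z = x ∨ z = b.partner x ∨ z = y ∨ z = b.partner y := by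
  by_contra hz
  rw [dotted, if_neg hz] at h
  exact h (b.letterAt_dots z)

theorem dotted_ne (b : BrauerDiagram n) (x y z : Fin n ⊕ Fin n) : b.dotted x y z ≠ sDotDot := by
  have h := b.letterAt_dots z
  unfold dotted
  generalize b.letterAt z = a at h
  split_ifs <;> cases a <;> simp [dots, dot] at h ⊢

theorem map_letterAt_of_dotted {b : BrauerDiagram n} {x y : Fin n ⊕ Fin n}
    {U : List (Fin n ⊕ Fin n)} {u : List Letter} (h : U.map (b.dotted x y) = u)
    (hu : Undotted u) : U.map b.letterAt = u := by
  rw [← map_undot_eq_self hu, ← h, List.map_map]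
  exact List.map_congr_left fun z _ => (b.undot_dotted x y z).symm

/-- `lineTerm` depends on the unordered pair of lines only. As `a` and `c` lie on different lines,
they represent the two marked ones. -/
theorem lineTerm_of_mem (δ : ℂ) {b : BrauerDiagram n} {x y a c : Fin n ⊕ Fin n}
    (ha : a = x ∨ a = b.partner x ∨ a = y ∨ a = b.partner y)
    (hc : c = x ∨ c = b.partner x ∨ c = y ∨ c = b.partner y) (h : a ≠ c)
    (h' : b.partner a ≠ c) : lineTerm δ b x y = lineTerm δ b a c := by
  rcases ha with ha | ha | ha | ha <;> rcases hc with hc | hc | hc | hc <;>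
    first
    | (refine absurd ?_ h; rw [ha, hc]; done)
    | (refine absurd ?_ h'; rw [ha, hc]; done)
    | (refine absurd ?_ h'; rw [ha, hc, partner_partner]; done)
    | (simp only [ha, hc, lineTerm_partner_left, lineTerm_partner_right]; done)
    | (simp only [ha, hc, lineTerm_partner_left, lineTerm_partner_right]
       exact lineTerm_comm _ _ _ _)

/-- This transports a rule to a diagram: the loop is rotated or reversed until it spells the word of
the rule, and the dotted letters then locate the two marked lines. The rows of their endpoints come
with the walks that make the conditions on `u` and `v` effective. -/
theorem exists_oneLoop (δ : ℂ) {b : BrauerDiagram n} {x y : Fin n ⊕ Fin n}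
    {L : List (Fin n ⊕ Fin n)} {𝓡 : List (List (Fin n ⊕ Fin n))} (h : IsReading b (L :: 𝓡))
    {A C : Letter} {u v : List Letter}
    (hw : Bracelet.mk (L.map (b.dotted x y)) = Bracelet.mk (A :: (u ++ C :: v)))
    (hA : A.dots = 1) (hC : C.dots = 1) (hu : Undotted u) (hv : Undotted v) :
    ∃ α α' γ γ', A.undot = step α (!α') ∧ C.undot = step γ (!γ') ∧ Walk (!α') u γ ∧
      Walk (!γ') v α ∧ lineTerm δ b x y = oneLoop α α' γ γ' u v * readProd b.letterAt 𝓡 := by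
  obtain ⟨L', h1, h2, h3⟩ := (h.loop L List.mem_cons_self).exists_map_eq (b.dotted_partner x y) hw
  obtain ⟨a, T, rfl, ha, hT⟩ := List.map_eq_cons_iff.1 h3
  obtain ⟨U, T', rfl, hU, hT'⟩ := List.map_eq_append_iff.1 hT
  obtain ⟨c, V, rfl, hc, hV⟩ := List.map_eq_cons_iff.1 hT'
  have h := h.replace h1 h2
  have hne := lineNodes_nodup_cons h.nodup_one
  have hU' := map_letterAt_of_dotted hU hu
  have hV' := map_letterAt_of_dotted hV hv
  have hseg : Seg b (b.partner a) U c ∧ Seg b (b.partner c) V a := (seg_append b).1 h1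
  have hswap : ∀ z : Fin n ⊕ Fin n, z.swap.isRight = !z.isRight := by rintro (z | z) <;> rfl
  refine ⟨a.isRight, (b.partner a).isRight, c.isRight, (b.partner c).isRight, ?_, ?_, ?_, ?_, ?_⟩
  · rw [← ha, undot_dotted, letterAt_eq]
  · rw [← hc, undot_dotted, letterAt_eq]
  · rw [← hU', ← hswap]
    exact hseg.1.walk
  · rw [← hV', ← hswap]
    exact hseg.2.walk
  · rw [lineTerm_of_mem δ (dotted_of_dots (by rw [ha, hA]; exact one_ne_zero))
      (dotted_of_dots (by rw [hc, hC]; exact one_ne_zero)) hne.1 hne.2.1,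
      lineTerm_of_ne δ hne.1 hne.2.1, h.bracelets_surgery_one, h.bracelets_surgery_one', hU', hV',
      oneLoop]
    ring

theorem exists_twoLoops (δ : ℂ) {b : BrauerDiagram n} {x y : Fin n ⊕ Fin n}
    {L L' : List (Fin n ⊕ Fin n)} {𝓡 : List (List (Fin n ⊕ Fin n))}
    (h : IsReading b (L :: L' :: 𝓡)) {A C : Letter} {u v : List Letter}
    (hw : Bracelet.mk (L.map (b.dotted x y)) = Bracelet.mk (A :: u))
    (hw' : Bracelet.mk (L'.map (b.dotted x y)) = Bracelet.mk (C :: v))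
    (hA : A.dots = 1) (hC : C.dots = 1) (hu : Undotted u) (hv : Undotted v) :
    ∃ α α' γ γ', A.undot = step α (!α') ∧ C.undot = step γ (!γ') ∧ Walk (!α') u α ∧
      Walk (!γ') v γ ∧ lineTerm δ b x y = twoLoops α α' γ γ' u v * readProd b.letterAt 𝓡 := by
  obtain ⟨M, h1, h2, h3⟩ := (h.loop L (by simp)).exists_map_eq (b.dotted_partner x y) hw
  obtain ⟨M', h1', h2', h3'⟩ := (h.loop L' (by simp)).exists_map_eq (b.dotted_partner x y) hw'
  obtain ⟨a, U, rfl, ha, hU⟩ := List.map_eq_cons_iff.1 h3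
  obtain ⟨c, V, rfl, hc, hV⟩ := List.map_eq_cons_iff.1 h3'
  have h := (((h.replace h1 h2).perm (List.Perm.swap _ _ _)).replace h1' h2').perm
    (List.Perm.swap _ _ _)
  have hne := lineNodes_nodup_cons h.nodup_two
  have hU' := map_letterAt_of_dotted hU hu
  have hV' := map_letterAt_of_dotted hV hv
  have hswap : ∀ z : Fin n ⊕ Fin n, z.swap.isRight = !z.isRight := by rintro (z | z) <;> rfl
  refine ⟨a.isRight, (b.partner a).isRight, c.isRight, (b.partner c).isRight, ?_, ?_, ?_, ?_, ?_⟩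
  · rw [← ha, undot_dotted, letterAt_eq]
  · rw [← hc, undot_dotted, letterAt_eq]
  · rw [← hU', ← hswap]
    exact Seg.walk h1
  · rw [← hV', ← hswap]
    exact Seg.walk h1'
  · rw [lineTerm_of_mem δ (dotted_of_dots (by rw [ha, hA]; exact one_ne_zero))
      (dotted_of_dots (by rw [hc, hC]; exact one_ne_zero)) hne.1 hne.2.1,
      lineTerm_of_ne δ hne.1 hne.2.1, h.bracelets_surgery_two, h.bracelets_surgery_two', hU', hV',
      twoLoops]
    ring

theorem mk_eq_of_br_eq {w w' : List Letter} (h : br w = br w') :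
    Bracelet.mk w = Bracelet.mk w' := X_injective h

theorem br_ne_br_mul_br (w u v : List Letter) : br w ≠ br u * br v := by
  intro h
  have := perm_of_prod_map_X_eq (l := [Bracelet.mk w]) (l' := [Bracelet.mk u, Bracelet.mk v])
    (by simpa [br] using h)
  simpa using this.length_eq

theorem mk_eq_of_br_mul_br_eq {w w' u u' : List Letter} (h : br w * br w' = br u * br u') :
    Bracelet.mk w = Bracelet.mk u ∧ Bracelet.mk w' = Bracelet.mk u' ∨
      Bracelet.mk w' = Bracelet.mk u ∧ Bracelet.mk w = Bracelet.mk u' := by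
  have := perm_of_prod_map_X_eq (l := [Bracelet.mk w, Bracelet.mk w'])
    (l' := [Bracelet.mk u, Bracelet.mk u']) (by simpa [br] using h)
  have hmem : Bracelet.mk u ∈ [Bracelet.mk w, Bracelet.mk w'] := this.mem_iff.2 (by simp)
  simp only [List.mem_cons, List.not_mem_nil, or_false] at hmem
  rcases hmem with hmem | hmem
  · rw [hmem] at this
    exact Or.inl ⟨hmem.symm, by simpa using (List.perm_cons _).1 this⟩
  · rw [hmem] at this
    have := (List.perm_cons _).1 ((List.Perm.swap _ _ _).trans this)
    exact Or.inr ⟨hmem.symm, by simpa using this⟩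

/-- A rule applicable to one loop of a diagram with two dotted lines gives the sum over the lower
endpoints of the dotted lines. -/
theorem lineTerm_eq_of_rule_one {δ : ℂ} {b : BrauerDiagram n} {x y : Fin n ⊕ Fin n}
    {L : List (Fin n ⊕ Fin n)} {𝓡 : List (List (Fin n ⊕ Fin n))} (h : IsReading b (L :: 𝓡))
    {g : BraceletPoly} (hr : TraceRule δ (br (L.map (b.dotted x y))) g) :
    lineTerm δ b x y = g * readProd b.letterAt 𝓡 := by
  generalize hf : br (L.map (b.dotted x y)) = f at hr
  cases hr with
  | s2 u hu h' =>
    exfalso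
    have := (Bracelet.perm_of_rel (Quotient.exact (mk_eq_of_br_eq hf))).mem_iff (a := sDotDot)
    have := this.2 List.mem_cons_self
    obtain ⟨z, -, hz⟩ := List.mem_map.1 this
    exact b.dotted_ne x y z hz
  | ss u v hu hv h' =>
    obtain ⟨α, α', γ, γ', h1, h2, h3, h4, h5⟩ :=
      exists_oneLoop δ h (mk_eq_of_br_eq hf) rfl rfl hu hv
    rw [h5, oneLoop_ss h1 h2]
  | s_s => exact (br_ne_br_mul_br _ _ _ hf).elim
  | ps u v hu hv hfit h' =>
    obtain ⟨α, α', γ, γ', h1, h2, h3, h4, h5⟩ :=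
      exists_oneLoop δ h (mk_eq_of_br_eq hf) rfl rfl hu hv
    rw [h5, oneLoop_ps h1 h2 h3 hfit]
  | p_s => exact (br_ne_br_mul_br _ _ _ hf).elim
  | pp u v hu hv hfit hfit' h' =>
    obtain ⟨α, α', γ, γ', h1, h2, h3, h4, h5⟩ :=
      exists_oneLoop δ h (mk_eq_of_br_eq hf) rfl rfl hu hv
    rw [h5, oneLoop_pp h1 h2 h3 h4 hfit hfit']
  | ppUnfit u v hu hv hlt h' =>
    obtain ⟨α, α', γ, γ', h1, h2, h3, h4, h5⟩ :=
      exists_oneLoop δ h (mk_eq_of_br_eq hf) rfl rfl hu hv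
    rw [h5, oneLoop_ppUnfit h1 h2 h3 hlt]
  | p_p => exact (br_ne_br_mul_br _ _ _ hf).elim

/-- The analogous statement for dotted lines on two different loops. -/
theorem lineTerm_eq_of_rule_two {δ : ℂ} {b : BrauerDiagram n} {x y : Fin n ⊕ Fin n}
    {L L' : List (Fin n ⊕ Fin n)} {𝓡 : List (List (Fin n ⊕ Fin n))}
    (h : IsReading b (L :: L' :: 𝓡)) {g : BraceletPoly}
    (hr : TraceRule δ (br (L.map (b.dotted x y)) * br (L'.map (b.dotted x y))) g) :
    lineTerm δ b x y = g * readProd b.letterAt 𝓡 := by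
  have key : ∀ (A C : Letter) (u v : List Letter), A.dots = 1 → C.dots = 1 → Undotted u →
      Undotted v → br (L.map (b.dotted x y)) * br (L'.map (b.dotted x y)) =
        br (A :: u) * br (C :: v) →
      ∃ α α' γ γ', A.undot = step α (!α') ∧ C.undot = step γ (!γ') ∧ Walk (!α') u α ∧
        Walk (!γ') v γ ∧ lineTerm δ b x y = twoLoops α α' γ γ' u v * readProd b.letterAt 𝓡 := by
    intro A C u v hA hC hu hv hf
    rcases mk_eq_of_br_mul_br_eq hf with ⟨h1, h2⟩ | ⟨h1, h2⟩
    · exact exists_twoLoops δ h h1 h2 hA hC hu hv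
    · exact exists_twoLoops δ (h.perm (List.Perm.swap _ _ _)) h1 h2 hA hC hu hv
  generalize hf : br (L.map (b.dotted x y)) * br (L'.map (b.dotted x y)) = f at hr key
  cases hr with
  | s2 => exact (br_ne_br_mul_br _ _ _ hf.symm).elim
  | ss => exact (br_ne_br_mul_br _ _ _ hf.symm).elim
  | s_s u v hu hv h' h'' =>
    obtain ⟨α, α', γ, γ', h1, h2, h3, h4, h5⟩ := key _ _ u v rfl rfl hu hv rfl
    rw [h5, twoLoops_ss h1 h2]
  | ps => exact (br_ne_br_mul_br _ _ _ hf.symm).elim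
  | p_s u v hu hv hfit h' h'' =>
    obtain ⟨α, α', γ, γ', h1, h2, h3, h4, h5⟩ := key _ _ u v rfl rfl hu hv rfl
    rw [h5, twoLoops_ps h1 h2 h3 hfit]
  | pp => exact (br_ne_br_mul_br _ _ _ hf.symm).elim
  | ppUnfit => exact (br_ne_br_mul_br _ _ _ hf.symm).elim
  | p_p u v hu hv hfit hfit' h' h'' =>
    obtain ⟨α, α', γ, γ', h1, h2, h3, h4, h5⟩ := key _ _ u v rfl rfl hu hv rfl
    rw [h5, twoLoops_pp h1 h2 h3 h4 hfit hfit']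

theorem dotted_self_left (b : BrauerDiagram n) (x y : Fin n ⊕ Fin n) :
    b.dotted x y x = (b.letterAt x).dot := if_pos (Or.inl rfl)

theorem dotted_self_right (b : BrauerDiagram n) (x y : Fin n ⊕ Fin n) :
    b.dotted x y y = (b.letterAt y).dot := if_pos (Or.inr (Or.inr (Or.inl rfl)))

theorem map_dotted_of_nodup {b : BrauerDiagram n} {x y : Fin n ⊕ Fin n}
    {M U : List (Fin n ⊕ Fin n)} (h : (lineNodes b (x :: y :: M)).Nodup) (hU : ∀ z ∈ U, z ∈ M) :
    U.map (b.dotted x y) = U.map b.letterAt := by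
  refine List.map_congr_left fun z hz => if_neg ?_
  obtain ⟨h1, h2, h3, h4⟩ := (lineNodes_nodup_cons h).2.2 z (hU z hz)
  tauto

/-- Realising the dotted word by a diagram gives the rules a common value to be compared with, and
so proves them consistent. -/
theorem exists_diagram_one {A C : Letter} {u v : List Letter} (hA : A.dots = 1)
    (hC : C.dots = 1) (hu : Undotted u) (hv : Undotted v)
    (h : Bracelet.mk (A :: (u ++ C :: v)) ∈ Bracelet.dottedBracelets) :
    ∃ (n : ℕ) (b : BrauerDiagram n) (x y : Fin n ⊕ Fin n) (L : List (Fin n ⊕ Fin n)),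
      IsReading b [L] ∧ L.map (b.dotted x y) = A :: (u ++ C :: v) := by
  obtain ⟨n, hn⟩ : ∃ n, n = [(A :: (u ++ C :: v)).map undot].flatten.length := ⟨_, rfl⟩
  obtain ⟨b, 𝓛, h1, h2⟩ := exists_diagram [(A :: (u ++ C :: v)).map undot]
    (fun w hw => by rw [List.mem_singleton.1 hw]; exact h) hn
  obtain ⟨L, 𝓡, rfl, h3, h4⟩ := List.map_eq_cons_iff.1 h2
  obtain rfl := List.map_eq_nil_iff.1 h4
  rw [map_undot_cons_append hu hv] at h3
  obtain ⟨x, T, rfl, hx, hT⟩ := List.map_eq_cons_iff.1 h3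
  obtain ⟨U, T', rfl, hU, hT'⟩ := List.map_eq_append_iff.1 hT
  obtain ⟨y, V, rfl, hy, hV⟩ := List.map_eq_cons_iff.1 hT'
  have hnd := h1.nodup_one
  refine ⟨_, b, x, y, _, h1, ?_⟩
  rw [List.map_cons, List.map_append, List.map_cons, dotted_self_left, dotted_self_right, hx, hy,
    dot_undot hA, dot_undot hC, map_dotted_of_nodup hnd (fun z hz => by simp [hz]),
    map_dotted_of_nodup hnd (fun z hz => by simp [hz]), hU, hV]

theorem exists_diagram_two {A C : Letter} {u v : List Letter} (hA : A.dots = 1)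
    (hC : C.dots = 1) (hu : Undotted u) (hv : Undotted v)
    (h : Bracelet.mk (A :: u) ∈ Bracelet.dottedBracelets)
    (h' : Bracelet.mk (C :: v) ∈ Bracelet.dottedBracelets) :
    ∃ (n : ℕ) (b : BrauerDiagram n) (x y : Fin n ⊕ Fin n) (L L' : List (Fin n ⊕ Fin n)),
      IsReading b [L, L'] ∧ L.map (b.dotted x y) = A :: u ∧ L'.map (b.dotted x y) = C :: v := by
  obtain ⟨n, hn⟩ : ∃ n, n = [(A :: u).map undot, (C :: v).map undot].flatten.length := ⟨_, rfl⟩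
  obtain ⟨b, 𝓛, h1, h2⟩ := exists_diagram [(A :: u).map undot, (C :: v).map undot]
    (by
      intro w hw
      simp only [List.mem_cons, List.not_mem_nil, or_false] at hw
      rcases hw with rfl | rfl
      exacts [h, h']) hn
  obtain ⟨L, 𝓡, rfl, h3, h4⟩ := List.map_eq_cons_iff.1 h2
  obtain ⟨L', 𝓡, rfl, h5, h6⟩ := List.map_eq_cons_iff.1 h4
  obtain rfl := List.map_eq_nil_iff.1 h6
  rw [List.map_cons, map_undot_eq_self hu] at h3
  rw [List.map_cons, map_undot_eq_self hv] at h5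
  obtain ⟨x, U, rfl, hx, hU⟩ := List.map_eq_cons_iff.1 h3
  obtain ⟨y, V, rfl, hy, hV⟩ := List.map_eq_cons_iff.1 h5
  have hnd := h1.nodup_two
  refine ⟨_, b, x, y, _, _, h1, ?_, ?_⟩
  · rw [List.map_cons, dotted_self_left, hx, dot_undot hA, map_dotted_of_nodup hnd (fun z hz => by simp [hz]),
      hU]
  · rw [List.map_cons, dotted_self_right, hy, dot_undot hC, map_dotted_of_nodup hnd (fun z hz => by simp [hz]),
      hV]

theorem bracelets_mem_plain (b : BrauerDiagram n) : b.bracelets ∈ plain := by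
  obtain ⟨𝓛, h⟩ := b.exists_reading
  rw [← h.readProd_eq, readProd_eq_prod_map_X]
  refine Subalgebra.list_prod_mem _ fun f hf => ?_
  simp only [List.map_map, List.mem_map] at hf
  obtain ⟨L, hL, rfl⟩ := hf
  exact X_mem_supported.2 (h.loop L hL).mk_mem_plainBracelets

theorem nodeTerm_mem_plain (δ : ℂ) (b : BrauerDiagram n) (x y : Fin n ⊕ Fin n) :
    nodeTerm δ b x y ∈ plain := by
  unfold nodeTerm
  split_ifs
  · exact Subalgebra.smul_mem _ (bracelets_mem_plain _) _
  · exact zero_mem _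

theorem lineTerm_mem_plain (δ : ℂ) (b : BrauerDiagram n) (x y : Fin n ⊕ Fin n) :
    lineTerm δ b x y ∈ plain :=
  add_mem (add_mem (nodeTerm_mem_plain _ _ _ _) (nodeTerm_mem_plain _ _ _ _))
    (add_mem (nodeTerm_mem_plain _ _ _ _) (nodeTerm_mem_plain _ _ _ _))

end BrauerDiagram

/-! ### Consistency of the rules. -/

namespace BraceletPoly

open Letter Bracelet BrauerDiagram

theorem TraceRule.shape {δ : ℂ} {f g : BraceletPoly} (h : TraceRule δ f g) :
    (∃ u, Undotted u ∧ Bracelet.mk (sDotDot :: u) ∈ dottedBracelets ∧ f = br (sDotDot :: u)) ∨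
    (∃ A C u v, A.dots = 1 ∧ C.dots = 1 ∧ Undotted u ∧ Undotted v ∧
      Bracelet.mk (A :: (u ++ C :: v)) ∈ dottedBracelets ∧ f = br (A :: (u ++ C :: v))) ∨
    (∃ A C u v, A.dots = 1 ∧ C.dots = 1 ∧ Undotted u ∧ Undotted v ∧
      Bracelet.mk (A :: u) ∈ dottedBracelets ∧ Bracelet.mk (C :: v) ∈ dottedBracelets ∧
      f = br (A :: u) * br (C :: v)) := by
  cases h with
  | s2 u hu h => exact Or.inl ⟨u, hu, h, rfl⟩
  | ss u v hu hv h => exact Or.inr (Or.inl ⟨_, _, u, v, rfl, rfl, hu, hv, h, rfl⟩)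
  | s_s u v hu hv h h' => exact Or.inr (Or.inr ⟨_, _, u, v, rfl, rfl, hu, hv, h, h', rfl⟩)
  | ps u v hu hv _ h => exact Or.inr (Or.inl ⟨_, _, u, v, rfl, rfl, hu, hv, h, rfl⟩)
  | p_s u v hu hv _ h h' => exact Or.inr (Or.inr ⟨_, _, u, v, rfl, rfl, hu, hv, h, h', rfl⟩)
  | pp u v hu hv _ _ h => exact Or.inr (Or.inl ⟨_, _, u, v, rfl, rfl, hu, hv, h, rfl⟩)
  | ppUnfit u v hu hv _ h => exact Or.inr (Or.inl ⟨_, _, u, v, rfl, rfl, hu, hv, h, rfl⟩)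
  | p_p u v hu hv _ _ h h' => exact Or.inr (Or.inr ⟨_, _, u, v, rfl, rfl, hu, hv, h, h', rfl⟩)

/-- A doubly dotted letter excludes every other rule, and the remaining one has a right-hand side
that depends on the bracelet alone. -/
theorem rule_sDotDot {δ : ℂ} {w : List Letter} (hw : sDotDot ∈ w) {g : BraceletPoly}
    (h : TraceRule δ (br w) g) :
    g = C (2 * δ) * X (Bracelet.mk w).undot := by
  generalize hf : br w = f at h
  have key : ∀ A C u v, A.dots = 1 → C.dots = 1 → Undotted u → Undotted v →
      br w ≠ br (A :: (u ++ C :: v)) := by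
    intro A C u v hA hC hu hv h
    have := (perm_of_rel (Quotient.exact (mk_eq_of_br_eq h))).mem_iff.1 hw
    simp only [List.mem_cons, List.mem_append] at this
    rcases this with rfl | h | rfl | h
    · simp [Letter.dots] at hA
    · simpa [Letter.dots] using hu _ h
    · simp [Letter.dots] at hC
    · simpa [Letter.dots] using hv _ h
  cases h with
  | s2 u hu h =>
    rw [mk_eq_of_br_eq hf, undot_mk, List.map_cons, map_undot_eq_self hu]
    rfl
  | ss u v hu hv h => exact (key _ _ u v rfl rfl hu hv hf).elim
  | s_s => exact (br_ne_br_mul_br _ _ _ hf).elim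
  | ps u v hu hv _ h => exact (key _ _ u v rfl rfl hu hv hf).elim
  | p_s => exact (br_ne_br_mul_br _ _ _ hf).elim
  | pp u v hu hv _ _ h => exact (key _ _ u v rfl rfl hu hv hf).elim
  | ppUnfit u v hu hv _ h => exact (key _ _ u v rfl rfl hu hv hf).elim
  | p_p => exact (br_ne_br_mul_br _ _ _ hf).elim

/-- The rules are consistent, and their values lie in `ℂ[𝔟(𝒜)]`. -/
theorem TraceRule.exists_value {δ : ℂ} {f g : BraceletPoly} (h : TraceRule δ f g) :
    ∃ g₀ ∈ plain, ∀ g', TraceRule δ f g' → g' = g₀ := by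
  rcases h.shape with ⟨u, hu, hd, rfl⟩ | ⟨A, C, u, v, hA, hC, hu, hv, hd, rfl⟩ |
    ⟨A, C, u, v, hA, hC, hu, hv, hd, hd', rfl⟩
  · refine ⟨_, ?_, fun g' h' => rule_sDotDot List.mem_cons_self h'⟩
    rw [C_mul']
    exact Subalgebra.smul_mem _ (X_mem_supported.2
      (show (Bracelet.mk (sDotDot :: u)).undot ∈ plainBracelets from hd)) _
  -- The common value is the `lineTerm` of this diagram, whose definition involves neither the rules
  -- nor a representative of the bracelet.
  · obtain ⟨n, b, x, y, L, h1, h2⟩ := exists_diagram_one hA hC hu hv hd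
    refine ⟨_, lineTerm_mem_plain δ b x y, fun g' h' => ?_⟩
    rw [← h2] at h'
    rw [lineTerm_eq_of_rule_one h1 h']
    simp [readProd]
  · obtain ⟨n, b, x, y, L, L', h1, h2, h3⟩ := exists_diagram_two hA hC hu hv hd hd'
    refine ⟨_, lineTerm_mem_plain δ b x y, fun g' h' => ?_⟩
    rw [← h2, ← h3] at h'
    rw [lineTerm_eq_of_rule_two h1 h']
    simp [readProd]

theorem TraceRule.unique {δ : ℂ} {f g g' : BraceletPoly} (h : TraceRule δ f g)
    (h' : TraceRule δ f g') : g = g' := by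
  obtain ⟨g₀, -, h0⟩ := h.exists_value
  rw [h0 g h, h0 g' h']

theorem TraceRule.mem_plain {δ : ℂ} {f g : BraceletPoly} (h : TraceRule δ f g) : g ∈ plain := by
  obtain ⟨g₀, hg, h0⟩ := h.exists_value
  rwa [h0 g h]

end BraceletPoly

namespace BraceletPoly

open Letter Bracelet BrauerDiagram

/-! ### The trace -/

theorem mem_span_monomial {f : BraceletPoly} {S : Set (Bracelet →₀ ℕ)} (h : ∀ m ∈ f.support, m ∈ S) :
    f ∈ Submodule.span ℂ ((fun m => (monomial m 1 : BraceletPoly)) '' S) := by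
  rw [f.as_sum]
  refine Submodule.sum_mem _ fun m hm => ?_
  rw [← mul_one (coeff m f), ← smul_eq_mul, ← smul_monomial]
  exact Submodule.smul_mem _ _ (Submodule.subset_span ⟨m, h m hm, rfl⟩)

theorem mem_of_mem_supported {f : BraceletPoly} {S : Set Bracelet} (h : f ∈ supported ℂ S)
    {m : Bracelet →₀ ℕ} (hm : m ∈ f.support) : ∀ β ∈ m.support, β ∈ S := fun β hβ =>
  mem_supported.1 h (Finset.mem_coe.2 ((mem_vars_iff_mem_support β).2 ⟨m, hm, hβ⟩))

theorem monomial_mem_supported {m : Bracelet →₀ ℕ} {S : Set Bracelet} :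
    (monomial m 1 : BraceletPoly) ∈ supported ℂ S ↔ ∀ β ∈ m.support, β ∈ S := by
  rw [mem_supported, vars_monomial one_ne_zero]
  rfl

theorem weight_eq_of_mem {f : BraceletPoly} {w : Bracelet → ℕ} {k : ℕ}
    (h : f ∈ weightedHomogeneousSubmodule ℂ w k) {m : Bracelet →₀ ℕ} (hm : m ∈ f.support) :
    Finsupp.weight w m = k := h (mem_support_iff.1 hm)

theorem monomial_mem_weighted {m : Bracelet →₀ ℕ} {w : Bracelet → ℕ} {k : ℕ} :
    (monomial m 1 : BraceletPoly) ∈ weightedHomogeneousSubmodule ℂ w k ↔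
      Finsupp.weight w m = k := by
  constructor
  · classical
    refine fun h => weight_eq_of_mem h ?_
    rw [mem_support_iff, coeff_monomial, if_pos rfl]
    exact one_ne_zero
  · exact fun h => isWeightedHomogeneous_monomial w m 1 h

theorem exists_list_sum_single (m : Bracelet →₀ ℕ) :
    ∃ l : List Bracelet, m = (l.map fun β => Finsupp.single β 1).sum := by
  induction m using Finsupp.induction_linear with
  | zero => exact ⟨[], rfl⟩
  | add f g hf hg =>
    obtain ⟨l, rfl⟩ := hf
    obtain ⟨l', rfl⟩ := hg
    exact ⟨l ++ l', by rw [List.map_append, List.sum_append]⟩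
  | single β k => exact ⟨List.replicate k β, by simp⟩

theorem mem_support_sum_single {l : List Bracelet} {β : Bracelet} :
    β ∈ ((l.map fun β => Finsupp.single β 1).sum : Bracelet →₀ ℕ).support ↔ β ∈ l := by
  classical
  rw [Finsupp.mem_support_iff, sum_single_apply, Ne, List.count_eq_zero, not_not]

theorem weight_sum_single (w : Bracelet → ℕ) (l : List Bracelet) :
    Finsupp.weight w ((l.map fun β => Finsupp.single β 1).sum : Bracelet →₀ ℕ) = (l.map w).sum := by
  induction l with
  | nil => simp
  | cons β l ih => simp [ih, Finsupp.weight_single]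

theorem trace_monomial (δ : ℂ) (m : Bracelet →₀ ℕ) :
    trace δ (monomial m 1) = monomial (m.filter fun β => β.dots = 0) 1 *
      ruleValue δ (m.filter fun β => β.dots ≠ 0) := by
  have h : (monomial m 1 : BraceletPoly) = basisMonomials Bracelet ℂ m :=
    (congrFun (coe_basisMonomials Bracelet ℂ) m).symm
  exact (congrArg _ h).trans (Module.Basis.constr_basis _ _ _ _)

theorem ruleValue_eq {δ : ℂ} {m : Bracelet →₀ ℕ} {g : BraceletPoly}
    (h : TraceRule δ (monomial m 1) g) : ruleValue δ m = g := by
  have h' : ∃ g, TraceRule δ (monomial m 1) g := ⟨g, h⟩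
  rw [ruleValue, dif_pos h']
  exact h'.choose_spec.unique h

theorem ruleValue_mem_plain (δ : ℂ) (m : Bracelet →₀ ℕ) : ruleValue δ m ∈ plain := by
  by_cases h : ∃ g, TraceRule δ (monomial m 1) g
  · obtain ⟨g, hg⟩ := h
    rw [ruleValue_eq hg]
    exact hg.mem_plain
  · rw [ruleValue, dif_neg h]
    exact zero_mem _

theorem TraceRule.exists_list {δ : ℂ} {f g : BraceletPoly} (h : TraceRule δ f g) :
    ∃ l : List Bracelet, f = (l.map X).prod ∧ ∀ β ∈ l, β.dots ≠ 0 := by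
  rcases h.shape with ⟨u, hu, hd, rfl⟩ | ⟨A, C, u, v, hA, hC, hu, hv, hd, rfl⟩ |
    ⟨A, C, u, v, hA, hC, hu, hv, hd, hd', rfl⟩
  · exact ⟨[Bracelet.mk (sDotDot :: u)], by simp [br], by simp [dots_mk, Letter.dots]⟩
  · exact ⟨[Bracelet.mk (A :: (u ++ C :: v))], by simp [br], by simp [dots_mk, hA]⟩
  · exact ⟨[Bracelet.mk (A :: u), Bracelet.mk (C :: v)], by simp [br], by simp [dots_mk, hA, hC]⟩

theorem undot_of_dots_eq_zero {β : Bracelet} (h : β.dots = 0) : β.undot = β := by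
  induction β using Quotient.inductionOn with
  | h w =>
    change Bracelet.mk (w.map Letter.undot) = Bracelet.mk w
    rw [map_undot_eq_self]
    intro a ha
    exact List.sum_eq_zero_iff.1 h _ (List.mem_map_of_mem ha)

theorem exists_first_dotted {w : List Letter} (h : (w.map Letter.dots).sum ≠ 0) :
    ∃ u A v, w = u ++ A :: v ∧ Undotted u ∧ A.dots ≠ 0 := by
  induction w with
  | nil => simp at h
  | cons a w ih =>
    by_cases ha : a.dots = 0
    · obtain ⟨u, A, v, rfl, hu, hA⟩ := ih (by simpa [ha] using h)
      refine ⟨a :: u, A, v, rfl, ?_, hA⟩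
      intro c hc
      rcases List.mem_cons.1 hc with rfl | hc
      exacts [ha, hu c hc]
    · exact ⟨[], a, w, rfl, by simp [Undotted], ha⟩

theorem sum_dots_eq_zero {u : List Letter} (hu : Undotted u) : (u.map Letter.dots).sum = 0 := by
  rw [List.sum_eq_zero_iff]
  intro k hk
  obtain ⟨a, ha, rfl⟩ := List.mem_map.1 hk
  exact hu a ha

theorem undotted_of_sum_dots {u : List Letter} (h : (u.map Letter.dots).sum = 0) : Undotted u :=
  fun _ ha => List.sum_eq_zero_iff.1 h _ (List.mem_map_of_mem ha)

theorem Undotted.append {u v : List Letter} (hu : Undotted u) (hv : Undotted v) :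
    Undotted (u ++ v) := fun a ha => (List.mem_append.1 ha).elim (hu a) (hv a)

theorem exists_word_one_dot {β : Bracelet} (h : β.dots = 1) :
    ∃ A u, A.dots = 1 ∧ Undotted u ∧ β = Bracelet.mk (A :: u) := by
  induction β using Quotient.inductionOn with
  | h w =>
    change (w.map Letter.dots).sum = 1 at h
    obtain ⟨u, A, v, rfl, hu, hA⟩ := exists_first_dotted (by rw [h]; exact one_ne_zero)
    simp only [List.map_append, List.map_cons, List.sum_append, List.sum_cons,
      sum_dots_eq_zero hu] at h
    exact ⟨A, v ++ u, by omega, (undotted_of_sum_dots (by omega)).append hu, mk_append_comm _ _⟩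

theorem exists_word_two_dots {β : Bracelet} (h : β.dots = 2) :
    (∃ u, Undotted u ∧ β = Bracelet.mk (sDotDot :: u)) ∨
    (∃ A C u v, A.dots = 1 ∧ C.dots = 1 ∧ Undotted u ∧ Undotted v ∧
      β = Bracelet.mk (A :: (u ++ C :: v))) := by
  induction β using Quotient.inductionOn with
  | h w =>
    change (w.map Letter.dots).sum = 2 at h
    obtain ⟨u, A, v, rfl, hu, hA⟩ := exists_first_dotted (by rw [h]; exact two_ne_zero)
    simp only [List.map_append, List.map_cons, List.sum_append, List.sum_cons,
      sum_dots_eq_zero hu] at h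
    have hw : Bracelet.mk (u ++ A :: v) = Bracelet.mk (A :: (v ++ u)) := mk_append_comm _ _
    by_cases hv : (v.map Letter.dots).sum = 0
    · left
      have hA2 : A.dots = 2 := by omega
      refine ⟨v ++ u, (undotted_of_sum_dots hv).append hu, ?_⟩
      refine hw.trans ?_
      cases A <;> simp [Letter.dots] at hA2
      rfl
    · right
      obtain ⟨v₁, C, v₂, rfl, hv₁, hC⟩ := exists_first_dotted hv
      simp only [List.map_append, List.map_cons, List.sum_append, List.sum_cons,
        sum_dots_eq_zero hv₁] at h
      refine ⟨A, C, v₁, v₂ ++ u, by omega, by omega, hv₁,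
        (undotted_of_sum_dots (by omega)).append hu, hw.trans ?_⟩
      rw [List.append_assoc]
      rfl

/-- Every factor carries a dot and there are two dots, so the monomial is one bracelet with two dots
or a product of two bracelets with one dot each. -/
theorem exists_rule (δ : ℂ) {m : Bracelet →₀ ℕ} (h1 : ∀ β ∈ m.support, β ∈ dottedBracelets)
    (h2 : ∀ β ∈ m.support, β.dots ≠ 0) (h3 : Finsupp.weight Bracelet.dots m = 2) :
    ∃ g, TraceRule δ (monomial m 1) g := by
  obtain ⟨l, rfl⟩ := exists_list_sum_single m
  simp only [mem_support_sum_single] at h1 h2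
  rw [weight_sum_single] at h3
  rw [← prod_map_X_eq_monomial]
  rcases l with _ | ⟨β, _ | ⟨γ, _ | ⟨ε, l⟩⟩⟩
  · simp at h3
  · simp only [List.map_cons, List.map_nil, List.sum_cons, List.sum_nil, List.prod_cons,
      List.prod_nil, add_zero, mul_one] at h3 ⊢
    have hβ := h1 β (by simp)
    rcases exists_word_two_dots h3 with ⟨u, hu, rfl⟩ | ⟨A, C, u, v, hA, hC, hu, hv, rfl⟩
    · exact ⟨_, TraceRule.s2 u hu hβ⟩
    · exact exists_rule_one δ hA hC hu hv hβ
  · have hβ := h1 β (by simp)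
    have hγ := h1 γ (by simp)
    have hβ' := h2 β (by simp)
    have hγ' := h2 γ (by simp)
    simp only [List.map_cons, List.map_nil, List.sum_cons, List.sum_nil, List.prod_cons,
      List.prod_nil, add_zero, mul_one] at h3 ⊢
    obtain ⟨A, u, hA, hu, rfl⟩ := exists_word_one_dot (β := β) (by omega)
    obtain ⟨C, v, hC, hv, rfl⟩ := exists_word_one_dot (β := γ) (by omega)
    exact exists_rule_two δ hA hC hu hv hβ hγ
  · have hβ := h2 β (by simp)
    have hγ := h2 γ (by simp)
    have hε := h2 ε (by simp)
    simp only [List.map_cons, List.sum_cons] at h3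
    omega

/-- The exponents of the monomials in dotted bracelets with two dots. -/
def twoDotExponents : Set (Bracelet →₀ ℕ) :=
  {m | (∀ β ∈ m.support, β ∈ dottedBracelets) ∧ Finsupp.weight Bracelet.dots m = 2}

theorem mem_twoDotExponents {g : BraceletPoly} (h : g ∈ twoDots) :
    ∀ m ∈ g.support, m ∈ twoDotExponents :=
  fun _ hm => ⟨mem_of_mem_supported h.1 hm, weight_eq_of_mem h.2 hm⟩

theorem monomial_mem_twoDots {m : Bracelet →₀ ℕ} (h : m ∈ twoDotExponents) :
    (monomial m 1 : BraceletPoly) ∈ twoDots :=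
  ⟨monomial_mem_supported.2 h.1, monomial_mem_weighted.2 h.2⟩

theorem filter_plain {m : Bracelet →₀ ℕ} (h : m ∈ twoDotExponents) :
    (monomial (m.filter fun β => β.dots = 0) 1 : BraceletPoly) ∈ plain := by
  refine monomial_mem_supported.2 fun β hβ => ?_
  rw [Finsupp.support_filter, Finset.mem_filter] at hβ
  have := h.1 β hβ.1
  change β.undot ∈ plainBracelets at this
  rwa [undot_of_dots_eq_zero hβ.2] at this

theorem filter_twoDots {m : Bracelet →₀ ℕ} (h : m ∈ twoDotExponents) :
    (m.filter fun β => β.dots ≠ 0) ∈ twoDotExponents := by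
  constructor
  · intro β hβ
    rw [Finsupp.support_filter, Finset.mem_filter] at hβ
    exact h.1 β hβ.1
  · have h1 := h.2
    rw [← Finsupp.filter_add_filter_not m (fun β => β.dots = 0), map_add] at h1
    have h2 : Finsupp.weight Bracelet.dots (m.filter fun β => β.dots = 0) = 0 := by
      rw [Finsupp.weight_apply, Finsupp.sum]
      refine Finset.sum_eq_zero fun β hβ => ?_
      rw [Finsupp.support_filter, Finset.mem_filter] at hβ
      rw [hβ.2, smul_zero]
    rwa [h2, zero_add] at h1

theorem exists_rule_filter (δ : ℂ) {m : Bracelet →₀ ℕ} (h : m ∈ twoDotExponents) :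
    ∃ g, TraceRule δ (monomial (m.filter fun β => β.dots ≠ 0) 1) g := by
  have h' := filter_twoDots h
  refine exists_rule δ h'.1 (fun β hβ => ?_) h'.2
  rw [Finsupp.support_filter, Finset.mem_filter] at hβ
  exact hβ.2

theorem dots_eq_zero_of_plain {β : Bracelet} (h : β ∈ plainBracelets) : β.dots = 0 := by
  induction β using Quotient.inductionOn with
  | h w => exact sum_dots_eq_zero (h w rfl).2.1

/-- Bracelets in `𝔟(𝒜)` carry no dots. On monomials, `f` therefore enters only the undotted part and
leaves the value of the rules alone. -/
theorem trace_mul {δ : ℂ} {f g : BraceletPoly} (hf : f ∈ plain) (hg : g ∈ twoDots) :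
    trace δ (f * g) = f * trace δ g := by
  have hf' := mem_span_monomial (f := f) (S := {m | ∀ β ∈ m.support, β ∈ plainBracelets})
    fun m hm => mem_of_mem_supported hf hm
  have hg' := mem_span_monomial (mem_twoDotExponents hg)
  clear hf hg
  induction hf' using Submodule.span_induction with
  | zero => simp
  | add x y _ _ hx hy => rw [add_mul, map_add, hx, hy, add_mul]
  | smul a x _ hx => rw [smul_mul_assoc, map_smul, hx, smul_mul_assoc]
  | mem f hf =>
    obtain ⟨a, ha, rfl⟩ := hf
    have ha' : ∀ β ∈ a.support, β.dots = 0 := fun β hβ => dots_eq_zero_of_plain (ha β hβ)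
    induction hg' using Submodule.span_induction with
    | zero => simp
    | add x y _ _ hx hy => rw [mul_add, map_add, hx, hy, map_add, mul_add]
    | smul c x _ hx => rw [mul_smul_comm, map_smul, hx, map_smul, mul_smul_comm]
    | mem g hg =>
      obtain ⟨m, hm, rfl⟩ := hg
      have h1 : a.filter (fun β => β.dots = 0) = a :=
        (Finsupp.filter_eq_self_iff _ _).2 fun β hβ => ha' β (Finsupp.mem_support_iff.2 hβ)
      have h2 : a.filter (fun β => β.dots ≠ 0) = 0 := by
        refine (Finsupp.filter_eq_zero_iff _ _).2 fun β hβ => ?_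
        by_contra h
        exact hβ (ha' β (Finsupp.mem_support_iff.2 h))
      change trace δ (monomial a 1 * monomial m 1) = monomial a 1 * trace δ (monomial m 1)
      rw [monomial_mul, one_mul, trace_monomial, trace_monomial, Finsupp.filter_add,
        Finsupp.filter_add, h1, h2, zero_add, ← mul_assoc, monomial_mul, one_mul]

theorem trace_eq_of_rule {δ : ℂ} {f g : BraceletPoly} (h : TraceRule δ f g) : trace δ f = g := by
  obtain ⟨l, rfl, hl⟩ := h.exists_list
  rw [prod_map_X_eq_monomial] at h ⊢
  set m := (l.map fun β => Finsupp.single β 1).sum with hm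
  have hm' : ∀ β, m β ≠ 0 → β.dots ≠ 0 := fun β hβ =>
    hl β (mem_support_sum_single.1 (Finsupp.mem_support_iff.2 hβ))
  have h1 : m.filter (fun β => β.dots ≠ 0) = m := (Finsupp.filter_eq_self_iff _ _).2 hm'
  have h2 : m.filter (fun β => β.dots = 0) = 0 := by
    refine (Finsupp.filter_eq_zero_iff _ _).2 fun β hβ => ?_
    by_contra h
    exact hm' β h hβ
  rw [trace_monomial, h1, h2, ruleValue_eq h]
  simp

theorem isTrace_trace (δ : ℂ) : IsTrace δ (trace δ) where
  mem_plain g hg := by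
    have hg' := mem_span_monomial (mem_twoDotExponents hg)
    clear hg
    induction hg' using Submodule.span_induction with
    | zero => simp
    | add x y _ _ hx hy =>
      rw [map_add]
      exact add_mem hx hy
    | smul c x _ hx =>
      rw [map_smul]
      exact Subalgebra.smul_mem _ hx _
    | mem g hg =>
      obtain ⟨m, hm, rfl⟩ := hg
      change trace δ (monomial m 1) ∈ plain
      rw [trace_monomial]
      exact mul_mem (filter_plain hm) (ruleValue_mem_plain δ _)
  map_mul _ hf _ hg := trace_mul hf hg
  rule _ _ h := trace_eq_of_rule h

/-- Each monomial with two dots is an undotted monomial times one to which a rule applies, so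
linearity over `ℂ[𝔟(𝒜)]` and the rules leave no choice. -/
theorem IsTrace.eq_trace {δ : ℂ} {τ : BraceletPoly →ₗ[ℂ] BraceletPoly} (h : IsTrace δ τ)
    {g : BraceletPoly} (hg : g ∈ twoDots) : τ g = trace δ g := by
  have hg' := mem_span_monomial (mem_twoDotExponents hg)
  clear hg
  induction hg' using Submodule.span_induction with
  | zero => simp
  | add x y _ _ hx hy => rw [map_add, map_add, hx, hy]
  | smul c x _ hx => rw [map_smul, map_smul, hx]
  | mem g hg =>
    obtain ⟨m, hm, rfl⟩ := hg
    obtain ⟨g, hg⟩ := exists_rule_filter δ hm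
    have h1 : (monomial m 1 : BraceletPoly) = monomial (m.filter fun β => β.dots = 0) 1 *
        monomial (m.filter fun β => β.dots ≠ 0) 1 := by
      rw [monomial_mul, one_mul]
      exact congrArg (fun m => (monomial m 1 : BraceletPoly))
        (Finsupp.filter_add_filter_not m (fun β => β.dots = 0)).symm
    change τ (monomial m 1) = trace δ (monomial m 1)
    rw [h1, h.map_mul _ (filter_plain hm) _ (monomial_mem_twoDots (filter_twoDots hm)),
      trace_mul (filter_plain hm) (monomial_mem_twoDots (filter_twoDots hm)), h.rule _ _ hg,
      trace_eq_of_rule hg]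

end BraceletPoly

theorem Letter.undot_of_derivative {a a' : Letter} (h : a.derivative = some a') :
    a'.undot = a.undot := by
  cases a <;> simp only [Letter.derivative, Option.some.injEq, reduceCtorEq] at h <;> subst h <;> rfl

theorem Letter.dots_of_derivative {a a' : Letter} (h : a.derivative = some a') :
    a'.dots = a.dots + 1 := by
  cases a <;> simp only [Letter.derivative, Option.some.injEq, reduceCtorEq] at h <;> subst h <;> rfl

namespace BrauerDiagram

open Letter BraceletPoly

variable {n : ℕ}

/-! ### The second derivative of the bracelets of a diagram -/

section derivative

variable (φ : Fin n ⊕ Fin n → Letter)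

theorem map_update_of_notMem {L : List (Fin n ⊕ Fin n)} {x : Fin n ⊕ Fin n} (h : x ∉ L)
    (a : Letter) : L.map (Function.update φ x a) = L.map φ :=
  List.map_congr_left fun z hz => Function.update_of_ne (by rintro rfl; exact h hz) _ _

theorem readProd_update_of_notMem {𝓛 : List (List (Fin n ⊕ Fin n))} {x : Fin n ⊕ Fin n}
    (h : x ∉ 𝓛.flatten) (a : Letter) : readProd (Function.update φ x a) 𝓛 = readProd φ 𝓛 :=
  readProd_congr fun L hL z hz => Function.update_of_ne
    (by rintro rfl; exact h (List.mem_flatten.2 ⟨L, hL, hz⟩)) _ _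

theorem readProd_perm {𝓛 𝓛' : List (List (Fin n ⊕ Fin n))} (h : 𝓛.Perm 𝓛') :
    readProd φ 𝓛 = readProd φ 𝓛' := (h.map _).prod_eq

/-- Without repetitions, places in the word correspond to nodes, and deriving one letter amounts to
updating the labelling at one node. This turns `∂` into a sum over lines. -/
theorem sum_derivedWords {L : List (Fin n ⊕ Fin n)} (h : L.Nodup) (f : List Letter → BraceletPoly) :
    ((derivedWords (L.map φ)).map f).sum = (L.map fun x =>
      (φ x).derivative.elim 0 fun a => f (L.map (Function.update φ x a))).sum := by
  induction L generalizing f with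
  | nil => rfl
  | cons y L ih =>
    rw [List.nodup_cons] at h
    rw [List.map_cons, derivedWords, List.map_append, List.sum_append, List.map_map, List.map_map,
      ih h.2, List.map_cons, List.sum_cons]
    congr 1
    · cases (φ y).derivative with
      | none => rfl
      | some a => simp [map_update_of_notMem φ h.1]
    · congr 1
      refine List.map_congr_left fun x hx => ?_
      have hxy : y ≠ x := by rintro rfl; exact h.1 hx
      congr 1
      funext a
      simp [Function.update_of_ne hxy]

/-- The term of the derivative in which the letter at the node `x` is derived. -/
noncomputable def firstTerm (𝓛 : List (List (Fin n ⊕ Fin n))) (x : Fin n ⊕ Fin n) : BraceletPoly :=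
  (φ x).derivative.elim 0 fun a => readProd (Function.update φ x a) 𝓛

/-- The term of the second derivative in which the letters at `x` and then at `y` are derived. -/
noncomputable def secondTerm (𝓛 : List (List (Fin n ⊕ Fin n))) (x y : Fin n ⊕ Fin n) :
    BraceletPoly :=
  (φ x).derivative.elim 0 fun a => firstTerm (Function.update φ x a) 𝓛 y

theorem del_readProd {𝓛 : List (List (Fin n ⊕ Fin n))} (h : 𝓛.flatten.Nodup) :
    del (readProd φ 𝓛) = (𝓛.flatten.map (firstTerm φ 𝓛)).sum := by
  induction 𝓛 with
  | nil => simp [readProd]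
  | cons L 𝓛 ih =>
    rw [List.flatten_cons, List.nodup_append] at h
    obtain ⟨h1, h2, h3⟩ := h
    have hbr : del (br (L.map φ)) = ((derivedWords (L.map φ)).map br).sum := mkDerivation_X _ _ _
    rw [readProd_cons, Derivation.leibniz, ih h2, hbr, sum_derivedWords φ h1, List.flatten_cons,
      List.map_append, List.sum_append, add_comm, smul_eq_mul, smul_eq_mul,
      ← List.sum_map_mul_left, ← List.sum_map_mul_left]
    congr 2
    · refine List.map_congr_left fun x hx => ?_
      have hx' : x ∉ 𝓛.flatten := fun hx' => h3 x hx x hx' rfl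
      unfold firstTerm
      cases (φ x).derivative with
      | none => exact mul_zero _
      | some a =>
        rw [Option.elim_some, Option.elim_some, readProd_cons, readProd_update_of_notMem φ hx',
          mul_comm]
    · refine List.map_congr_left fun x hx => ?_
      have hx' : x ∉ L := fun hx' => h3 x hx' x hx rfl
      unfold firstTerm
      cases (φ x).derivative with
      | none => exact mul_zero _
      | some a => rw [Option.elim_some, Option.elim_some, readProd_cons, map_update_of_notMem φ hx']

theorem del_del_readProd {𝓛 : List (List (Fin n ⊕ Fin n))} (h : 𝓛.flatten.Nodup) :
    del (del (readProd φ 𝓛)) =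
      (𝓛.flatten.map fun x => (𝓛.flatten.map fun y => secondTerm φ 𝓛 x y).sum).sum := by
  rw [del_readProd φ h, map_list_sum, List.map_map]
  congr 1
  refine List.map_congr_left fun x _ => ?_
  rw [Function.comp_apply]
  unfold secondTerm
  rw [firstTerm]
  cases (φ x).derivative with
  | none => exact (map_zero _).trans (List.sum_eq_zero fun f hf => by
      obtain ⟨y, -, rfl⟩ := List.mem_map.1 hf
      rfl).symm
  | some a => exact del_readProd _ h

theorem sum_dots_update {F : List (Fin n ⊕ Fin n)} (hF : F.Nodup) {x : Fin n ⊕ Fin n} (hx : x ∈ F)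
    {a : Letter} (ha : a.dots = (φ x).dots + 1) :
    (F.map fun z => (Function.update φ x a z).dots).sum = (F.map fun z => (φ z).dots).sum + 1 := by
  induction F with
  | nil => simp at hx
  | cons y F ih =>
    rw [List.nodup_cons] at hF
    rw [List.map_cons, List.map_cons, List.sum_cons, List.sum_cons]
    by_cases hxy : y = x
    · subst hxy
      have : (F.map fun z => (Function.update φ y a z).dots) = F.map fun z => (φ z).dots :=
        List.map_congr_left fun z hz =>
          congrArg dots (Function.update_of_ne (by rintro rfl; exact hF.1 hz) _ _)
      rw [Function.update_self, this, ha]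
      omega
    · rw [ih hF.2 ((List.mem_cons.1 hx).resolve_left (Ne.symm hxy)), Function.update_of_ne hxy]
      omega

theorem readProd_mem_weighted (w : Bracelet → ℕ) (𝓛 : List (List (Fin n ⊕ Fin n))) :
    readProd φ 𝓛 ∈ weightedHomogeneousSubmodule ℂ w
      (𝓛.map fun L => w (Bracelet.mk (L.map φ))).sum := by
  rw [readProd_eq_prod_map_X, prod_map_X_eq_monomial, monomial_mem_weighted, weight_sum_single,
    List.map_map]
  rfl

end derivative

/-! ### The trace of the terms of the second derivative. -/

variable {b : BrauerDiagram n} {𝓛 : List (List (Fin n ⊕ Fin n))} {ψ : Fin n ⊕ Fin n → Letter}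

theorem mk_mem_dottedBracelets {L : List (Fin n ⊕ Fin n)} (h : Loop b L)
    (h' : ∀ x ∈ L, (ψ x).undot = b.letterAt x) :
    Bracelet.mk (L.map ψ) ∈ Bracelet.dottedBracelets := by
  change (Bracelet.mk (L.map ψ)).undot ∈ Bracelet.plainBracelets
  rw [Bracelet.undot_mk, List.map_map, List.map_congr_left (f := undot ∘ ψ) (g := b.letterAt) h']
  exact h.mk_mem_plainBracelets

theorem sum_map_dots_flatten (ψ : Fin n ⊕ Fin n → Letter) (𝓛 : List (List (Fin n ⊕ Fin n))) :
    (𝓛.map fun L => (Bracelet.mk (L.map ψ)).dots).sum =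
      (𝓛.flatten.map fun x => (ψ x).dots).sum := by
  induction 𝓛 with
  | nil => rfl
  | cons L 𝓛 ih =>
    rw [List.map_cons, List.sum_cons, ih, List.flatten_cons, List.map_append, List.sum_append,
      Bracelet.dots_mk, List.map_map]
    rfl

theorem readProd_mem_twoDots (h : ∀ L ∈ 𝓛, Loop b L)
    (h1 : ∀ x ∈ 𝓛.flatten, (ψ x).undot = b.letterAt x)
    (h2 : (𝓛.flatten.map fun x => (ψ x).dots).sum = 2) : readProd ψ 𝓛 ∈ twoDots := by
  constructor
  · refine Subalgebra.list_prod_mem _ fun f hf => ?_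
    obtain ⟨L, hL, rfl⟩ := List.mem_map.1 hf
    exact X_mem_supported.2 (mk_mem_dottedBracelets (h L hL)
      fun x hx => h1 x (List.mem_flatten.2 ⟨L, hL, hx⟩))
  · have := readProd_mem_weighted ψ Bracelet.dots 𝓛
    rwa [sum_map_dots_flatten, h2] at this

theorem secondTerm_mem_twoDots (h : IsReading b 𝓛) {x y : Fin n ⊕ Fin n} (hx : x ∈ 𝓛.flatten)
    (hy : y ∈ 𝓛.flatten) : secondTerm b.letterAt 𝓛 x y ∈ twoDots := by
  have hnd := nodup_of_lineNodes b h.nodup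
  unfold secondTerm
  cases ha : (b.letterAt x).derivative with
  | none => exact zero_mem _
  | some a =>
    rw [Option.elim_some, firstTerm]
    cases hc : (Function.update b.letterAt x a y).derivative with
    | none => exact zero_mem _
    | some c =>
      have h1 : ∀ z, (Function.update b.letterAt x a z).undot = b.letterAt z := by
        intro z
        rw [Function.update_apply]
        split_ifs with hz
        · rw [undot_of_derivative ha, hz, undot_eq_self (b.letterAt_dots x)]
        · exact undot_eq_self (b.letterAt_dots z)
      refine readProd_mem_twoDots h.loop (fun z _ => ?_) ?_
      · rw [Function.update_apply]
        split_ifs with hz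
        · rw [undot_of_derivative hc, h1, hz]
        · exact h1 z
      · rw [sum_dots_update _ hnd hy (dots_of_derivative hc),
          sum_dots_update _ hnd hx (dots_of_derivative ha), List.sum_eq_zero]
        intro k hk
        obtain ⟨z, -, rfl⟩ := List.mem_map.1 hk
        exact b.letterAt_dots z

theorem exists_perm_of_mem_flatten {x : Fin n ⊕ Fin n} (hx : x ∈ 𝓛.flatten) :
    ∃ L 𝓡, x ∈ L ∧ 𝓛.Perm (L :: 𝓡) := by
  obtain ⟨L, hL, hxL⟩ := List.mem_flatten.1 hx
  obtain ⟨𝓐, 𝓑, rfl⟩ := List.append_of_mem hL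
  exact ⟨L, 𝓐 ++ 𝓑, hxL, List.perm_middle⟩

theorem readProd_letterAt_mem_plain (h : ∀ L ∈ 𝓛, Loop b L) : readProd b.letterAt 𝓛 ∈ plain := by
  refine Subalgebra.list_prod_mem _ fun f hf => ?_
  obtain ⟨L, hL, rfl⟩ := List.mem_map.1 hf
  exact X_mem_supported.2 (h L hL).mk_mem_plainBracelets

/-- The two equal positions at an arc of the lower row. -/
theorem trace_secondTerm_self (δ : ℂ) (h : IsReading b 𝓛) {x : Fin n ⊕ Fin n}
    (hx : x ∈ 𝓛.flatten) (hs : b.letterAt x = s) :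
    trace δ (readProd (Function.update b.letterAt x sDotDot) 𝓛) = lineTerm δ b x x := by
  obtain ⟨L, 𝓡, hxL, hp⟩ := exists_perm_of_mem_flatten hx
  replace h := h.perm hp
  rw [readProd_perm _ hp, lineTerm_self δ hs, ← h.readProd_eq]
  obtain ⟨U, V, rfl⟩ := List.append_of_mem hxL
  have hnd := nodup_of_lineNodes b h.nodup
  rw [List.flatten_cons, List.append_assoc, List.cons_append,
    (List.perm_middle (a := x)).nodup_iff, List.nodup_cons] at hnd
  simp only [List.mem_append, not_or] at hnd
  obtain ⟨⟨hU, hV, hR⟩, -⟩ := hnd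
  have h1 : (U ++ x :: V).map (Function.update b.letterAt x sDotDot) =
      U.map b.letterAt ++ sDotDot :: V.map b.letterAt := by
    rw [List.map_append, List.map_cons, Function.update_self, map_update_of_notMem _ hU,
      map_update_of_notMem _ hV]
  have hL := h.loop _ List.mem_cons_self
  have hd : Bracelet.mk (U.map b.letterAt ++ sDotDot :: V.map b.letterAt) ∈
      Bracelet.dottedBracelets := by
    rw [← h1]
    refine mk_mem_dottedBracelets hL fun z _ => ?_
    rw [Function.update_apply]
    split_ifs with hz
    · rw [hz, hs]; rfl
    · exact undot_eq_self (b.letterAt_dots z)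
  have hund : Undotted (V.map b.letterAt ++ U.map b.letterAt) := by
    rw [← List.map_append]
    intro a ha
    obtain ⟨z, -, rfl⟩ := List.mem_map.1 ha
    exact b.letterAt_dots z
  rw [readProd_cons, h1, readProd_update_of_notMem _ hR, readProd_cons, List.map_append,
    List.map_cons, hs, mul_comm, ← mul_assoc, mul_comm _ (readProd _ _)]
  have hrot : ∀ a : Letter, br (U.map b.letterAt ++ a :: V.map b.letterAt) =
      br (a :: (V.map b.letterAt ++ U.map b.letterAt)) :=
    fun a => congrArg X (Bracelet.mk_append_comm _ _)
  have hd' := hd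
  rw [Bracelet.mk_append_comm] at hd'
  rw [trace_mul (readProd_letterAt_mem_plain fun M hM => h.loop M (List.mem_cons_of_mem _ hM)),
    hrot, hrot, trace_eq_of_rule (TraceRule.s2 _ hund hd')]
  refine ⟨X_mem_supported.2 hd, ?_⟩
  have := isWeightedHomogeneous_X ℂ Bracelet.dots
    (Bracelet.mk (U.map b.letterAt ++ sDotDot :: V.map b.letterAt))
  rw [Bracelet.dots_mk, List.map_append, List.map_cons, List.sum_append, List.sum_cons,
    sum_dots_eq_zero (u := U.map b.letterAt), sum_dots_eq_zero (u := V.map b.letterAt)] at this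
  · exact this
  · exact fun a ha => hund a (List.mem_append_left _ ha)
  · exact fun a ha => hund a (List.mem_append_right _ ha)

open Classical in
theorem sum_map_ite {L : List (Fin n ⊕ Fin n)} (h : L.Nodup) (x : Fin n ⊕ Fin n) :
    (L.map fun z => if z = x then 1 else 0).sum = if x ∈ L then 1 else 0 := by
  induction L with
  | nil => simp
  | cons y L ih =>
    rw [List.nodup_cons] at h
    rw [List.map_cons, List.sum_cons, ih h.2]
    by_cases hxy : y = x
    · subst hxy
      simp [h.1]
    · simp [hxy, Ne.symm hxy]

theorem dots_dot {a : Letter} (h : a = s ∨ a = p) : a.dot.dots = 1 := by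
  rcases h with rfl | rfl <;> rfl

section dotted

variable {x y : Fin n ⊕ Fin n}

/-- A reading contains only one end of each line, so the dots at the other ends are invisible. Thus
the symmetric labelling `dotted` agrees along the reading with the labelling produced by `∂²`. -/
theorem IsReading.dotted_eq (h : IsReading b 𝓛) (hx : x ∈ 𝓛.flatten) (hy : y ∈ 𝓛.flatten)
    {z : Fin n ⊕ Fin n} (hz : z ∈ 𝓛.flatten) :
    b.dotted x y z = if z = x ∨ z = y then (b.letterAt z).dot else b.letterAt z := by
  have hne : ∀ w ∈ 𝓛.flatten, z ≠ b.partner w := by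
    rintro w hw rfl
    have := (Multiset.nodup_add.1 h.nodup).2.2
    exact Multiset.disjoint_left.1 this (Multiset.mem_coe.2 hz)
      (Multiset.mem_coe.2 (List.mem_map_of_mem hw))
  unfold dotted
  refine if_congr ?_ rfl rfl
  have h1 := hne x hx
  have h2 := hne y hy
  tauto

open Classical in
theorem IsReading.sum_dots (h : IsReading b 𝓛) (hx : x ∈ 𝓛.flatten) (hy : y ∈ 𝓛.flatten)
    (hxy : x ≠ y) (hx' : b.letterAt x = s ∨ b.letterAt x = p)
    (hy' : b.letterAt y = s ∨ b.letterAt y = p) {L : List (Fin n ⊕ Fin n)}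
    (hL : ∀ z ∈ L, z ∈ 𝓛.flatten) (hL' : L.Nodup) :
    (L.map fun z => (b.dotted x y z).dots).sum =
      (if x ∈ L then 1 else 0) + if y ∈ L then 1 else 0 := by
  rw [← sum_map_ite hL', ← sum_map_ite hL', ← List.sum_map_add]
  congr 1
  refine List.map_congr_left fun z hz => ?_
  rw [h.dotted_eq hx hy (hL z hz)]
  by_cases hzx : z = x
  · subst hzx
    simp [hxy, dots_dot hx']
  · by_cases hzy : z = y
    · subst hzy
      simp [hzx, dots_dot hy']
    · simp [hzx, hzy, letterAt_dots]

theorem readProd_dotted_of_notMem (h : IsReading b 𝓛) (hx : x ∈ 𝓛.flatten) (hy : y ∈ 𝓛.flatten)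
    {𝓡 : List (List (Fin n ⊕ Fin n))} (hR : ∀ z ∈ 𝓡.flatten, z ∈ 𝓛.flatten) (h1 : x ∉ 𝓡.flatten)
    (h2 : y ∉ 𝓡.flatten) : readProd (b.dotted x y) 𝓡 = readProd b.letterAt 𝓡 := by
  refine readProd_congr fun L hL z hz => ?_
  have hz' : z ∈ 𝓡.flatten := List.mem_flatten.2 ⟨L, hL, hz⟩
  rw [h.dotted_eq hx hy (hR z hz'), if_neg]
  rintro (rfl | rfl)
  exacts [h1 hz', h2 hz']

/-- The loops without dots factor out of the trace. The rest is one loop with two dots or two loops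
with one dot each; some rule applies to it, and whichever it is, its value is the sum over the lower
endpoints. -/
theorem trace_readProd_dotted (δ : ℂ) (h : IsReading b 𝓛) (hx : x ∈ 𝓛.flatten)
    (hy : y ∈ 𝓛.flatten) (hxy : x ≠ y) (hx' : b.letterAt x = s ∨ b.letterAt x = p)
    (hy' : b.letterAt y = s ∨ b.letterAt y = p) :
    trace δ (readProd (b.dotted x y) 𝓛) = lineTerm δ b x y := by
  obtain ⟨L, 𝓡, hxL, hp⟩ := exists_perm_of_mem_flatten hx
  rw [readProd_perm _ hp]
  replace h := h.perm hp
  replace hx := hp.flatten.mem_iff.1 hx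
  replace hy := hp.flatten.mem_iff.1 hy
  clear hp
  have hnd := nodup_of_lineNodes b h.nodup
  rw [List.flatten_cons, List.nodup_append] at hnd
  have hxR : x ∉ 𝓡.flatten := fun hx' => hnd.2.2 x hxL x hx' rfl
  have hmem : ∀ M : List (Fin n ⊕ Fin n), Loop b M →
      Bracelet.mk (M.map (b.dotted x y)) ∈ Bracelet.dottedBracelets :=
    fun M hM => mk_mem_dottedBracelets hM fun z _ => b.undot_dotted x y z
  have hdots := fun M hM => h.sum_dots hx hy hxy hx' hy' (L := M) hM
  by_cases hyL : y ∈ L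
  · have hyR : y ∉ 𝓡.flatten := fun hy' => hnd.2.2 y hyL y hy' rfl
    have hL2 : (L.map fun z => (b.dotted x y z).dots).sum = 2 := by
      rw [hdots L (fun z hz => List.mem_append_left _ hz) hnd.1, if_pos hxL, if_pos hyL]
    obtain ⟨g, hg⟩ : ∃ g, TraceRule δ (br (L.map (b.dotted x y))) g := by
      have hm := hmem L (h.loop L List.mem_cons_self)
      have hd : (Bracelet.mk (L.map (b.dotted x y))).dots = 2 := by
        rw [Bracelet.dots_mk, List.map_map]
        exact hL2
      rcases exists_word_two_dots hd with ⟨u, hu, he⟩ | ⟨A, C, u, v, hA, hC, hu, hv, he⟩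
      · rw [br, he]
        rw [he] at hm
        exact ⟨_, TraceRule.s2 u hu hm⟩
      · rw [br, he]
        rw [he] at hm
        exact exists_rule_one δ hA hC hu hv hm
    rw [lineTerm_eq_of_rule_one h hg, readProd_cons, readProd_dotted_of_notMem h hx hy
      (fun z hz => List.mem_append_right _ hz) hxR hyR, mul_comm, trace_mul
      (readProd_letterAt_mem_plain fun M hM => h.loop M (List.mem_cons_of_mem _ hM)),
      trace_eq_of_rule hg, mul_comm]
    have := readProd_mem_twoDots (b := b) (𝓛 := [L]) (ψ := b.dotted x y)
      (fun M hM => h.loop M (by simp_all)) (fun z _ => b.undot_dotted x y z) (by simpa using hL2)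
    simpa [readProd] using this
  · have hyR : y ∈ 𝓡.flatten := (List.mem_append.1 hy).resolve_left hyL
    obtain ⟨L', 𝓡', hyL', hp'⟩ := exists_perm_of_mem_flatten hyR
    replace hp' := hp'.cons L
    rw [readProd_perm _ hp']
    have h' := h.perm hp'
    have hsub : ∀ z, z ∈ (L :: L' :: 𝓡').flatten → z ∈ (L :: 𝓡).flatten :=
      fun z hz => hp'.flatten.mem_iff.2 hz
    have hnd' := nodup_of_lineNodes b h'.nodup
    rw [List.flatten_cons, List.flatten_cons, List.nodup_append, List.nodup_append] at hnd'
    obtain ⟨h1, ⟨h2, -, h3⟩, h4⟩ := hnd'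
    have hxL' : x ∉ L' := fun hx' => h4 x hxL x (List.mem_append_left _ hx') rfl
    have hxR' : x ∉ 𝓡'.flatten := fun hx' => h4 x hxL x (List.mem_append_right _ hx') rfl
    have hyR' : y ∉ 𝓡'.flatten := fun hy' => h3 y hyL' y hy' rfl
    have hd1 : (L.map fun z => (b.dotted x y z).dots).sum = 1 := by
      rw [hdots L (fun z hz => hsub z (by simp [hz])) h1, if_pos hxL, if_neg hyL]
    have hd2 : (L'.map fun z => (b.dotted x y z).dots).sum = 1 := by
      rw [hdots L' (fun z hz => hsub z (by simp [hz])) h2, if_neg hxL', if_pos hyL']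
    obtain ⟨g, hg⟩ : ∃ g, TraceRule δ (br (L.map (b.dotted x y)) * br (L'.map (b.dotted x y))) g := by
      have hm1 := hmem L (h'.loop L (by simp))
      have hm2 := hmem L' (h'.loop L' (by simp))
      obtain ⟨A, u, hA, hu, he⟩ := exists_word_one_dot (β := Bracelet.mk (L.map (b.dotted x y)))
        (by rw [Bracelet.dots_mk, List.map_map]; exact hd1)
      obtain ⟨C, v, hC, hv, he'⟩ := exists_word_one_dot (β := Bracelet.mk (L'.map (b.dotted x y)))
        (by rw [Bracelet.dots_mk, List.map_map]; exact hd2)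
      rw [br, br, he, he']
      rw [he] at hm1
      rw [he'] at hm2
      exact exists_rule_two δ hA hC hu hv hm1 hm2
    rw [lineTerm_eq_of_rule_two h' hg, readProd_cons, readProd_cons, ← mul_assoc,
      readProd_dotted_of_notMem h hx hy (fun z hz => hsub z (by simp_all)) hxR' hyR',
      mul_comm, trace_mul (readProd_letterAt_mem_plain fun M hM => h'.loop M (by simp [hM])),
      trace_eq_of_rule hg, mul_comm]
    have := readProd_mem_twoDots (b := b) (𝓛 := [L, L']) (ψ := b.dotted x y)
      (fun M hM => h'.loop M (by
        simp only [List.mem_cons, List.not_mem_nil, or_false] at hM ⊢; tauto))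
      (fun z _ => b.undot_dotted x y z) (by simp [hd1, hd2])
    simpa [readProd] using this

end dotted

theorem rows_of_letterAt_n {x : Fin n ⊕ Fin n} (h : b.letterAt x = Letter.n) :
    x.isRight = false ∧ (b.partner x).isRight = false := by
  rw [letterAt_eq] at h
  cases h1 : x.isRight <;> cases h2 : (b.partner x).isRight <;> rw [h1, h2] at h <;>
    simp [step] at h ⊢

theorem rows_of_letterAt_p {x : Fin n ⊕ Fin n} (h : b.letterAt x = Letter.p) :
    (b.partner x).isRight = !x.isRight := by
  rw [letterAt_eq] at h
  cases h1 : x.isRight <;> cases h2 : (b.partner x).isRight <;> rw [h1, h2] at h <;>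
    simp [step] at h ⊢

/-- An upper arc has no lower endpoint. This corresponds to `∂(n) = 0`. -/
theorem lineTerm_of_letterAt_n (δ : ℂ) {x : Fin n ⊕ Fin n} (h : b.letterAt x = Letter.n)
    (y : Fin n ⊕ Fin n) : lineTerm δ b x y = 0 := by
  simp [lineTerm, nodeTerm, rows_of_letterAt_n h]

/-- A vertical line has one lower endpoint and hence no pair of different ones. This corresponds to
the vanishing derivative of a dotted `p`. -/
theorem lineTerm_self_of_letterAt_p (δ : ℂ) {x : Fin n ⊕ Fin n} (h : b.letterAt x = Letter.p) :
    lineTerm δ b x x = 0 := by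
  simp only [lineTerm, nodeTerm, rows_of_letterAt_p h]
  cases x.isRight <;> simp

theorem letterAt_cases (b : BrauerDiagram n) (x : Fin n ⊕ Fin n) :
    b.letterAt x = Letter.n ∨ b.letterAt x = s ∨ b.letterAt x = p := by
  have := b.letterAt_dots x
  cases h : b.letterAt x <;> simp [h, dots] at this ⊢

theorem derivative_eq_dot {a : Letter} (h : a = s ∨ a = p) : a.derivative = some a.dot := by
  rcases h with rfl | rfl <;> rfl

theorem trace_secondTerm (δ : ℂ) (h : IsReading b 𝓛) {x y : Fin n ⊕ Fin n} (hx : x ∈ 𝓛.flatten)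
    (hy : y ∈ 𝓛.flatten) : trace δ (secondTerm b.letterAt 𝓛 x y) = lineTerm δ b x y := by
  unfold secondTerm
  rcases b.letterAt_cases x with hx' | hx'
  · rw [lineTerm_of_letterAt_n δ hx', hx']
    exact map_zero _
  rw [derivative_eq_dot hx', Option.elim_some, firstTerm]
  by_cases hxy : x = y
  · subst hxy
    rw [Function.update_self]
    rcases hx' with hs | hp
    · rw [hs, ← trace_secondTerm_self δ h hx hs]
      simp [dot, derivative]
    · rw [hp, lineTerm_self_of_letterAt_p δ hp]
      exact map_zero _
  · rw [Function.update_of_ne (Ne.symm hxy)]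
    rcases b.letterAt_cases y with hy' | hy'
    · rw [lineTerm_comm, lineTerm_of_letterAt_n δ hy', hy']
      exact map_zero _
    · rw [derivative_eq_dot hy', Option.elim_some, ← trace_readProd_dotted δ h hx hy hxy hx' hy']
      congr 1
      refine readProd_congr fun L hL z hz => ?_
      rw [h.dotted_eq hx hy (List.mem_flatten.2 ⟨L, hL, hz⟩), Function.update_apply,
        Function.update_apply]
      by_cases hzy : z = y
      · simp [hzy]
      · by_cases hzx : z = x
        · subst hzx
          simp [hxy]
        · simp [hzy, hzx]

/-- Each line occurs once in a reading, so summing over nodes means summing both ends over the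
lines. -/
theorem IsReading.sum_eq {M : Type*} [AddCommMonoid M] (h : IsReading b 𝓛)
    (F : Fin n ⊕ Fin n → M) :
    ∑ z, F z = (𝓛.flatten.map fun x => F x + F (b.partner x)).sum := by
  rw [List.sum_map_add, Finset.sum, ← h.lineNodes_eq, lineNodes, Multiset.map_add,
    Multiset.sum_add, Multiset.map_coe, Multiset.map_coe, Multiset.sum_coe, Multiset.sum_coe,
    List.map_map]
  rfl

theorem del_del_bracelets_mem (b : BrauerDiagram n) : del (del b.bracelets) ∈ twoDots := by
  obtain ⟨𝓛, h⟩ := b.exists_reading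
  rw [← h.readProd_eq, del_del_readProd _ (nodup_of_lineNodes b h.nodup)]
  refine list_sum_mem fun f hf => ?_
  obtain ⟨x, hx, rfl⟩ := List.mem_map.1 hf
  refine list_sum_mem fun f hf => ?_
  obtain ⟨y, hy, rfl⟩ := List.mem_map.1 hf
  exact secondTerm_mem_twoDots h hx hy

/-- The terms of `∂²` are indexed by ordered pairs of lines, including equal ones, and `τ` expands
each into the pairs of endpoints. Together these are all ordered pairs of nodes, of which only pairs
of different lower nodes contribute. -/
theorem trace_del_del_bracelets (δ : ℂ) (b : BrauerDiagram n) :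
    trace δ (del (del b.bracelets)) = ∑ i, ∑ j, if i = j then 0 else
      BrauerAlgebra.arcScalar δ b (Sum.inr i) (Sum.inr j) •
        (surgery b (Sum.inr i) (Sum.inr j)).bracelets := by
  obtain ⟨𝓛, h⟩ := b.exists_reading
  have h1 : trace δ (del (del b.bracelets)) = ∑ x, ∑ y, nodeTerm δ b x y := by
    rw [← h.readProd_eq, del_del_readProd _ (nodup_of_lineNodes b h.nodup), map_list_sum,
      List.map_map, h.sum_eq]
    congr 1
    refine List.map_congr_left fun x hx => ?_
    rw [Function.comp_apply, map_list_sum, List.map_map, h.sum_eq, h.sum_eq, ← List.sum_map_add]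
    congr 1
    refine List.map_congr_left fun y hy => ?_
    rw [Function.comp_apply, trace_secondTerm δ h hx hy, lineTerm]
  rw [h1, Fintype.sum_sum_type]
  simp only [Fintype.sum_sum_type]
  simp [nodeTerm, ite_not]

end BrauerDiagram

namespace BrauerDiagram

open BraceletPoly

variable {n : ℕ}

/-! ### The bracelets of the conjugates of a diagram -/

theorem relabel_partner (s : Equiv.Perm (Fin n)) (b : BrauerDiagram n) (x : Fin n ⊕ Fin n) :
    (relabel s b).partner (Equiv.sumCongr s s x) = Equiv.sumCongr s s (b.partner x) :=
  conj_partner_apply _ _ _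

theorem letterAt_relabel (s : Equiv.Perm (Fin n)) (b : BrauerDiagram n) (x : Fin n ⊕ Fin n) :
    (relabel s b).letterAt (Equiv.sumCongr s s x) = b.letterAt x := by
  rw [letterAt_eq, letterAt_eq, relabel_partner]
  rcases x with x | x <;> rcases b.partner _ with y | y <;> rfl

theorem Loop.relabel {b : BrauerDiagram n} {L : List (Fin n ⊕ Fin n)} (h : Loop b L)
    (s : Equiv.Perm (Fin n)) : Loop (relabel s b) (L.map (Equiv.sumCongr s s)) := by
  rw [loop_iff] at h ⊢
  refine ⟨by simpa using h.1, ?_⟩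
  rw [← List.map_rotate, ← h.2, List.map_map, List.map_map]
  refine List.map_congr_left fun x _ => ?_
  simp only [Function.comp_apply, next, relabel_partner]
  rcases b.partner x with y | y <;> rfl

theorem IsReading.relabel {b : BrauerDiagram n} {𝓛 : List (List (Fin n ⊕ Fin n))}
    (h : IsReading b 𝓛) (s : Equiv.Perm (Fin n)) :
    IsReading (relabel s b) (𝓛.map (List.map (Equiv.sumCongr s s))) := by
  refine ⟨fun L hL => ?_, ?_⟩
  · obtain ⟨M, hM, rfl⟩ := List.mem_map.1 hL
    exact (h.loop M hM).relabel s
  · rw [← List.map_flatten, lineNodes, List.map_map,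
      List.map_congr_left (f := (BrauerDiagram.relabel s b).partner ∘ Equiv.sumCongr s s)
        (g := Equiv.sumCongr s s ∘ b.partner) fun x _ => relabel_partner s b x,
      ← List.map_map, ← Multiset.map_coe, ← Multiset.map_coe, ← Multiset.map_add]
    change Multiset.map _ (lineNodes b 𝓛.flatten) = _
    rw [h.lineNodes_eq]
    exact Multiset.map_univ_val_equiv _

theorem bracelets_relabel (s : Equiv.Perm (Fin n)) (b : BrauerDiagram n) :
    (relabel s b).bracelets = b.bracelets := by
  obtain ⟨𝓛, h⟩ := b.exists_reading
  rw [← h.readProd_eq, ← (h.relabel s).readProd_eq, readProd, readProd, List.map_map]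
  congr 1
  refine List.map_congr_left fun L _ => ?_
  rw [Function.comp_apply, List.map_map]
  congr 1
  exact List.map_congr_left fun x _ => letterAt_relabel s b x

/-! ### The monomials of degree `n` are the products of bracelets of the diagrams -/

theorem IsReading.length_flatten {b : BrauerDiagram n} {𝓛 : List (List (Fin n ⊕ Fin n))}
    (h : IsReading b 𝓛) : 𝓛.flatten.length = n := by
  have h1 := congrArg Multiset.card h.lineNodes_eq
  simp only [lineNodes, Multiset.card_add, Multiset.coe_card, List.length_map, Finset.card_val,
    Finset.card_univ, Fintype.card_sum, Fintype.card_fin] at h1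
  omega

theorem bracelets_mem_plainDegree (b : BrauerDiagram n) : b.bracelets ∈ plainDegree n := by
  refine ⟨bracelets_mem_plain b, ?_⟩
  obtain ⟨𝓛, h⟩ := b.exists_reading
  have := readProd_mem_weighted b.letterAt Bracelet.length 𝓛
  have hn : (𝓛.map fun L => (Bracelet.mk (L.map b.letterAt)).length).sum = n := by
    refine Eq.trans ?_ (List.length_flatten.symm.trans h.length_flatten)
    congr 1
    exact List.map_congr_left fun L _ => List.length_map (as := L) b.letterAt
  rwa [h.readProd_eq, hn] at this

theorem exists_bracelets_eq_monomial (b : BrauerDiagram n) :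
    ∃ m, b.bracelets = monomial m 1 := by
  obtain ⟨𝓛, h⟩ := b.exists_reading
  exact ⟨_, by rw [← h.readProd_eq, readProd_eq_prod_map_X, prod_map_X_eq_monomial]⟩

theorem exists_bracelets_eq {m : Bracelet →₀ ℕ} (h : monomial m (1 : ℂ) ∈ plainDegree n) :
    ∃ b : BrauerDiagram n, b.bracelets = monomial m 1 := by
  obtain ⟨l, rfl⟩ := exists_list_sum_single m
  have h1 := monomial_mem_supported.1 h.1
  have h2 := monomial_mem_weighted.1 h.2
  simp only [mem_support_sum_single] at h1
  rw [weight_sum_single] at h2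
  obtain ⟨out, hout⟩ : ∃ out : Bracelet → List Letter, ∀ β, Bracelet.mk (out β) = β :=
    ⟨Quotient.out, Quotient.out_eq⟩
  obtain ⟨b, 𝓛, h3, h4⟩ := exists_diagram (n := n) (l.map out) (fun w hw => by
    obtain ⟨β, hβ, rfl⟩ := List.mem_map.1 hw
    rw [hout]
    exact h1 β hβ) (by
    rw [← h2, List.length_flatten, List.map_map]
    congr 1
    exact List.map_congr_left fun β _ => (congrArg Bracelet.length (hout β)).symm)
  refine ⟨b, ?_⟩
  have h5 := congrArg (List.map Bracelet.mk) h4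
  rw [List.map_map, List.map_map, List.map_congr_left (f := Bracelet.mk ∘ out) (g := id) fun β _ => hout β,
    List.map_id] at h5
  rw [← h3.readProd_eq, readProd_eq_prod_map_X, ← prod_map_X_eq_monomial]
  conv_rhs => rw [← h5]
  rfl

/-- Through this inclusion the linear statements about polynomials of degree `n` reduce to products
of bracelets of diagrams. -/
theorem plainDegree_le_span :
    plainDegree n ≤ Submodule.span ℂ (Set.range (bracelets (n := n))) := by
  intro f hf
  refine Submodule.span_mono ?_ (mem_span_monomial
    (S := {m | (monomial m 1 : BraceletPoly) ∈ plainDegree n}) fun m hm => ?_)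
  · rintro _ ⟨m, hm, rfl⟩
    exact exists_bracelets_eq hm
  · exact ⟨monomial_mem_supported.2 (mem_of_mem_supported hf.1 hm),
      monomial_mem_weighted.2 (weight_eq_of_mem hf.2 hm)⟩

theorem del_del_mem_twoDots {ζ : BraceletPoly} (h : ζ ∈ plainDegree n) :
    del (del ζ) ∈ twoDots := by
  have h' := plainDegree_le_span h
  clear h
  induction h' using Submodule.span_induction with
  | zero => simp
  | add x y _ _ hx hy =>
    rw [map_add, map_add]
    exact add_mem hx hy
  | smul c x _ hx =>
    rw [Derivation.map_smul, Derivation.map_smul]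
    exact Submodule.smul_mem _ _ hx
  | mem x hx =>
    obtain ⟨b, rfl⟩ := hx
    exact del_del_bracelets_mem b

end BrauerDiagram

namespace BrauerAlgebra

open BraceletPoly BrauerDiagram

variable {n : ℕ} {δ : ℂ}

/-! ### The basis of the centraliser -/

theorem toBracelets_average (b : BrauerDiagram n) :
    toBracelets n δ (average δ b) = b.bracelets := by
  have h : ∀ b' : BrauerDiagram n, toBracelets n δ (diagram δ b') =
      (1 / (n.factorial : ℂ)) • b'.bracelets := fun b' =>
    (Finsupp.linearCombination_single ℂ 1 b').trans (one_smul _ _)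
  rw [average_eq, map_sum]
  simp only [h, bracelets_relabel]
  rw [Finset.sum_const, Finset.card_univ, Fintype.card_perm, Fintype.card_fin, ← Nat.cast_smul_eq_nsmul ℂ,
    smul_smul, mul_one_div_cancel (Nat.cast_ne_zero.2 n.factorial_ne_zero), one_smul]

/-- The diagram chosen in the definition of `e_ζ` may differ from `b`, but it has the same
bracelets. It is thus a renumbering of `b` and has the same average. -/
theorem ofBracelets_bracelets (b : BrauerDiagram n) :
    ofBracelets n δ b.bracelets = average δ b := by
  obtain ⟨m, hm⟩ := b.exists_bracelets_eq_monomial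
  have h : ∃ b : BrauerDiagram n, toBracelets n δ (average δ b) = monomial m 1 :=
    ⟨b, by rw [toBracelets_average, hm]⟩
  have h1 : ofBracelets n δ (monomial m 1) = average δ h.choose := by
    have e : (monomial m 1 : BraceletPoly) = basisMonomials Bracelet ℂ m :=
      (congrFun (coe_basisMonomials Bracelet ℂ) m).symm
    exact (congrArg _ e).trans ((Module.Basis.constr_basis _ _ _ _).trans (dif_pos h))
  have h2 := h.choose_spec
  rw [toBracelets_average] at h2
  obtain ⟨s, hs⟩ := exists_relabel_of_bracelets_eq (h2.trans hm.symm)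
  rw [hm, h1, ← average_relabel s, ← hs]

theorem toBracelets_ofBracelets {ζ : BraceletPoly} (h : ζ ∈ plainDegree n) :
    toBracelets n δ (ofBracelets n δ ζ) = ζ := by
  have h' := plainDegree_le_span h
  clear h
  induction h' using Submodule.span_induction with
  | zero => simp
  | add x y _ _ hx hy => rw [map_add, map_add, hx, hy]
  | smul c x _ hx => rw [map_smul, map_smul, hx]
  | mem x hx =>
    obtain ⟨b, rfl⟩ := hx
    rw [ofBracelets_bracelets, toBracelets_average]

theorem ofBracelets_mem_centraliser {ζ : BraceletPoly} (h : ζ ∈ plainDegree n) :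
    ofBracelets n δ ζ ∈ centraliser n δ := by
  have h' := plainDegree_le_span h
  clear h
  induction h' using Submodule.span_induction with
  | zero => simp
  | add x y _ _ hx hy =>
    rw [map_add]
    exact add_mem hx hy
  | smul c x _ hx =>
    rw [map_smul]
    exact Submodule.smul_mem _ _ hx
  | mem x hx =>
    obtain ⟨b, rfl⟩ := hx
    rw [ofBracelets_bracelets]
    exact average_mem_centraliser b

/-- `Φ` sends the `e_ζ` back to the different monomials `ζ`, whence independence. They span since
every average is some `e_ζ` and the averages span the centraliser. -/
theorem exists_basis (n : ℕ) (δ : ℂ) :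
    ∃ B : Module.Basis {m : Bracelet →₀ ℕ // monomial m (1 : ℂ) ∈ plainDegree n} ℂ
      (centraliser n δ), ∀ m, (B m : BrauerAlgebra n δ) = ofBracelets n δ (monomial m.1 1) := by
  let v : {m : Bracelet →₀ ℕ // monomial m (1 : ℂ) ∈ plainDegree n} → centraliser n δ :=
    fun m => ⟨ofBracelets n δ (monomial m.1 1), ofBracelets_mem_centraliser m.2⟩
  have hli : LinearIndependent ℂ v := by
    refine LinearIndependent.of_comp ((toBracelets n δ).comp (centraliser n δ).subtype) ?_
    have h : (toBracelets n δ).comp (centraliser n δ).subtype ∘ v =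
        basisMonomials Bracelet ℂ ∘ Subtype.val := by
      funext m
      simp only [Function.comp_apply, coe_basisMonomials]
      exact toBracelets_ofBracelets m.2
    rw [h]
    exact (basisMonomials Bracelet ℂ).linearIndependent.comp _ Subtype.val_injective
  have hsp : ⊤ ≤ Submodule.span ℂ (Set.range v) := by
    rintro u -
    have h1 : u.1 ∈ (Submodule.span ℂ (Set.range v)).map (centraliser n δ).subtype := by
      rw [Submodule.map_span]
      refine Submodule.span_mono ?_ (centraliser_le_span u.2)
      rintro _ ⟨b, rfl⟩
      obtain ⟨m, hm⟩ := b.exists_bracelets_eq_monomial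
      refine ⟨_, ⟨⟨m, hm ▸ bracelets_mem_plainDegree b⟩, rfl⟩, ?_⟩
      change ofBracelets n δ (monomial m 1) = _
      rw [← hm, ofBracelets_bracelets]
    obtain ⟨u', hu', h2⟩ := h1
    rwa [← Subtype.ext h2]
  exact ⟨Module.Basis.mk hli hsp, fun m => congrArg Subtype.val (Module.Basis.mk_apply hli hsp m)⟩

/-! ### The differential operator -/

/-- The operator `½ τ ∘ ∂²`. -/
noncomputable def halfTrace (δ : ℂ) : BraceletPoly →ₗ[ℂ] BraceletPoly :=
  (1 / 2 : ℂ) • (trace δ ∘ₗ (del : BraceletPoly →ₗ[ℂ] BraceletPoly) ∘ₗ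
    (del : BraceletPoly →ₗ[ℂ] BraceletPoly))

theorem halfTrace_apply (δ : ℂ) (ζ : BraceletPoly) :
    halfTrace δ ζ = (1 / 2 : ℂ) • trace δ (del (del ζ)) := rfl

theorem halfTrace_mem {ζ : BraceletPoly} (h : ζ ∈ plainDegree n) :
    halfTrace δ ζ ∈ plainDegree n := by
  have h' := plainDegree_le_span h
  clear h
  induction h' using Submodule.span_induction with
  | zero => simp
  | add x y _ _ hx hy =>
    rw [map_add]
    exact add_mem hx hy
  | smul c x _ hx =>
    rw [map_smul]
    exact Submodule.smul_mem _ _ hx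
  | mem x hx =>
    obtain ⟨b, rfl⟩ := hx
    rw [halfTrace_apply, trace_del_del_bracelets]
    refine Submodule.smul_mem _ _ (Submodule.sum_mem _ fun i _ => Submodule.sum_mem _ fun j _ => ?_)
    split_ifs
    · exact zero_mem _
    · exact Submodule.smul_mem _ _ (bracelets_mem_plainDegree _)

theorem arcSum_mul_ofBracelets {ζ : BraceletPoly} (h : ζ ∈ plainDegree n) :
    arcSum n δ * ofBracelets n δ ζ = ofBracelets n δ (halfTrace δ ζ) := by
  have h' := plainDegree_le_span h
  clear h
  rw [← mulBilin_apply]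
  induction h' using Submodule.span_induction with
  | zero => simp
  | add x y _ _ hx hy => simp only [map_add, hx, hy]
  | smul c x _ hx => simp only [map_smul, hx]
  | mem x hx =>
    obtain ⟨b, rfl⟩ := hx
    rw [ofBracelets_bracelets, mulBilin_apply, arcSum_mul_average, halfTrace_apply,
      trace_del_del_bracelets, map_smul, map_sum]
    simp only [map_sum, apply_ite (ofBracelets n δ), map_zero, map_smul, ofBracelets_bracelets]

end BrauerAlgebra

open BrauerAlgebra BraceletPoly in
theorem mainTheorem6 (n : ℕ) (δ : ℂ) :
    -- the rules define `τ` unambiguously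
    (IsTrace δ (trace δ) ∧ ∀ τ, IsTrace δ τ → ∀ g ∈ twoDots, τ g = trace δ g) ∧
    -- every average `γ_b` is `e_ζ` for the monic monomial `ζ = Φ(γ_b)`
    (∀ b : BrauerDiagram n, ∃ m : Bracelet →₀ ℕ, MvPolynomial.monomial m 1 ∈ plainDegree n ∧
      toBracelets n δ (average δ b) = MvPolynomial.monomial m 1 ∧
      ofBracelets n δ (MvPolynomial.monomial m 1) = average δ b) ∧
    -- the `e_ζ`, for monic monomials `ζ` of degree `n`, form a basis of `C_n(δ)`
    (∃ B : Module.Basis {m : Bracelet →₀ ℕ // MvPolynomial.monomial m (1 : ℂ) ∈ plainDegree n} ℂ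
        (centraliser n δ),
      ∀ m, (B m : BrauerAlgebra n δ) = ofBracelets n δ (MvPolynomial.monomial m.1 1)) ∧
    -- there is exactly one operator `Δ` with `A_n e_ζ = e_{Δ ζ}`, and it is `½ τ ∘ ∂²`
    (∀ ζ ∈ plainDegree n, del (del ζ) ∈ twoDots) ∧
    ∃ Δ : plainDegree n →ₗ[ℂ] plainDegree n,
      (∀ Δ' : plainDegree n →ₗ[ℂ] plainDegree n,
        (∀ ζ : plainDegree n, arcSum n δ * ofBracelets n δ ζ = ofBracelets n δ (Δ' ζ)) ↔ Δ' = Δ) ∧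
      ∀ ζ : plainDegree n, (Δ ζ : BraceletPoly) = (1 / 2 : ℂ) • trace δ (del (del ζ)) := by
  refine ⟨⟨isTrace_trace δ, fun τ hτ g hg => hτ.eq_trace hg⟩, fun b => ?_, exists_basis n δ,
    fun ζ hζ => BrauerDiagram.del_del_mem_twoDots hζ,
    (halfTrace δ).restrict fun ζ hζ => halfTrace_mem hζ, fun Δ' => ⟨fun h => ?_, ?_⟩, fun ζ => rfl⟩
  · obtain ⟨m, hm⟩ := b.exists_bracelets_eq_monomial
    refine ⟨m, ?_, ?_, ?_⟩
    · rw [← hm]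
      exact b.bracelets_mem_plainDegree
    · rw [← hm, toBracelets_average]
    · rw [← hm, ofBracelets_bracelets]
  · refine LinearMap.ext fun ζ => Subtype.ext ?_
    have h1 := (h ζ).symm.trans (arcSum_mul_ofBracelets ζ.2)
    -- Applying `Φ` recovers both polynomials from their images, so the operator is determined by
    -- `A_n`.
    have h2 := congrArg (toBracelets n δ) h1
    rwa [toBracelets_ofBracelets (Δ' ζ).2, toBracelets_ofBracelets (halfTrace_mem ζ.2)] at h2
  · rintro rfl ζ
    exact arcSum_mul_ofBracelets ζ.2
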